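/- Let $n\ge 1$, equip $\mathbb{R}^n$ with the $\ell^\infty$ metric $|x-y|$, and let $\mu$ be a Borel measure on $\mathbb{R}^n$. Assume that there are $\lambda\colon\mathbb{R}^n\times(0,\infty)\to(0,\infty)$ and a constant $C_\lambda$ such that, for all $x\in\mathbb{R}^n$ and $r>0$, $\mu(B(x,r))\le\lambda(x,r)$, the function $r\mapsto\lambda(x,r)$ is non-decreasing, and $\lambda(x,2r)\le C_\lambda\lambda(x,r)$. Let $\alpha>0$ and let $s_t(x,y)$, $t>0$, $x,y\in\mathbb{R}^n$, be a complex-valued kernel, jointly Borel measurable in $(t,x,y)$, such that for some constant $C_s$ $$|s_t(x,y)|\le C_s\,\frac{t^\alpha}{t^\alpha\lambda(x,t)+|x-y|^\alpha\lambda(x,|x-y|)}\quad\text{for all } t>0,\ x,y\in\mathbb{R}^n,$$ $$|s_t(x,y)-s_t(x,z)|\le C_s\,\frac{|y-z|^\alpha}{t^\alpha\lambda(x,t)+|x-y|^\alpha\lambda(x,|x-y|)}\quad\text{whenever } |y-z|<t/2,$$ where $|x-y|^\alpha\lambda(x,|x-y|)$ is read as $0$ if $x=y$. Put $$\theta_tf(x)=\int_{\mathbb{R}^n}s_t(x,y)f(y)\,d\mu(y).$$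 A cube is a set $Q=\prod_{i=1}^n[a_i,a_i+\ell(Q))$ with $\ell(Q)>0$; $3Q$ is the concentric cube with sidelength $3\ell(Q)$, and $\widehat Q=Q\times(0,\ell(Q))$. Assume that there are a function $b\in L^\infty(\mu)$, with $\|b\|_{L^\infty(\mu)}\le B$, and constants $c>0$ and $C_1$ such that for every cube $Q\subset\mathbb{R}^n$ $$\Big|\int_Qb\,d\mu\Big|\ge c\,\mu(Q)\qquad\text{and}\qquad\iint_{\widehat Q}|\theta_tb(x)|^2\,d\mu(x)\frac{dt}{t}\le C_1\,\mu(3Q).$$ Then for every $f\in L^2(\mu)$ the integral defining $\theta_tf(x)$ converges absolutely for all $x\in\mathbb{R}^n$ and $t>0$, and $$\iint_{\mathbb{R}^{n+1}_+}|\theta_tf(x)|^2\,d\mu(x)\frac{dt}{t}\le C\,\|f\|_{L^2(\mu)}^2,$$ where $C$ depends only on $n,\alpha,C_\lambda,C_s,B,c,C_1$. -/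

import Mathlib

open MeasureTheory Set
open scoped ENNReal

/-- The space `Fin n → ℝ` carries the `ℓ^∞` metric, so `Metric.ball` is an `ℓ^∞` ball.
`lam` is a positive, non-decreasing, doubling (with constant `Clam`) majorant of
`(x, r) ↦ μ (B(x, r))`. Only radii `r > 0` are constrained. -/
structure IsUpperDoubling {n : ℕ} (μ : Measure (Fin n → ℝ)) (lam : (Fin n → ℝ) → ℝ → ℝ)
    (Clam : ℝ) : Prop where
  pos : ∀ x r, 0 < r → 0 < lam x r
  mono : ∀ x, MonotoneOn (lam x) (Ioi 0)
  doubling : ∀ x r, 0 < r → lam x (2 * r) ≤ Clam * lam x r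
  measure_ball_le : ∀ x r, 0 < r → μ (Metric.ball x r) ≤ ENNReal.ofReal (lam x r)

/-- The common denominator `t^α lam(x,t) + |x-y|^α lam(x,|x-y|)` of the kernel estimates.
Since `α > 0`, the second summand is `0` when `x = y`, whatever `lam x 0` is. -/
noncomputable def kernelDenom {n : ℕ} (lam : (Fin n → ℝ) → ℝ → ℝ) (α t : ℝ)
    (x y : Fin n → ℝ) : ℝ :=
  t ^ α * lam x t + dist x y ^ α * lam x (dist x y)

/-- A family of kernels `s_t(x,y)`, `t > 0`, jointly measurable in `(t,x,y)`, with the size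
estimate and the Hölder estimate in the last variable, both with constant `Cs`. -/
structure IsSquareKernel {n : ℕ} (lam : (Fin n → ℝ) → ℝ → ℝ) (α Cs : ℝ)
    (s : ℝ → (Fin n → ℝ) → (Fin n → ℝ) → ℂ) : Prop where
  measurable : Measurable
    (fun p : Ioi (0 : ℝ) × (Fin n → ℝ) × (Fin n → ℝ) => s (p.1 : ℝ) p.2.1 p.2.2)
  size : ∀ t, 0 < t → ∀ x y, ‖s t x y‖ ≤ Cs * (t ^ α / kernelDenom lam α t x y)
  holder : ∀ t, 0 < t → ∀ x y z, dist y z < t / 2 →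
    ‖s t x y - s t x z‖ ≤ Cs * (dist y z ^ α / kernelDenom lam α t x y)

/-- `θ_t f(x) = ∫ s_t(x,y) f(y) dμ(y)`. -/
noncomputable def theta {n : ℕ} (μ : Measure (Fin n → ℝ))
    (s : ℝ → (Fin n → ℝ) → (Fin n → ℝ) → ℂ) (f : (Fin n → ℝ) → ℂ) (t : ℝ)
    (x : Fin n → ℝ) : ℂ :=
  ∫ y, s t x y * f y ∂μ

/-- The (half-open) cube with lower corner `a` and sidelength `l`. Its concentric dilate by
the factor `3` is `cube (fun i => a i - l) (3 * l)`. -/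
def cube {n : ℕ} (a : Fin n → ℝ) (l : ℝ) : Set (Fin n → ℝ) :=
  {x | ∀ i, x i ∈ Ico (a i) (a i + l)}

/-!
Fix a top scale `L` and a randomly translated dyadic grid with cells of sidelength `L / 2 ^ k`.
Accretivity on cubes makes `⟨f⟩ / ⟨b⟩ • b` an adapted conditional expectation on every generation,
so `f` splits into adapted differences that satisfy an `L²` square function estimate.

For a scale `t ≈ L / 2 ^ j` and a point `x` that stays away from the boundaries of the cells
containing it, the size and Hölder estimates show that `θ_t` of the `k`-th difference decays
geometrically in `|j - k|`: for `k > j` by cancellation, for `k ≤ j` because what remains after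
subtracting a multiple of `θ_t b` lives far from `x`. The multiples of `θ_t b` telescope to
`⟨f⟩ / ⟨b⟩ • θ_t b`, which the Carleson embedding theorem controls. There `μ` need not be
doubling, but points away from the boundary of a cell are covered by subcubes whose threefold
dilates stay in the cell and overlap boundedly, so `μ (3Q)` may be replaced by `μ Q`.

Every point is good for at least half of the translations, so averaging over them removes the
restriction to good points, and `L → ∞` by monotone convergence.
-/

open scoped NNReal

section Partition

variable {X ι : Type*}

lemma factorsThrough_of_le {π : ℕ → X → ι} (hπ : ∀ k, (π k).FactorsThrough (π (k + 1))) {k m : ℕ}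
    (hkm : k ≤ m) : (π k).FactorsThrough (π m) := by
  induction m, hkm using Nat.le_induction with
  | base => exact fun _ _ h => h
  | succ m _ ih => exact fun _ _ h => ih (hπ m h)

variable [MeasurableSpace X] {μ : Measure X}

lemma sq_lintegral_mul_le {c F : X → ℝ≥0∞} (hc : AEMeasurable c μ) (hF : AEMeasurable F μ) :
    (∫⁻ x, c x * F x ∂μ) ^ 2 ≤ (∫⁻ x, c x ∂μ) * ∫⁻ x, c x * F x ^ 2 ∂μ := by
  have sqrt_sq (a : ℝ≥0∞) : (a ^ (1 / 2 : ℝ)) ^ 2 = a := by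
    rw [← ENNReal.rpow_natCast, ← ENNReal.rpow_mul]
    norm_num
  have h := ENNReal.lintegral_mul_le_Lp_mul_Lq μ Real.HolderConjugate.two_two
    (f := fun x => c x ^ (1 / 2 : ℝ)) (g := fun x => c x ^ (1 / 2 : ℝ) * F x)
    (hc.pow_const _) ((hc.pow_const _).mul hF)
  simp only [Pi.mul_apply, ← mul_assoc, ← sq, ENNReal.rpow_ofNat, mul_pow, sqrt_sq] at h
  simpa only [mul_pow, sqrt_sq] using pow_le_pow_left' h 2

lemma sq_tsum_mul_le (c F : ℕ → ℝ≥0∞) :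
    (∑' k, c k * F k) ^ 2 ≤ (∑' k, c k) * ∑' k, c k * F k ^ 2 := by
  simpa only [lintegral_count] using sq_lintegral_mul_le (μ := Measure.count)
    (measurable_of_countable c).aemeasurable (measurable_of_countable F).aemeasurable

/-- The average of `g : X → [0, ∞]` over the cell of `x`, where the cells are the fibers of `π`.
It is `0` on cells of measure zero. -/
noncomputable def cellLAverage (μ : Measure X) (π : X → ι) (g : X → ℝ≥0∞) (x : X) : ℝ≥0∞ :=
  ⨍⁻ y in π ⁻¹' {π x}, g y ∂μ

lemma factorsThrough_cellLAverage (π : X → ι) (g : X → ℝ≥0∞) :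
    (cellLAverage μ π g).FactorsThrough π :=
  fun x y h => by simp only [cellLAverage, h]

variable [MeasurableSpace ι]

/-- A measurable partition of `X` into cells of finite measure, encoded by the map `π` that sends a
point to the index of its cell. -/
structure IsCellPartition (μ : Measure X) (π : X → ι) : Prop where
  measurable : Measurable π
  measure_cell_ne_top : ∀ i, μ (π ⁻¹' {i}) ≠ ∞

/-- A sequence of measurable partitions into cells of finite measure, each refining the previous
one; it plays the role of the dyadic filtration. -/
structure IsRefiningPartition (μ : Measure X) (π : ℕ → X → ι) : Prop where
  level : ∀ k, IsCellPartition μ (π k)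
  factorsThrough_succ : ∀ k, (π k).FactorsThrough (π (k + 1))

lemma IsRefiningPartition.shift {π : ℕ → X → ι} (hπ : IsRefiningPartition μ π) (k : ℕ) :
    IsRefiningPartition μ fun l => π (k + l) :=
  ⟨fun l => hπ.level (k + l), fun l => hπ.factorsThrough_succ (k + l)⟩

variable {π : X → ι}

lemma IsCellPartition.isFiniteMeasure_restrict (hπ : IsCellPartition μ π) (i : ι) :
    IsFiniteMeasure (μ.restrict (π ⁻¹' {i})) :=
  MeasureTheory.isFiniteMeasure_restrict.2 (hπ.measure_cell_ne_top i)

lemma IsCellPartition.integrableOn_cell {E : Type*} [NormedAddCommGroup E]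
    (hπ : IsCellPartition μ π) {f : X → E} (hf : MemLp f 2 μ) (i : ι) :
    IntegrableOn f (π ⁻¹' {i}) μ :=
  have := hπ.isFiniteMeasure_restrict i
  (hf.restrict _).integrable one_le_two

lemma IsCellPartition.sq_cellLAverage_le (hπ : IsCellPartition μ π) {g : X → ℝ≥0∞}
    (hg : AEMeasurable g μ) (x : X) :
    cellLAverage μ π g x ^ 2 ≤ cellLAverage μ π (fun x => g x ^ 2) x := by
  simp only [cellLAverage, setLAverage_eq]
  rcases eq_or_ne (μ (π ⁻¹' {π x})) 0 with h0 | h0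
  · simp [setLIntegral_measure_zero _ _ h0]
  have h := sq_lintegral_mul_le (μ := μ.restrict (π ⁻¹' {π x})) (c := 1) (F := g)
    aemeasurable_const hg.restrict
  simp only [Pi.one_apply, one_mul, lintegral_one, Measure.restrict_apply_univ] at h
  rw [ENNReal.div_eq_inv_mul, mul_pow, ENNReal.div_eq_inv_mul]
  set m := μ (π ⁻¹' {π x})
  calc m⁻¹ ^ 2 * (∫⁻ y in π ⁻¹' {π x}, g y ∂μ) ^ 2
      ≤ m⁻¹ ^ 2 * (m * ∫⁻ y in π ⁻¹' {π x}, g y ^ 2 ∂μ) := by gcongr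
    _ = (m⁻¹ * m) * (m⁻¹ * ∫⁻ y in π ⁻¹' {π x}, g y ^ 2 ∂μ) := by ring
    _ = _ := by rw [ENNReal.inv_mul_cancel h0 (hπ.measure_cell_ne_top _), one_mul]

variable [MeasurableSingletonClass ι]

lemma IsCellPartition.measurableSet_cell (hπ : IsCellPartition μ π) (i : ι) :
    MeasurableSet (π ⁻¹' {i}) :=
  hπ.measurable (measurableSet_singleton i)

lemma IsCellPartition.setLIntegral_cellLAverage (hπ : IsCellPartition μ π) (g : X → ℝ≥0∞) (i : ι) :
    ∫⁻ x in π ⁻¹' {i}, cellLAverage μ π g x ∂μ = ∫⁻ x in π ⁻¹' {i}, g x ∂μ := by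
  have := hπ.isFiniteMeasure_restrict i
  rw [← lintegral_laverage (μ.restrict (π ⁻¹' {i})) g]
  exact setLIntegral_congr_fun (hπ.measurableSet_cell i) fun x hx => by
    rw [cellLAverage, show π x = i from hx]

variable [Countable ι]

lemma stronglyMeasurable_of_factorsThrough {Y : Type*} [TopologicalSpace Y] [Nonempty Y]
    (hπ : Measurable π) {s : X → Y} (hs : s.FactorsThrough π) : StronglyMeasurable s := by
  obtain ⟨g, rfl⟩ := (Function.factorsThrough_iff s).1 hs
  exact StronglyMeasurable.of_discrete.comp_measurable hπ

lemma measurable_cellLAverage (hπ : Measurable π) (g : X → ℝ≥0∞) :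
    Measurable (cellLAverage μ π g) :=
  (stronglyMeasurable_of_factorsThrough hπ (factorsThrough_cellLAverage π g)).measurable

lemma lintegral_eq_tsum_cell (μ : Measure X) (hπ : Measurable π) (F : X → ℝ≥0∞) :
    ∫⁻ x, F x ∂μ = ∑' i, ∫⁻ x in π ⁻¹' {i}, F x ∂μ := by
  rw [← lintegral_iUnion fun i => hπ (measurableSet_singleton i)]
  · rw [← preimage_iUnion, iUnion_of_singleton, preimage_univ, Measure.restrict_univ]
  · exact fun i j h => Disjoint.preimage _ (by simpa using h)

lemma IsCellPartition.lintegral_mul_cellLAverage (hπ : IsCellPartition μ π) {s g : X → ℝ≥0∞}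
    (hs : s.FactorsThrough π) (hg : AEMeasurable g μ) :
    ∫⁻ x, s x * cellLAverage μ π g x ∂μ = ∫⁻ x, s x * g x ∂μ := by
  obtain ⟨σ, rfl⟩ := (Function.factorsThrough_iff s).1 hs
  have pull_out (F : X → ℝ≥0∞) (hF : AEMeasurable F μ) (i : ι) :
      ∫⁻ x in π ⁻¹' {i}, (σ ∘ π) x * F x ∂μ = σ i * ∫⁻ x in π ⁻¹' {i}, F x ∂μ := by
    rw [← lintegral_const_mul'' _ hF.restrict]
    exact setLIntegral_congr_fun (hπ.measurableSet_cell i) fun x hx => by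
      rw [Function.comp_apply, show π x = i from hx]
  rw [lintegral_eq_tsum_cell μ hπ.measurable, lintegral_eq_tsum_cell μ hπ.measurable]
  simp only [pull_out _ hg, pull_out _ (measurable_cellLAverage hπ.measurable g).aemeasurable,
    hπ.setLIntegral_cellLAverage]

lemma IsCellPartition.lintegral_sq_cellLAverage_le (hπ : IsCellPartition μ π) {g : X → ℝ≥0∞}
    (hg : AEMeasurable g μ) : ∫⁻ x, cellLAverage μ π g x ^ 2 ∂μ ≤ ∫⁻ x, g x ^ 2 ∂μ :=
  calc ∫⁻ x, cellLAverage μ π g x ^ 2 ∂μ ≤ ∫⁻ x, 1 * cellLAverage μ π (fun x => g x ^ 2) x ∂μ :=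
        lintegral_mono fun x => by simpa only [one_mul] using hπ.sq_cellLAverage_le hg x
    _ = ∫⁻ x, g x ^ 2 ∂μ := by
        rw [hπ.lintegral_mul_cellLAverage (fun _ _ _ => rfl) (hg.pow_const 2)]
        simp only [one_mul]

end Partition

section Carleson

variable {X ι : Type*} [MeasurableSpace X] {μ : Measure X} {π : ℕ → X → ι} {w : ℕ → X → ℝ≥0∞}
  {C : ℝ≥0∞}

/-- The normalized mass `μ(Q)⁻¹ ∑_{m ≥ k} ∫_Q w_m` of the weights below the level-`k` cell `Q` of
`x`; the Carleson condition says that it is at most `C`. -/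
noncomputable def carlesonMass (μ : Measure X) (π : ℕ → X → ι) (w : ℕ → X → ℝ≥0∞) (k : ℕ) (x : X) :
    ℝ≥0∞ :=
  ∑' l, cellLAverage μ (π k) (w (k + l)) x

/-- The functional `∫ ⟨g⟩² / (C + W)` at level `k`, with `W` the Carleson mass. Its increments along
the levels control the terms of the Carleson embedding (Bellman function method). -/
noncomputable def bellmanEnergy (μ : Measure X) (π : ℕ → X → ι) (w : ℕ → X → ℝ≥0∞) (C : ℝ≥0∞)
    (g : X → ℝ≥0∞) (k : ℕ) : ℝ≥0∞ :=
  ∫⁻ x, cellLAverage μ (π k) g x ^ 2 / (C + carlesonMass μ π w k x) ∂μ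

/-- The ratio `⟨g⟩ / (C + W)` at level `k`, with `W` the Carleson mass: the optimal multiplier in
the arithmetic-geometric mean inequality behind the growth of `bellmanEnergy`. -/
noncomputable def bellmanMultiplier (μ : Measure X) (π : ℕ → X → ι) (w : ℕ → X → ℝ≥0∞) (C : ℝ≥0∞)
    (g : X → ℝ≥0∞) (k : ℕ) (x : X) : ℝ≥0∞ :=
  cellLAverage μ (π k) g x / (C + carlesonMass μ π w k x)

lemma factorsThrough_carlesonMass (k : ℕ) : (carlesonMass μ π w k).FactorsThrough (π k) :=
  fun x y h => by simp only [carlesonMass, factorsThrough_cellLAverage _ _ h]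

lemma factorsThrough_bellmanMultiplier (g : X → ℝ≥0∞) (k : ℕ) :
    (bellmanMultiplier μ π w C g k).FactorsThrough (π k) := fun x y h => by
  simp only [bellmanMultiplier, factorsThrough_cellLAverage _ _ h, factorsThrough_carlesonMass k h]

lemma bellmanMultiplier_mul (hC : C ≠ 0) (hC' : C ≠ ∞) (hW : ∀ k x, carlesonMass μ π w k x ≤ C)
    (g : X → ℝ≥0∞) (k : ℕ) (x : X) :
    bellmanMultiplier μ π w C g k x * (C + carlesonMass μ π w k x) = cellLAverage μ (π k) g x :=
  ENNReal.div_mul_cancel (by simp [hC])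
    (ENNReal.add_ne_top.2 ⟨hC', ne_top_of_le_ne_top hC' (hW k x)⟩)

lemma carlesonMass_le
    (hcar : ∀ k i, ∑' l, ∫⁻ x in π k ⁻¹' {i}, w (k + l) x ∂μ ≤ C * μ (π k ⁻¹' {i})) (k : ℕ)
    (x : X) : carlesonMass μ π w k x ≤ C := by
  simp only [carlesonMass, cellLAverage, setLAverage_eq, ENNReal.div_eq_inv_mul]
  rw [ENNReal.tsum_mul_left]
  set m := μ (π k ⁻¹' {π k x})
  calc m⁻¹ * _ ≤ m⁻¹ * (C * m) := by gcongr; exact hcar k (π k x)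
    _ = C * (m⁻¹ * m) := by ring
    _ ≤ C := mul_le_of_le_one_right' (ENNReal.inv_mul_le_one _)

lemma two_mul_le_div_add_mul (u s : ℝ≥0∞) {p : ℝ≥0∞} (h0 : p ≠ 0) (h : p ≠ ∞) :
    2 * s * u ≤ u ^ 2 / p + s ^ 2 * p := by
  rcases eq_or_ne u ∞ with rfl | hu
  · simp [ENNReal.top_div, h]
  rcases eq_or_ne s ∞ with rfl | hs
  · simp [h0]
  lift u to ℝ≥0 using hu
  lift s to ℝ≥0 using hs
  lift p to ℝ≥0 using h
  have hp : p ≠ 0 := by simpa using h0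
  have amgm : 2 * s * u ≤ u ^ 2 / p + s ^ 2 * p :=
    calc 2 * s * u = 2 * (u / p) * s * p := by field_simp
      _ ≤ ((u / p) ^ 2 + s ^ 2) * p := by gcongr; exact two_mul_le_add_sq _ _
      _ = u ^ 2 / p + s ^ 2 * p := by field_simp
  rw [← ENNReal.coe_pow, ← ENNReal.coe_div hp]
  exact_mod_cast amgm

variable [MeasurableSpace ι] [Countable ι] [MeasurableSingletonClass ι]

namespace IsRefiningPartition

lemma lintegral_mul_carlesonMass (hπ : IsRefiningPartition μ π) (hw : ∀ k, Measurable (w k))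
    {s : X → ℝ≥0∞} {k : ℕ} (hs : s.FactorsThrough (π k)) :
    ∫⁻ x, s x * carlesonMass μ π w k x ∂μ = ∑' l, ∫⁻ x, s x * w (k + l) x ∂μ := by
  have hsm : Measurable s :=
    (stronglyMeasurable_of_factorsThrough (hπ.level k).measurable hs).measurable
  simp only [carlesonMass, ← ENNReal.tsum_mul_left]
  rw [lintegral_tsum fun l => (show Measurable fun x => s x * cellLAverage μ (π k) _ x from
    hsm.mul (measurable_cellLAverage (hπ.level k).measurable _)).aemeasurable]
  simp only [(hπ.level k).lintegral_mul_cellLAverage hs (hw _).aemeasurable]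

lemma lintegral_mul_carlesonMass_succ (hπ : IsRefiningPartition μ π) (hw : ∀ k, Measurable (w k))
    {s : X → ℝ≥0∞} {k : ℕ} (hs : s.FactorsThrough (π k)) :
    ∫⁻ x, s x * carlesonMass μ π w k x ∂μ
      = ∫⁻ x, s x * w k x ∂μ + ∫⁻ x, s x * carlesonMass μ π w (k + 1) x ∂μ := by
  rw [hπ.lintegral_mul_carlesonMass hw hs, hπ.lintegral_mul_carlesonMass hw
    (fun _ _ h => hs (hπ.factorsThrough_succ k h)), tsum_eq_zero_add' ENNReal.summable]
  simp only [add_zero, add_right_comm, add_assoc]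

lemma measurable_carlesonMass (hπ : IsRefiningPartition μ π) (k : ℕ) :
    Measurable (carlesonMass μ π w k) :=
  (stronglyMeasurable_of_factorsThrough (hπ.level k).measurable
    (factorsThrough_carlesonMass k)).measurable

lemma bellmanEnergy_le (hπ : IsRefiningPartition μ π) {g : X → ℝ≥0∞} (hg : AEMeasurable g μ)
    (hC : C ≠ 0) (k : ℕ) : bellmanEnergy μ π w C g k ≤ C⁻¹ * ∫⁻ x, g x ^ 2 ∂μ :=
  calc bellmanEnergy μ π w C g k ≤ ∫⁻ x, C⁻¹ * cellLAverage μ (π k) g x ^ 2 ∂μ :=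
        lintegral_mono fun x => by
          rw [ENNReal.div_eq_inv_mul]
          gcongr
          exact le_self_add
    _ = C⁻¹ * ∫⁻ x, cellLAverage μ (π k) g x ^ 2 ∂μ :=
        lintegral_const_mul' _ _ (ENNReal.inv_ne_top.2 hC)
    _ ≤ C⁻¹ * ∫⁻ x, g x ^ 2 ∂μ := by
        exact mul_le_mul_right ((hπ.level k).lintegral_sq_cellLAverage_le hg) _

lemma two_mul_lintegral_mul_le_bellmanEnergy (hπ : IsRefiningPartition μ π) (hC : C ≠ 0)
    (hC' : C ≠ ∞) {g s : X → ℝ≥0∞} (hg : AEMeasurable g μ) {k : ℕ} (hs : s.FactorsThrough (π k))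
    (hW : ∀ x, carlesonMass μ π w k x ≤ C) :
    2 * ∫⁻ x, s x * g x ∂μ
      ≤ bellmanEnergy μ π w C g k + ∫⁻ x, s x ^ 2 * (C + carlesonMass μ π w k x) ∂μ := by
  have hsm : Measurable s :=
    (stronglyMeasurable_of_factorsThrough (hπ.level k).measurable hs).measurable
  rw [← (hπ.level k).lintegral_mul_cellLAverage hs hg, bellmanEnergy,
    ← lintegral_const_mul' _ _ (by norm_num), ← lintegral_add_right _
    (show Measurable fun x => s x ^ 2 * (C + carlesonMass μ π w k x) from
      (hsm.pow_const 2).mul ((hπ.measurable_carlesonMass k).const_add C))]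
  refine lintegral_mono fun x => ?_
  rw [← mul_assoc]
  exact two_mul_le_div_add_mul _ _ (by simp [hC])
    (ENNReal.add_ne_top.2 ⟨hC', ne_top_of_le_ne_top hC' (hW x)⟩)

lemma bellmanEnergy_eq_lintegral_mul (hπ : IsRefiningPartition μ π) {g : X → ℝ≥0∞}
    (hg : AEMeasurable g μ) (k : ℕ) :
    bellmanEnergy μ π w C g k = ∫⁻ x, bellmanMultiplier μ π w C g k x * g x ∂μ := by
  rw [← (hπ.level k).lintegral_mul_cellLAverage (factorsThrough_bellmanMultiplier g k) hg]
  exact lintegral_congr fun x => by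
    simp only [bellmanMultiplier, sq, ENNReal.div_eq_inv_mul, mul_assoc]

lemma bellmanEnergy_eq_lintegral_sq_mul_succ (hπ : IsRefiningPartition μ π)
    (hw : ∀ k, Measurable (w k)) (hC : C ≠ 0) (hC' : C ≠ ∞)
    (hW : ∀ k x, carlesonMass μ π w k x ≤ C) (g : X → ℝ≥0∞) (k : ℕ) :
    bellmanEnergy μ π w C g k
      = ∫⁻ x, bellmanMultiplier μ π w C g k x ^ 2 * (C + carlesonMass μ π w (k + 1) x) ∂μ
        + ∫⁻ x, bellmanMultiplier μ π w C g k x ^ 2 * w k x ∂μ := by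
  set s := bellmanMultiplier μ π w C g k
  have hs2 : (fun x => s x ^ 2).FactorsThrough (π k) := fun x y h => by
    simp only [s, factorsThrough_bellmanMultiplier g k h]
  have hsm : Measurable fun x => s x ^ 2 :=
    (stronglyMeasurable_of_factorsThrough (hπ.level k).measurable hs2).measurable
  have energy_eq : bellmanEnergy μ π w C g k
      = ∫⁻ x, s x ^ 2 * (C + carlesonMass μ π w k x) ∂μ := lintegral_congr fun x => by
    rw [sq (s x), mul_assoc, bellmanMultiplier_mul hC hC' hW, sq, mul_comm (s x), mul_div_assoc]
    rfl
  rw [energy_eq]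
  simp only [mul_add, lintegral_add_left (hsm.mul_const C),
    hπ.lintegral_mul_carlesonMass_succ hw hs2]
  ring

lemma bellmanEnergy_add_le (hπ : IsRefiningPartition μ π) (hw : ∀ k, Measurable (w k)) (hC : C ≠ 0)
    (hC' : C ≠ ∞) (hW : ∀ k x, carlesonMass μ π w k x ≤ C) {g : X → ℝ≥0∞} (hg : AEMeasurable g μ)
    (hg2 : ∫⁻ x, g x ^ 2 ∂μ ≠ ∞) (k : ℕ) :
    bellmanEnergy μ π w C g k + ∫⁻ x, bellmanMultiplier μ π w C g k x ^ 2 * w k x ∂μ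
      ≤ bellmanEnergy μ π w C g (k + 1) := by
  have energy_ne_top : bellmanEnergy μ π w C g k ≠ ∞ := ne_top_of_le_ne_top
    (ENNReal.mul_ne_top (ENNReal.inv_ne_top.2 hC) hg2) (hπ.bellmanEnergy_le hg hC k)
  refine (ENNReal.add_le_add_iff_left energy_ne_top).1 ?_
  calc bellmanEnergy μ π w C g k
        + (bellmanEnergy μ π w C g k + ∫⁻ x, bellmanMultiplier μ π w C g k x ^ 2 * w k x ∂μ)
      = 2 * ∫⁻ x, bellmanMultiplier μ π w C g k x * g x ∂μ
        + ∫⁻ x, bellmanMultiplier μ π w C g k x ^ 2 * w k x ∂μ := by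
        rw [← hπ.bellmanEnergy_eq_lintegral_mul hg]
        ring
    _ ≤ bellmanEnergy μ π w C g (k + 1)
        + ∫⁻ x, bellmanMultiplier μ π w C g k x ^ 2 * (C + carlesonMass μ π w (k + 1) x) ∂μ
        + ∫⁻ x, bellmanMultiplier μ π w C g k x ^ 2 * w k x ∂μ := by
      gcongr
      exact hπ.two_mul_lintegral_mul_le_bellmanEnergy hC hC' hg (fun _ _ h =>
        factorsThrough_bellmanMultiplier g k (hπ.factorsThrough_succ k h)) (hW (k + 1))
    _ = bellmanEnergy μ π w C g k + bellmanEnergy μ π w C g (k + 1) := by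
      rw [hπ.bellmanEnergy_eq_lintegral_sq_mul_succ hw hC hC' hW g k]
      ring

theorem carleson_embedding (hπ : IsRefiningPartition μ π) (hw : ∀ k, Measurable (w k)) (hC : C ≠ 0)
    (hC' : C ≠ ∞) (hcar : ∀ k i, ∑' l, ∫⁻ x in π k ⁻¹' {i}, w (k + l) x ∂μ ≤ C * μ (π k ⁻¹' {i}))
    {g : X → ℝ≥0∞} (hg : AEMeasurable g μ) :
    ∑' k, ∫⁻ x, cellLAverage μ (π k) g x ^ 2 * w k x ∂μ ≤ 4 * C * ∫⁻ x, g x ^ 2 ∂μ := by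
  rcases eq_or_ne (∫⁻ x, g x ^ 2 ∂μ) ∞ with hg2 | hg2
  · simp [hg2, hC]
  have hW := carlesonMass_le hcar
  have term_le (k : ℕ) : ∫⁻ x, cellLAverage μ (π k) g x ^ 2 * w k x ∂μ
      ≤ (2 * C) ^ 2 * ∫⁻ x, bellmanMultiplier μ π w C g k x ^ 2 * w k x ∂μ := by
    rw [← lintegral_const_mul' _ _ (by finiteness)]
    refine lintegral_mono fun x => ?_
    rw [← mul_assoc, ← mul_pow, ← bellmanMultiplier_mul hC hC' hW, mul_comm (2 * C), two_mul C]
    gcongr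
    exact hW k x
  refine ENNReal.tsum_le_of_sum_range_le fun K => ?_
  have telescope : ∑ k ∈ Finset.range K, ∫⁻ x, cellLAverage μ (π k) g x ^ 2 * w k x ∂μ
      ≤ (2 * C) ^ 2 * bellmanEnergy μ π w C g K := by
    induction K with
    | zero => simp
    | succ K ih =>
      rw [Finset.sum_range_succ]
      refine (add_le_add ih (term_le K)).trans ?_
      rw [← mul_add]
      gcongr
      exact hπ.bellmanEnergy_add_le hw hC hC' hW hg hg2 K
  calc _ ≤ (2 * C) ^ 2 * (C⁻¹ * ∫⁻ x, g x ^ 2 ∂μ) := by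
        refine telescope.trans ?_
        gcongr
        exact hπ.bellmanEnergy_le hg hC K
    _ = 4 * C * (C * C⁻¹) * ∫⁻ x, g x ^ 2 ∂μ := by ring
    _ = _ := by rw [ENNReal.mul_inv_cancel hC hC', mul_one]

end IsRefiningPartition

end Carleson

section CellAverage

variable {X ι E : Type*} [MeasurableSpace X] {μ : Measure X} [NormedAddCommGroup E]

lemma eLpNorm_two_sq (f : X → E) : eLpNorm f 2 μ ^ 2 = ∫⁻ x, ‖f x‖ₑ ^ 2 ∂μ := by
  simpa using eLpNorm_nnreal_pow_eq_lintegral (f := f) (p := 2) (μ := μ) two_ne_zero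

lemma memLp_two_iff_lintegral {f : X → E} (hf : AEStronglyMeasurable f μ) :
    MemLp f 2 μ ↔ ∫⁻ x, ‖f x‖ₑ ^ 2 ∂μ < ∞ := by
  rw [← eLpNorm_two_sq, MemLp, and_iff_right hf, ENNReal.pow_lt_top_iff]
  simp

section NormedSpace

variable [NormedSpace ℝ E] {π π' : X → ι}

/-- The average of `f` over the cell of `x`, where the cells are the fibers of `π`. It is `0` on
cells of measure zero. -/
noncomputable def cellAverage (μ : Measure X) (π : X → ι) (f : X → E) (x : X) : E :=
  ⨍ y in π ⁻¹' {π x}, f y ∂μ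

lemma factorsThrough_cellAverage (π : X → ι) (f : X → E) :
    (cellAverage μ π f).FactorsThrough π :=
  fun x y h => by simp only [cellAverage, h]

lemma cellAverage_eq_zero {x : X} (h : μ (π ⁻¹' {π x}) = 0) (f : X → E) :
    cellAverage μ π f x = 0 := by
  rw [cellAverage, Measure.restrict_eq_zero.2 h, average_zero_measure]

lemma enorm_cellAverage_le (f : X → E) (x : X) :
    ‖cellAverage μ π f x‖ₑ ≤ cellLAverage μ π (fun y => ‖f y‖ₑ) x := by
  simpa only [cellAverage, average, cellLAverage, laverage] using
    enorm_integral_le_lintegral_enorm f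

variable [MeasurableSpace ι]

lemma IsCellPartition.measureReal_smul_cellAverage (hπ : IsCellPartition μ π) (f : X → E) (x : X) :
    μ.real (π ⁻¹' {π x}) • cellAverage μ π f x = ∫ y in π ⁻¹' {π x}, f y ∂μ := by
  have := hπ.isFiniteMeasure_restrict (π x)
  simpa only [cellAverage, Measure.real, Measure.restrict_apply_univ] using
    measure_smul_average (μ.restrict (π ⁻¹' {π x})) f

variable [MeasurableSingletonClass ι]

lemma IsCellPartition.setIntegral_cellAverage [CompleteSpace E] (hπ : IsCellPartition μ π)
    (f : X → E) (i : ι) :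
    ∫ x in π ⁻¹' {i}, cellAverage μ π f x ∂μ = ∫ x in π ⁻¹' {i}, f x ∂μ := by
  have := hπ.isFiniteMeasure_restrict i
  rw [← integral_average (μ.restrict (π ⁻¹' {i})) f]
  exact setIntegral_congr_fun (hπ.measurableSet_cell i) fun x hx => by
    rw [cellAverage, show π x = i from hx]

variable [Countable ι]

lemma stronglyMeasurable_cellAverage (hπ : Measurable π) (f : X → E) :
    StronglyMeasurable (cellAverage μ π f) :=
  stronglyMeasurable_of_factorsThrough hπ (factorsThrough_cellAverage π f)

lemma IsCellPartition.lintegral_enorm_cellAverage_sq_le (hπ : IsCellPartition μ π) {f : X → E}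
    (hf : AEStronglyMeasurable f μ) :
    ∫⁻ x, ‖cellAverage μ π f x‖ₑ ^ 2 ∂μ ≤ ∫⁻ x, ‖f x‖ₑ ^ 2 ∂μ :=
  (lintegral_mono fun x => by gcongr; exact enorm_cellAverage_le f x).trans
    (hπ.lintegral_sq_cellLAverage_le hf.enorm)

lemma IsCellPartition.memLp_cellAverage (hπ : IsCellPartition μ π) {f : X → E}
    (hf : MemLp f 2 μ) : MemLp (cellAverage μ π f) 2 μ :=
  (memLp_two_iff_lintegral (stronglyMeasurable_cellAverage hπ.measurable f).aestronglyMeasurable).2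
    ((hπ.lintegral_enorm_cellAverage_sq_le hf.1).trans_lt ((memLp_two_iff_lintegral hf.1).1 hf))

lemma setIntegral_cell_congr (hπ : Measurable π) (hπ' : Measurable π')
    (href : π.FactorsThrough π') {f g : X → E} {i : ι} (hf : IntegrableOn f (π ⁻¹' {i}) μ)
    (hg : IntegrableOn g (π ⁻¹' {i}) μ)
    (hfg : ∀ j, ∫ x in π' ⁻¹' {j}, f x ∂μ = ∫ x in π' ⁻¹' {j}, g x ∂μ) :
    ∫ x in π ⁻¹' {i}, f x ∂μ = ∫ x in π ⁻¹' {i}, g x ∂μ := by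
  have cell_eq : π ⁻¹' {i} = ⋃ j, π ⁻¹' {i} ∩ π' ⁻¹' {j} := by
    rw [← inter_iUnion, ← preimage_iUnion, iUnion_of_singleton, preimage_univ, inter_univ]
  have measurableSet_inter (j : ι) : MeasurableSet (π ⁻¹' {i} ∩ π' ⁻¹' {j}) :=
    (hπ (measurableSet_singleton i)).inter (hπ' (measurableSet_singleton j))
  have disjoint_inter : Pairwise (Function.onFun Disjoint fun j => π ⁻¹' {i} ∩ π' ⁻¹' {j}) :=
    fun j k h => (Disjoint.preimage π' (by simpa using h : Disjoint {j} {k})).mono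
      inter_subset_right inter_subset_right
  rw [cell_eq] at hf hg ⊢
  rw [integral_iUnion measurableSet_inter disjoint_inter hf,
    integral_iUnion measurableSet_inter disjoint_inter hg]
  refine tsum_congr fun j => ?_
  rcases (π ⁻¹' {i} ∩ π' ⁻¹' {j}).eq_empty_or_nonempty with hempty | ⟨x, rfl, rfl⟩
  · simp only [hempty, setIntegral_empty]
  · have : π' ⁻¹' {π' x} ⊆ π ⁻¹' {π x} := fun y hy => href hy
    rw [inter_eq_right.2 this, hfg]

lemma IsCellPartition.cellAverage_cellAverage [CompleteSpace E] (hπ : IsCellPartition μ π)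
    (hπ' : IsCellPartition μ π') (href : π.FactorsThrough π') {f : X → E} (hf : MemLp f 2 μ) :
    cellAverage μ π (cellAverage μ π' f) = cellAverage μ π f := by
  ext x
  rw [cellAverage, cellAverage, setAverage_eq, setAverage_eq,
    setIntegral_cell_congr hπ.measurable hπ'.measurable href
      (hπ.integrableOn_cell (hπ'.memLp_cellAverage hf) _) (hπ.integrableOn_cell hf _)
      (hπ'.setIntegral_cellAverage f)]

end NormedSpace

section InnerProductSpace

variable [InnerProductSpace ℝ E] [CompleteSpace E]

lemma lintegral_enorm_sub_average_sq [IsFiniteMeasure μ] {f : X → E} (hf : MemLp f 2 μ) :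
    ∫⁻ x, ‖f x - ⨍ y, f y ∂μ‖ₑ ^ 2 ∂μ + ∫⁻ _, ‖⨍ y, f y ∂μ‖ₑ ^ 2 ∂μ = ∫⁻ x, ‖f x‖ₑ ^ 2 ∂μ := by
  set m := ⨍ y, f y ∂μ with hm
  have lintegral_eq {g : X → E} (hg : MemLp g 2 μ) :
      ∫⁻ x, ‖g x‖ₑ ^ 2 ∂μ = ENNReal.ofReal (∫ x, ‖g x‖ ^ 2 ∂μ) := by
    rw [ofReal_integral_eq_lintegral_ofReal (hg.integrable_norm_pow two_ne_zero)
      (Filter.Eventually.of_forall fun x => by positivity)]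
    simp only [ENNReal.ofReal_pow (norm_nonneg _), ofReal_norm]
  have hsub : MemLp (fun x => f x - m) 2 μ := hf.sub (memLp_const m)
  have hconst : MemLp (fun _ : X => m) 2 μ := memLp_const m
  have hinner : Integrable (fun x => inner ℝ m (f x - m)) μ :=
    (hsub.integrable one_le_two).const_inner m
  have integral_inner_eq_zero : ∫ x, inner ℝ m (f x - m) ∂μ = 0 := by
    rw [integral_inner (hsub.integrable one_le_two), hm, integral_sub_average, inner_zero_right]
  have pythagoras (x : X) :
      ‖f x‖ ^ 2 = ‖f x - m‖ ^ 2 + ‖m‖ ^ 2 + 2 * inner ℝ m (f x - m) := by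
    have := norm_add_sq_real m (f x - m)
    rw [add_sub_cancel] at this
    linarith
  rw [lintegral_eq hsub, lintegral_eq hconst, lintegral_eq hf,
    ← ENNReal.ofReal_add (by positivity) (by positivity),
    integral_congr_ae (.of_forall pythagoras), integral_add _ (hinner.const_mul 2),
    integral_const_mul, integral_inner_eq_zero, mul_zero, add_zero, integral_add]
  · exact hsub.integrable_norm_pow two_ne_zero
  · exact hconst.integrable_norm_pow two_ne_zero
  · exact (hsub.integrable_norm_pow two_ne_zero).add (hconst.integrable_norm_pow two_ne_zero)

variable [MeasurableSpace ι] [Countable ι] [MeasurableSingletonClass ι]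

lemma IsCellPartition.lintegral_enorm_sub_cellAverage_sq {π : X → ι} (hπ : IsCellPartition μ π)
    {f : X → E} (hf : MemLp f 2 μ) :
    ∫⁻ x, ‖f x - cellAverage μ π f x‖ₑ ^ 2 ∂μ + ∫⁻ x, ‖cellAverage μ π f x‖ₑ ^ 2 ∂μ
      = ∫⁻ x, ‖f x‖ₑ ^ 2 ∂μ := by
  simp only [lintegral_eq_tsum_cell μ hπ.measurable (fun _ => ‖_‖ₑ ^ 2), ← ENNReal.tsum_add]
  refine tsum_congr fun i => ?_
  have := hπ.isFiniteMeasure_restrict i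
  rw [← lintegral_enorm_sub_average_sq (hf.restrict (π ⁻¹' {i}))]
  congr 1 <;>
  exact setLIntegral_congr_fun (hπ.measurableSet_cell i) fun x hx => by
    rw [cellAverage, show π x = i from hx]

variable {π : ℕ → X → ι}

lemma IsRefiningPartition.tsum_lintegral_cellAverage_sub_sq_le (hπ : IsRefiningPartition μ π)
    {f : X → E} (hf : MemLp f 2 μ) :
    ∑' k, ∫⁻ x, ‖cellAverage μ (π (k + 1)) f x - cellAverage μ (π k) f x‖ₑ ^ 2 ∂μ
      ≤ ∫⁻ x, ‖f x‖ₑ ^ 2 ∂μ := by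
  have orthogonality (k : ℕ) :
      ∫⁻ x, ‖cellAverage μ (π (k + 1)) f x - cellAverage μ (π k) f x‖ₑ ^ 2 ∂μ
        + ∫⁻ x, ‖cellAverage μ (π k) f x‖ₑ ^ 2 ∂μ
      = ∫⁻ x, ‖cellAverage μ (π (k + 1)) f x‖ₑ ^ 2 ∂μ := by
    simpa only [(hπ.level k).cellAverage_cellAverage (hπ.level (k + 1))
      (hπ.factorsThrough_succ k) hf] using
      (hπ.level k).lintegral_enorm_sub_cellAverage_sq ((hπ.level (k + 1)).memLp_cellAverage hf)
  refine ENNReal.tsum_le_of_sum_range_le fun K => ?_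
  refine le_trans ?_ ((hπ.level K).lintegral_enorm_cellAverage_sq_le hf.1)
  induction K with
  | zero => simp only [Finset.range_zero, Finset.sum_empty, zero_le]
  | succ K ih =>
    rw [Finset.sum_range_succ, ← orthogonality K, add_comm]
    gcongr

lemma IsRefiningPartition.tsum_setLIntegral_cellAverage_sub_sq_le (hπ : IsRefiningPartition μ π)
    {b : X → E} (hb : StronglyMeasurable b) {B : ℝ≥0} (hB : ∀ x, ‖b x‖ₑ ≤ B) (k : ℕ) (i : ι) :
    ∑' l, ∫⁻ x in π k ⁻¹' {i},
        ‖cellAverage μ (π (k + l + 1)) b x - cellAverage μ (π (k + l)) b x‖ₑ ^ 2 ∂μ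
      ≤ B ^ 2 * μ (π k ⁻¹' {i}) := by
  set Q := π k ⁻¹' {i}
  have hQ : MeasurableSet Q := (hπ.level k).measurableSet_cell i
  have lintegral_le : ∫⁻ x, ‖Q.indicator b x‖ₑ ^ 2 ∂μ ≤ B ^ 2 * μ Q := by
    rw [← setLIntegral_const, ← lintegral_indicator hQ]
    refine lintegral_mono fun x => ?_
    by_cases hx : x ∈ Q
    · simp only [indicator_of_mem hx]
      gcongr
      exact hB x
    · simp [indicator_of_notMem hx]
  have hmem : MemLp (Q.indicator b) 2 μ :=
    (memLp_two_iff_lintegral (hb.indicator hQ).aestronglyMeasurable).2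
      (lintegral_le.trans_lt (ENNReal.mul_lt_top (by finiteness)
        ((hπ.level k).measure_cell_ne_top i).lt_top))
  have cellAverage_indicator {m : ℕ} (hkm : k ≤ m) {x : X} (hx : x ∈ Q) :
      cellAverage μ (π m) (Q.indicator b) x = cellAverage μ (π m) b x := by
    simp only [cellAverage, setAverage_eq]
    rw [setIntegral_congr_fun ((hπ.level m).measurableSet_cell _) fun y hy => ?_]
    have : y ∈ Q := (factorsThrough_of_le hπ.factorsThrough_succ hkm hy).trans hx
    exact indicator_of_mem this b
  refine le_trans (ENNReal.tsum_le_tsum fun l => ?_)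
    (((hπ.shift k).tsum_lintegral_cellAverage_sub_sq_le hmem).trans lintegral_le)
  refine le_trans (le_of_eq ?_) (setLIntegral_le_lintegral Q _)
  refine setLIntegral_congr_fun hQ fun x hx => ?_
  rw [cellAverage_indicator (by omega) hx, cellAverage_indicator (by omega) hx, add_assoc]

end InnerProductSpace

end CellAverage

section AdaptedDifferences

variable {X ι : Type*} {b f : X → ℂ} {B c : ℝ≥0}

lemma ennreal_add_sq_le (a b : ℝ≥0∞) : (a + b) ^ 2 ≤ 2 * a ^ 2 + 2 * b ^ 2 := by
  have h := ENNReal.rpow_add_le_mul_rpow_add_rpow a b one_le_two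
  norm_num at h
  rwa [mul_add] at h

lemma enorm_inv_le_of_le (hc : 0 < c) {u : ℂ} (hu : c ≤ ‖u‖ₑ) : ‖u⁻¹‖ₑ ≤ (c⁻¹ : ℝ≥0) := by
  have hu0 : u ≠ 0 := enorm_pos.1 (lt_of_lt_of_le (by exact_mod_cast hc) hu)
  rw [enorm_inv hu0, ENNReal.coe_inv hc.ne']
  gcongr

lemma enorm_div_sub_div_le (hc : 0 < c) {u v : ℂ} (hu : c ≤ ‖u‖ₑ) (hv : c ≤ ‖v‖ₑ) (p q : ℂ) :
    ‖p / u - q / v‖ₑ ≤ (c⁻¹ : ℝ≥0) * ‖p - q‖ₑ + (c⁻¹ : ℝ≥0) ^ 2 * (‖q‖ₑ * ‖u - v‖ₑ) := by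
  have hu0 : u ≠ 0 := enorm_pos.1 (lt_of_lt_of_le (by exact_mod_cast hc) hu)
  have hv0 : v ≠ 0 := enorm_pos.1 (lt_of_lt_of_le (by exact_mod_cast hc) hv)
  have : p / u - q / v = u⁻¹ * (p - q) - u⁻¹ * v⁻¹ * (q * (u - v)) := by
    field_simp
    ring
  rw [this]
  refine enorm_sub_le.trans ?_
  simp only [enorm_mul, sq]
  gcongr <;> apply enorm_inv_le_of_le <;> assumption

variable [MeasurableSpace X] {μ : Measure X}

/-- The coefficient `⟨f⟩ / ⟨b⟩` of the `b`-adapted averaging operator `f ↦ b ⟨f⟩ / ⟨b⟩`. It is `0`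
on cells of measure zero. -/
noncomputable def adaptedCoeff (μ : Measure X) (π : X → ι) (b f : X → ℂ) (x : X) : ℂ :=
  cellAverage μ π f x / cellAverage μ π b x

/-- The differences of the adapted coefficients of consecutive levels. Level `0` is the coarsest
coefficient itself, so that the differences up to level `j` add up to the coefficient at `j`. -/
noncomputable def adaptedDiff (μ : Measure X) (π : ℕ → X → ι) (b f : X → ℂ) : ℕ → X → ℂ
  | 0, x => adaptedCoeff μ (π 0) b f x
  | k + 1, x => adaptedCoeff μ (π (k + 1)) b f x - adaptedCoeff μ (π k) b f x

/-- `b` is accretive on the cells of `π` with constant `c`: its averages over the cells are bounded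
below by `c`. -/
def IsAccretiveOn (μ : Measure X) (π : X → ι) (b : X → ℂ) (c : ℝ≥0) : Prop :=
  ∀ i, c * μ (π ⁻¹' {i}) ≤ ‖∫ x in π ⁻¹' {i}, b x ∂μ‖ₑ

lemma factorsThrough_adaptedCoeff (π : X → ι) (b f : X → ℂ) :
    (adaptedCoeff μ π b f).FactorsThrough π :=
  fun x y h => by simp only [adaptedCoeff, factorsThrough_cellAverage _ _ h]

lemma factorsThrough_adaptedDiff {π : ℕ → X → ι}
    (href : ∀ k, (π k).FactorsThrough (π (k + 1))) (b f : X → ℂ) (k : ℕ) :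
    (adaptedDiff μ π b f k).FactorsThrough (π k) := by
  intro x y h
  cases k with
  | zero => exact factorsThrough_adaptedCoeff (π 0) b f h
  | succ k =>
    rw [adaptedDiff, adaptedDiff, factorsThrough_adaptedCoeff (π (k + 1)) b f h,
      factorsThrough_adaptedCoeff (π k) b f (href k h)]

lemma adaptedCoeff_eq_zero {π : X → ι} {x : X} (h : μ (π ⁻¹' {π x}) = 0) (b f : X → ℂ) :
    adaptedCoeff μ π b f x = 0 := by
  rw [adaptedCoeff, cellAverage_eq_zero h, zero_div]

lemma sum_adaptedDiff (π : ℕ → X → ι) (b f : X → ℂ) (j : ℕ) (x : X) :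
    ∑ k ∈ Finset.range (j + 1), adaptedDiff μ π b f k x = adaptedCoeff μ (π j) b f x := by
  induction j with
  | zero => simp [adaptedDiff]
  | succ j ih => rw [Finset.sum_range_succ, ih, adaptedDiff, add_sub_cancel]

section OneLevel

variable [MeasurableSpace ι] {π π' : X → ι}

lemma IsAccretiveOn.le_enorm_cellAverage (hacc : IsAccretiveOn μ π b c) (hπ : IsCellPartition μ π)
    {x : X} (h0 : μ (π ⁻¹' {π x}) ≠ 0) : c ≤ ‖cellAverage μ π b x‖ₑ := by
  have h := hacc (π x)
  rwa [← hπ.measureReal_smul_cellAverage, enorm_smul, Measure.real, Real.enorm_eq_ofReal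
    ENNReal.toReal_nonneg, ENNReal.ofReal_toReal (hπ.measure_cell_ne_top _), mul_comm,
    ENNReal.mul_le_mul_iff_right h0 (hπ.measure_cell_ne_top _)] at h

lemma IsAccretiveOn.enorm_adaptedCoeff_le (hacc : IsAccretiveOn μ π b c) (hc : 0 < c)
    (hπ : IsCellPartition μ π) (f : X → ℂ) (x : X) :
    ‖adaptedCoeff μ π b f x‖ₑ ≤ (c⁻¹ : ℝ≥0) * ‖cellAverage μ π f x‖ₑ := by
  by_cases h0 : μ (π ⁻¹' {π x}) = 0
  · simp only [adaptedCoeff_eq_zero h0, enorm_zero, zero_le]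
  rw [adaptedCoeff, div_eq_inv_mul, enorm_mul]
  gcongr
  exact enorm_inv_le_of_le hc (hacc.le_enorm_cellAverage hπ h0)

lemma IsAccretiveOn.enorm_adaptedCoeff_sub_le (hacc : IsAccretiveOn μ π b c)
    (hacc' : IsAccretiveOn μ π' b c) (hc : 0 < c) (hπ : IsCellPartition μ π)
    (hπ' : IsCellPartition μ π') (href : π.FactorsThrough π') (f : X → ℂ) (x : X) :
    ‖adaptedCoeff μ π' b f x - adaptedCoeff μ π b f x‖ₑ
      ≤ (c⁻¹ : ℝ≥0) * ‖cellAverage μ π' f x - cellAverage μ π f x‖ₑ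
        + (c⁻¹ : ℝ≥0) ^ 2 * (‖cellAverage μ π f x‖ₑ
          * ‖cellAverage μ π' b x - cellAverage μ π b x‖ₑ) := by
  by_cases h1 : μ (π' ⁻¹' {π' x}) = 0
  · rw [adaptedCoeff_eq_zero h1, cellAverage_eq_zero h1, zero_sub, zero_sub, enorm_neg, enorm_neg]
    exact (hacc.enorm_adaptedCoeff_le hc hπ f x).trans le_self_add
  have h0 : μ (π ⁻¹' {π x}) ≠ 0 := fun h => h1 (measure_mono_null (fun y hy => href hy) h)
  exact enorm_div_sub_div_le hc (hacc'.le_enorm_cellAverage hπ' h1)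
    (hacc.le_enorm_cellAverage hπ h0) _ _

variable [MeasurableSingletonClass ι]

lemma IsAccretiveOn.setIntegral_cell_mul_adaptedCoeff (hacc : IsAccretiveOn μ π b c) (hc : 0 < c)
    (hπ : IsCellPartition μ π) (f : X → ℂ) (i : ι) :
    ∫ x in π ⁻¹' {i}, b x * adaptedCoeff μ π b f x ∂μ = ∫ x in π ⁻¹' {i}, f x ∂μ := by
  by_cases h0 : μ (π ⁻¹' {i}) = 0
  · rw [setIntegral_measure_zero _ h0, setIntegral_measure_zero _ h0]
  obtain ⟨x, rfl⟩ : (π ⁻¹' {i}).Nonempty := nonempty_of_measure_ne_zero h0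
  have cellAverage_ne_zero : cellAverage μ π b x ≠ 0 := enorm_pos.1
    (lt_of_lt_of_le (by exact_mod_cast hc) (hacc.le_enorm_cellAverage hπ h0))
  calc ∫ y in π ⁻¹' {π x}, b y * adaptedCoeff μ π b f y ∂μ
      = ∫ y in π ⁻¹' {π x}, b y * adaptedCoeff μ π b f x ∂μ :=
        setIntegral_congr_fun (hπ.measurableSet_cell _) fun y hy => by
          simp only [factorsThrough_adaptedCoeff π b f (show π y = π x from hy)]
    _ = μ.real (π ⁻¹' {π x}) • (cellAverage μ π b x * adaptedCoeff μ π b f x) := by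
        rw [integral_mul_const, ← hπ.measureReal_smul_cellAverage, smul_mul_assoc]
    _ = ∫ y in π ⁻¹' {π x}, f y ∂μ := by
        rw [adaptedCoeff, mul_div_cancel₀ _ cellAverage_ne_zero, hπ.measureReal_smul_cellAverage]

variable [Countable ι]

lemma measurable_adaptedCoeff (hπ : Measurable π) (b f : X → ℂ) :
    Measurable (adaptedCoeff μ π b f) :=
  (stronglyMeasurable_of_factorsThrough hπ (factorsThrough_adaptedCoeff π b f)).measurable

lemma IsAccretiveOn.lintegral_adaptedCoeff_sq_le (hacc : IsAccretiveOn μ π b c) (hc : 0 < c)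
    (hπ : IsCellPartition μ π) (hf : AEStronglyMeasurable f μ) :
    ∫⁻ x, ‖adaptedCoeff μ π b f x‖ₑ ^ 2 ∂μ ≤ (c⁻¹ : ℝ≥0) ^ 2 * ∫⁻ x, ‖f x‖ₑ ^ 2 ∂μ :=
  calc _ ≤ ∫⁻ x, (c⁻¹ : ℝ≥0) ^ 2 * ‖cellAverage μ π f x‖ₑ ^ 2 ∂μ := by
        refine lintegral_mono fun x => ?_
        rw [← mul_pow]
        gcongr
        exact hacc.enorm_adaptedCoeff_le hc hπ f x
    _ = (c⁻¹ : ℝ≥0) ^ 2 * ∫⁻ x, ‖cellAverage μ π f x‖ₑ ^ 2 ∂μ :=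
        lintegral_const_mul' _ _ (by finiteness)
    _ ≤ _ := mul_le_mul_right (hπ.lintegral_enorm_cellAverage_sq_le hf) _

lemma IsAccretiveOn.lintegral_mul_adaptedCoeff_sq_le (hacc : IsAccretiveOn μ π b c) (hc : 0 < c)
    (hπ : IsCellPartition μ π) (hB : ∀ x, ‖b x‖ₑ ≤ B) (hf : AEStronglyMeasurable f μ) :
    ∫⁻ x, ‖b x * adaptedCoeff μ π b f x‖ₑ ^ 2 ∂μ
      ≤ B ^ 2 * ((c⁻¹ : ℝ≥0) ^ 2 * ∫⁻ x, ‖f x‖ₑ ^ 2 ∂μ) :=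
  calc _ ≤ ∫⁻ x, (B : ℝ≥0∞) ^ 2 * ‖adaptedCoeff μ π b f x‖ₑ ^ 2 ∂μ := by
        refine lintegral_mono fun x => ?_
        rw [enorm_mul, mul_pow]
        gcongr
        exact hB x
    _ = B ^ 2 * ∫⁻ x, ‖adaptedCoeff μ π b f x‖ₑ ^ 2 ∂μ :=
        lintegral_const_mul' _ _ (by finiteness)
    _ ≤ _ := by
        gcongr
        exact hacc.lintegral_adaptedCoeff_sq_le hc hπ hf

lemma IsAccretiveOn.memLp_mul_adaptedCoeff (hacc : IsAccretiveOn μ π b c) (hc : 0 < c)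
    (hπ : IsCellPartition μ π) (hb : Measurable b) (hB : ∀ x, ‖b x‖ₑ ≤ B) (hf : MemLp f 2 μ) :
    MemLp (fun x => b x * adaptedCoeff μ π b f x) 2 μ := by
  refine (memLp_two_iff_lintegral
    (hb.mul (measurable_adaptedCoeff hπ.measurable b f)).aestronglyMeasurable).2
    ((hacc.lintegral_mul_adaptedCoeff_sq_le hc hπ hB hf.1).trans_lt ?_)
  have := (memLp_two_iff_lintegral hf.1).1 hf
  finiteness

lemma IsAccretiveOn.setIntegral_mul_adaptedCoeff (hacc : IsAccretiveOn μ π' b c) (hc : 0 < c)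
    (hπ : IsCellPartition μ π) (hπ' : IsCellPartition μ π') (href : π.FactorsThrough π')
    (hb : Measurable b) (hB : ∀ x, ‖b x‖ₑ ≤ B) (hf : MemLp f 2 μ) (i : ι) :
    ∫ x in π ⁻¹' {i}, b x * adaptedCoeff μ π' b f x ∂μ = ∫ x in π ⁻¹' {i}, f x ∂μ :=
  setIntegral_cell_congr hπ.measurable hπ'.measurable href
    (hπ.integrableOn_cell (hacc.memLp_mul_adaptedCoeff hc hπ' hb hB hf) i)
    (hπ.integrableOn_cell hf i) (hacc.setIntegral_cell_mul_adaptedCoeff hc hπ' f)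

lemma IsAccretiveOn.setIntegral_cell_sub_mul_adaptedCoeff (hacc : IsAccretiveOn μ π b c)
    (hc : 0 < c) (hπ : IsCellPartition μ π) (hb : Measurable b) (hB : ∀ x, ‖b x‖ₑ ≤ B)
    (hf : MemLp f 2 μ) (i : ι) :
    ∫ x in π ⁻¹' {i}, f x - b x * adaptedCoeff μ π b f x ∂μ = 0 := by
  rw [integral_sub (hπ.integrableOn_cell hf i)
    (hπ.integrableOn_cell (hacc.memLp_mul_adaptedCoeff hc hπ hb hB hf) i),
    hacc.setIntegral_cell_mul_adaptedCoeff hc hπ, sub_self]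

lemma IsAccretiveOn.lintegral_sub_mul_adaptedCoeff_sq_le (hacc : IsAccretiveOn μ π b c)
    (hc : 0 < c) (hπ : IsCellPartition μ π) (hB : ∀ x, ‖b x‖ₑ ≤ B)
    (hf : AEStronglyMeasurable f μ) :
    ∫⁻ x, ‖f x - b x * adaptedCoeff μ π b f x‖ₑ ^ 2 ∂μ
      ≤ 2 * (∫⁻ x, ‖f x‖ₑ ^ 2 ∂μ + B ^ 2 * ((c⁻¹ : ℝ≥0) ^ 2 * ∫⁻ x, ‖f x‖ₑ ^ 2 ∂μ)) :=
  calc _ ≤ ∫⁻ x, (2 * ‖f x‖ₑ ^ 2 + 2 * ‖b x * adaptedCoeff μ π b f x‖ₑ ^ 2) ∂μ :=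
        lintegral_mono fun x => (pow_le_pow_left' enorm_sub_le 2).trans (ennreal_add_sq_le _ _)
    _ = 2 * (∫⁻ x, ‖f x‖ₑ ^ 2 ∂μ + ∫⁻ x, ‖b x * adaptedCoeff μ π b f x‖ₑ ^ 2 ∂μ) := by
        rw [lintegral_add_left' ((hf.enorm.pow_const 2).const_mul 2),
          lintegral_const_mul' _ _ ENNReal.ofNat_ne_top,
          lintegral_const_mul' _ _ ENNReal.ofNat_ne_top, mul_add]
    _ ≤ _ := by
        gcongr
        exact hacc.lintegral_mul_adaptedCoeff_sq_le hc hπ hB hf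

end OneLevel

variable [MeasurableSpace ι] [Countable ι] [MeasurableSingletonClass ι] {π : ℕ → X → ι}

lemma IsRefiningPartition.memLp_mul_adaptedDiff_succ (hπ : IsRefiningPartition μ π)
    (hb : Measurable b) (hB : ∀ x, ‖b x‖ₑ ≤ B) (hacc : ∀ k, IsAccretiveOn μ (π k) b c)
    (hc : 0 < c) (hf : MemLp f 2 μ) (k : ℕ) :
    MemLp (fun x => b x * adaptedDiff μ π b f (k + 1) x) 2 μ := by
  simp only [adaptedDiff, mul_sub]
  exact ((hacc (k + 1)).memLp_mul_adaptedCoeff hc (hπ.level _) hb hB hf).sub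
    ((hacc k).memLp_mul_adaptedCoeff hc (hπ.level _) hb hB hf)

lemma IsRefiningPartition.setIntegral_cell_mul_adaptedDiff_succ (hπ : IsRefiningPartition μ π)
    (hb : Measurable b) (hB : ∀ x, ‖b x‖ₑ ≤ B) (hacc : ∀ k, IsAccretiveOn μ (π k) b c)
    (hc : 0 < c) (hf : MemLp f 2 μ) (k : ℕ) (i : ι) :
    ∫ x in π k ⁻¹' {i}, b x * adaptedDiff μ π b f (k + 1) x ∂μ = 0 := by
  have integrableOn (l : ℕ) :
      IntegrableOn (fun x => b x * adaptedCoeff μ (π l) b f x) (π k ⁻¹' {i}) μ :=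
    (hπ.level k).integrableOn_cell ((hacc l).memLp_mul_adaptedCoeff hc (hπ.level l) hb hB hf) i
  simp only [adaptedDiff, mul_sub]
  rw [integral_sub (integrableOn _) (integrableOn _),
    (hacc (k + 1)).setIntegral_mul_adaptedCoeff hc (hπ.level k) (hπ.level (k + 1))
      (hπ.factorsThrough_succ k) hb hB hf,
    (hacc k).setIntegral_cell_mul_adaptedCoeff hc (hπ.level k), sub_self]

lemma measurable_adaptedDiff (hπ : ∀ k, Measurable (π k)) (b f : X → ℂ) (k : ℕ) :
    Measurable (adaptedDiff μ π b f k) := by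
  cases k with
  | zero => exact measurable_adaptedCoeff (hπ 0) b f
  | succ k => exact (measurable_adaptedCoeff (hπ _) b f).sub (measurable_adaptedCoeff (hπ _) b f)

lemma IsRefiningPartition.tsum_lintegral_cellAverage_mul_sub_sq_le (hπ : IsRefiningPartition μ π)
    (hb : Measurable b) (hB0 : 0 < B) (hB : ∀ x, ‖b x‖ₑ ≤ B) (hf : AEStronglyMeasurable f μ) :
    ∑' k, ∫⁻ x, ‖cellAverage μ (π k) f x‖ₑ ^ 2
        * ‖cellAverage μ (π (k + 1)) b x - cellAverage μ (π k) b x‖ₑ ^ 2 ∂μ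
      ≤ 4 * B ^ 2 * ∫⁻ x, ‖f x‖ₑ ^ 2 ∂μ := by
  have measurable_weight (k : ℕ) : Measurable fun x =>
      ‖cellAverage μ (π (k + 1)) b x - cellAverage μ (π k) b x‖ₑ ^ 2 :=
    ((stronglyMeasurable_cellAverage (hπ.level (k + 1)).measurable b).sub
      (stronglyMeasurable_cellAverage (hπ.level k).measurable b)).enorm.pow_const 2
  refine le_trans (ENNReal.tsum_le_tsum fun k => lintegral_mono fun x => ?_)
    (hπ.carleson_embedding measurable_weight (by simpa using hB0.ne') (by finiteness)
      (hπ.tsum_setLIntegral_cellAverage_sub_sq_le hb.stronglyMeasurable hB) hf.enorm)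
  dsimp only
  gcongr
  exact enorm_cellAverage_le f x

lemma IsRefiningPartition.lintegral_adaptedDiff_succ_sq_le (hπ : IsRefiningPartition μ π)
    (hacc : ∀ k, IsAccretiveOn μ (π k) b c) (hc : 0 < c) (k : ℕ) :
    ∫⁻ x, ‖adaptedDiff μ π b f (k + 1) x‖ₑ ^ 2 ∂μ
      ≤ 2 * (c⁻¹ : ℝ≥0) ^ 2
          * ∫⁻ x, ‖cellAverage μ (π (k + 1)) f x - cellAverage μ (π k) f x‖ₑ ^ 2 ∂μ
        + 2 * (c⁻¹ : ℝ≥0) ^ 4 * ∫⁻ x, ‖cellAverage μ (π k) f x‖ₑ ^ 2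
          * ‖cellAverage μ (π (k + 1)) b x - cellAverage μ (π k) b x‖ₑ ^ 2 ∂μ := by
  have measurable_sub : Measurable fun x =>
      ‖cellAverage μ (π (k + 1)) f x - cellAverage μ (π k) f x‖ₑ ^ 2 :=
    ((stronglyMeasurable_cellAverage (hπ.level (k + 1)).measurable f).sub
      (stronglyMeasurable_cellAverage (hπ.level k).measurable f)).enorm.pow_const 2
  rw [← lintegral_const_mul' _ _ (by finiteness), ← lintegral_const_mul' _ _ (by finiteness),
    ← lintegral_add_left (measurable_sub.const_mul _)]
  refine lintegral_mono fun x => ?_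
  calc _ ≤ _ := pow_le_pow_left' ((hacc k).enorm_adaptedCoeff_sub_le (hacc (k + 1)) hc
        (hπ.level k) (hπ.level (k + 1)) (hπ.factorsThrough_succ k) f x) 2
    _ ≤ _ := ennreal_add_sq_le _ _
    _ = _ := by ring

/-- The constant of the square function estimate for the `b`-adapted martingale differences. -/
noncomputable def adaptedConst (B c : ℝ≥0) : ℝ≥0 :=
  3 * c⁻¹ ^ 2 + 8 * c⁻¹ ^ 4 * B ^ 2

theorem IsRefiningPartition.tsum_lintegral_adaptedDiff_sq_le (hπ : IsRefiningPartition μ π)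
    (hb : Measurable b) (hB0 : 0 < B) (hB : ∀ x, ‖b x‖ₑ ≤ B)
    (hacc : ∀ k, IsAccretiveOn μ (π k) b c) (hc : 0 < c) (hf : MemLp f 2 μ) :
    ∑' k, ∫⁻ x, ‖adaptedDiff μ π b f k x‖ₑ ^ 2 ∂μ
      ≤ adaptedConst B c * ∫⁻ x, ‖f x‖ₑ ^ 2 ∂μ := by
  set I := ∫⁻ x, ‖f x‖ₑ ^ 2 ∂μ
  have coarsest_le : ∫⁻ x, ‖adaptedDiff μ π b f 0 x‖ₑ ^ 2 ∂μ ≤ (c⁻¹ : ℝ≥0) ^ 2 * I :=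
    (hacc 0).lintegral_adaptedCoeff_sq_le hc (hπ.level 0) hf.1
  have succ_le : ∑' k, ∫⁻ x, ‖adaptedDiff μ π b f (k + 1) x‖ₑ ^ 2 ∂μ
      ≤ 2 * (c⁻¹ : ℝ≥0) ^ 2 * I + 2 * (c⁻¹ : ℝ≥0) ^ 4 * (4 * B ^ 2 * I) := by
    refine (ENNReal.tsum_le_tsum (hπ.lintegral_adaptedDiff_succ_sq_le hacc hc)).trans ?_
    rw [ENNReal.tsum_add, ENNReal.tsum_mul_left, ENNReal.tsum_mul_left]
    gcongr
    · exact hπ.tsum_lintegral_cellAverage_sub_sq_le hf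
    · exact hπ.tsum_lintegral_cellAverage_mul_sub_sq_le hb hB0 hB hf.1
  rw [tsum_eq_zero_add' ENNReal.summable]
  refine (add_le_add coarsest_le succ_le).trans (le_of_eq ?_)
  rw [adaptedConst]
  push_cast
  ring

end AdaptedDifferences

section DoublingMajorant

variable {X : Type*} [PseudoMetricSpace X] [MeasurableSpace X] {μ : Measure X} {D q : ℝ≥0}
  {g g' : X → ℝ≥0∞}

/-- The smallest majorant of `μ (B(x, r))` that is doubling in `r` with constant `D`. Unlike a
general majorant it is comparable at points of distance at most `r`. -/
noncomputable def dyadicMajorant (μ : Measure X) (D : ℝ≥0) (x : X) (r : ℝ) : ℝ≥0∞ :=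
  ⨆ k : ℕ, μ (Metric.ball x (2 ^ k * r)) / D ^ k

/-- The average over a ball, normalized by `dyadicMajorant` instead of the measure of the ball. -/
noncomputable def ballAverage (μ : Measure X) (D : ℝ≥0) (r : ℝ) (g : X → ℝ≥0∞) (x : X) : ℝ≥0∞ :=
  (∫⁻ y in Metric.ball x r, g y ∂μ) / dyadicMajorant μ D x r

/-- The superposition of the ball averages at the scales `2 ^ k * t` with weights `q ^ k`. It
dominates integral operators whose kernel decays geometrically off the scale `t`. -/
noncomputable def tailOp (μ : Measure X) (D q : ℝ≥0) (t : ℝ) (g : X → ℝ≥0∞) (x : X) : ℝ≥0∞ :=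
  ∑' k : ℕ, q ^ k * ballAverage μ D (2 ^ k * t) g x

/-- The integral kernel of `tailOp`. -/
noncomputable def tailKernel (μ : Measure X) (D q : ℝ≥0) (t : ℝ) (x y : X) : ℝ≥0∞ :=
  ∑' k : ℕ, q ^ k
    * (Metric.ball x (2 ^ k * t)).indicator (fun _ => (dyadicMajorant μ D x (2 ^ k * t))⁻¹) y

lemma tsum_coe_pow (hq : q < 1) : ∑' k : ℕ, (q : ℝ≥0∞) ^ k = ((1 - q)⁻¹ : ℝ≥0) := by
  rw [ENNReal.tsum_geometric, ENNReal.coe_inv (tsub_pos_of_lt hq).ne', ENNReal.coe_sub,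
    ENNReal.coe_one]

lemma measure_ball_le_dyadicMajorant (x : X) (r : ℝ) :
    μ (Metric.ball x r) ≤ dyadicMajorant μ D x r :=
  le_trans (by simp) (le_iSup (fun k : ℕ => μ (Metric.ball x (2 ^ k * r)) / (D : ℝ≥0∞) ^ k) 0)

lemma inv_dyadicMajorant_mul_measure_ball_le_one (x : X) (r : ℝ) :
    (dyadicMajorant μ D x r)⁻¹ * μ (Metric.ball x r) ≤ 1 :=
  (mul_le_mul_right (measure_ball_le_dyadicMajorant x r) _).trans (ENNReal.inv_mul_le_one _)

lemma monotone_dyadicMajorant (x : X) : Monotone (dyadicMajorant μ D x) := by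
  intro r r' h
  unfold dyadicMajorant
  gcongr

lemma dyadicMajorant_le_mul (hD : D ≠ 0) {x y : X} {r : ℝ} (hr : 0 < r) (hxy : dist x y ≤ r) :
    dyadicMajorant μ D x r ≤ D * dyadicMajorant μ D y r := by
  refine iSup_le fun k => ?_
  have hD' : (D : ℝ≥0∞) ≠ 0 := by simpa using hD
  have ball_subset : Metric.ball x (2 ^ k * r) ⊆ Metric.ball y (2 ^ (k + 1) * r) :=
    Metric.ball_subset_ball' <| by
      have one_le_pow : (1 : ℝ) ≤ 2 ^ k := one_le_pow₀ one_le_two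
      rw [pow_succ]
      nlinarith
  calc μ (Metric.ball x (2 ^ k * r)) / (D : ℝ≥0∞) ^ k
      ≤ μ (Metric.ball y (2 ^ (k + 1) * r)) / (D : ℝ≥0∞) ^ k := by gcongr
    _ = D * (μ (Metric.ball y (2 ^ (k + 1) * r)) / (D : ℝ≥0∞) ^ (k + 1)) := by
        rw [pow_succ' (D : ℝ≥0∞), ← mul_div_assoc,
          ENNReal.mul_div_mul_left _ _ hD' ENNReal.coe_ne_top]
    _ ≤ _ := by
        gcongr
        exact le_iSup (fun k : ℕ => μ (Metric.ball y (2 ^ k * r)) / (D : ℝ≥0∞) ^ k) (k + 1)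

lemma inv_dyadicMajorant_le_mul (hD : D ≠ 0) {x y : X} {r : ℝ} (hr : 0 < r)
    (hxy : dist y x ≤ r) :
    (dyadicMajorant μ D x r)⁻¹ ≤ D * (dyadicMajorant μ D y r)⁻¹ := by
  have hD' : (D : ℝ≥0∞) ≠ 0 := by simpa using hD
  calc (dyadicMajorant μ D x r)⁻¹ = D * (D * dyadicMajorant μ D x r)⁻¹ := by
        rw [ENNReal.mul_inv (Or.inl hD') (Or.inl ENNReal.coe_ne_top), ← mul_assoc,
          ENNReal.mul_inv_cancel hD' ENNReal.coe_ne_top, one_mul]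
    _ ≤ _ := by
        gcongr
        exact dyadicMajorant_le_mul hD hr hxy

lemma dyadicMajorant_ne_zero (hμ : μ ≠ 0) (x : X) {r : ℝ} (hr : 0 < r) :
    dyadicMajorant μ D x r ≠ 0 := by
  intro hzero
  have univ_eq : (univ : Set X) = ⋃ k : ℕ, Metric.ball x (2 ^ k * r) := by
    refine (eq_univ_of_forall fun y => mem_iUnion.2 ?_).symm
    obtain ⟨k, hk⟩ := pow_unbounded_of_one_lt (dist y x / r) one_lt_two
    exact ⟨k, by rwa [Metric.mem_ball, ← div_lt_iff₀ hr]⟩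
  refine hμ (Measure.measure_univ_eq_zero.1 ?_)
  rw [univ_eq]
  refine measure_iUnion_null fun k => ?_
  exact (ENNReal.div_eq_zero_iff.1 (ENNReal.iSup_eq_zero.1 hzero k)).resolve_right (by finiteness)

lemma tailOp_one_le (hq : q < 1) (t : ℝ) (x : X) :
    tailOp μ D q t (fun _ => 1) x ≤ ((1 - q)⁻¹ : ℝ≥0) := by
  rw [← tsum_coe_pow hq]
  refine ENNReal.tsum_le_tsum fun k => mul_le_of_le_one_right' ?_
  rw [ballAverage, lintegral_one, Measure.restrict_apply_univ, ENNReal.div_eq_inv_mul]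
  exact inv_dyadicMajorant_mul_measure_ball_le_one x _

lemma tailOp_mono {t : ℝ} (h : ∀ x, g x ≤ g' x) (x : X) :
    tailOp μ D q t g x ≤ tailOp μ D q t g' x := by
  unfold tailOp ballAverage
  gcongr with k y
  exact h y

lemma tailOp_const_mul {C : ℝ≥0} {t : ℝ} (g : X → ℝ≥0∞) (x : X) :
    tailOp μ D q t (fun y => C * g y) x = C * tailOp μ D q t g x := by
  unfold tailOp ballAverage
  rw [← ENNReal.tsum_mul_left]
  refine tsum_congr fun k => ?_
  rw [lintegral_const_mul' _ _ ENNReal.coe_ne_top, mul_div_assoc, mul_left_comm]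

lemma tailOp_add {t : ℝ} (hg : Measurable g) (g' : X → ℝ≥0∞) (x : X) :
    tailOp μ D q t (fun y => g y + g' y) x = tailOp μ D q t g x + tailOp μ D q t g' x := by
  unfold tailOp ballAverage
  rw [← ENNReal.tsum_add]
  refine tsum_congr fun k => ?_
  rw [lintegral_add_left hg, ENNReal.add_div, mul_add]

lemma sq_ballAverage_le (x : X) (r : ℝ) (hg : AEMeasurable g μ) :
    ballAverage μ D r g x ^ 2
      ≤ (∫⁻ y in Metric.ball x r, g y ^ 2 ∂μ) / dyadicMajorant μ D x r := by
  have cauchy_schwarz := sq_lintegral_mul_le (μ := μ.restrict (Metric.ball x r)) (c := 1) (F := g)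
    aemeasurable_const hg.restrict
  simp only [Pi.one_apply, one_mul, lintegral_one, Measure.restrict_apply_univ] at cauchy_schwarz
  rw [ballAverage, ENNReal.div_eq_inv_mul, mul_pow, ENNReal.div_eq_inv_mul]
  set m := dyadicMajorant μ D x r
  calc m⁻¹ ^ 2 * (∫⁻ y in Metric.ball x r, g y ∂μ) ^ 2
      ≤ m⁻¹ ^ 2 * (μ (Metric.ball x r) * ∫⁻ y in Metric.ball x r, g y ^ 2 ∂μ) := by gcongr
    _ = (m⁻¹ * μ (Metric.ball x r)) * (m⁻¹ * ∫⁻ y in Metric.ball x r, g y ^ 2 ∂μ) := by ring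
    _ ≤ m⁻¹ * ∫⁻ y in Metric.ball x r, g y ^ 2 ∂μ :=
        mul_le_of_le_one_left' (inv_dyadicMajorant_mul_measure_ball_le_one x r)

lemma tailOp_le_one_add_lintegral_sq (hq : q < 1) {t : ℝ} (ht : 0 < t) (hg : AEMeasurable g μ)
    (x : X) :
    tailOp μ D q t g x
      ≤ ((1 - q)⁻¹ : ℝ≥0) * (1 + (∫⁻ y, g y ^ 2 ∂μ) / dyadicMajorant μ D x t) := by
  have le_one_add_sq (a : ℝ≥0∞) : a ≤ 1 + a ^ 2 := by
    rcases le_total a 1 with h | h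
    · exact h.trans le_self_add
    · exact (le_self_pow₀ h two_ne_zero).trans le_add_self
  rw [← tsum_coe_pow hq, ← ENNReal.tsum_mul_right]
  refine ENNReal.tsum_le_tsum fun k => mul_le_mul_right ?_ _
  refine (le_one_add_sq _).trans (add_le_add_right ((sq_ballAverage_le x _ hg).trans ?_) 1)
  gcongr
  · exact Measure.restrict_le_self
  · exact monotone_dyadicMajorant x (le_mul_of_one_le_left ht.le (one_le_pow₀ one_le_two))

lemma tailOp_ne_top_of_memLp {E : Type*} [NormedAddCommGroup E] (hq : q < 1) (hμ : μ ≠ 0) {t : ℝ}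
    (ht : 0 < t) {f : X → E} (hf : MemLp f 2 μ) (x : X) :
    tailOp μ D q t (fun y => ‖f y‖ₑ) x ≠ ∞ := by
  refine ne_top_of_le_ne_top ?_ (tailOp_le_one_add_lintegral_sq hq ht hf.1.enorm x)
  refine ENNReal.mul_ne_top ENNReal.coe_ne_top (ENNReal.add_ne_top.2 ⟨ENNReal.one_ne_top, ?_⟩)
  exact ENNReal.div_ne_top ((memLp_two_iff_lintegral hf.1).1 hf).ne
    (dyadicMajorant_ne_zero hμ x ht)

lemma tailOp_le_of_bounded (hq : q < 1) {B : ℝ≥0} (hB : ∀ x, g x ≤ B) (t : ℝ) (x : X) :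
    tailOp μ D q t g x ≤ (B * (1 - q)⁻¹ : ℝ≥0) :=
  calc _ ≤ tailOp μ D q t (fun _ => B * 1) x := tailOp_mono (fun y => by simpa using hB y) x
    _ = B * tailOp μ D q t (fun _ => 1) x := tailOp_const_mul _ _
    _ ≤ B * ((1 - q)⁻¹ : ℝ≥0) := by
        gcongr
        exact tailOp_one_le hq t x
    _ = _ := (ENNReal.coe_mul _ _).symm

lemma tailKernel_sq_le {t ρ : ℝ} {x y : X} (hρ : ρ ≤ dist y x) {κ : ℝ≥0∞}
    (hκ : ∀ k : ℕ, ρ < 2 ^ k * t → (q : ℝ≥0∞) ^ k ≤ κ) :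
    tailKernel μ D (q ^ 2) t x y ≤ κ * tailKernel μ D q t x y := by
  unfold tailKernel
  rw [← ENNReal.tsum_mul_left]
  refine ENNReal.tsum_le_tsum fun k => ?_
  by_cases hy : y ∈ Metric.ball x (2 ^ k * t)
  · rw [ENNReal.coe_pow, ← pow_mul, mul_comm 2 k, pow_mul, sq, mul_assoc]
    gcongr
    exact hκ k (hρ.trans_lt hy)
  · simp only [indicator_of_notMem hy, mul_zero, le_refl]

lemma setLIntegral_ball_inv_dyadicMajorant_le (hD : D ≠ 0) {r : ℝ} (hr : 0 < r) (y : X) :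
    ∫⁻ x in Metric.ball y r, (dyadicMajorant μ D x r)⁻¹ ∂μ ≤ D :=
  calc _ ≤ ∫⁻ _ in Metric.ball y r, D * (dyadicMajorant μ D y r)⁻¹ ∂μ :=
        setLIntegral_mono measurable_const fun x hx =>
          inv_dyadicMajorant_le_mul hD hr (Metric.mem_ball'.1 hx).le
    _ = D * ((dyadicMajorant μ D y r)⁻¹ * μ (Metric.ball y r)) := by
        rw [setLIntegral_const, mul_assoc]
    _ ≤ D := mul_le_of_le_one_right' (inv_dyadicMajorant_mul_measure_ball_le_one y r)

variable [OpensMeasurableSpace X]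

lemma lintegral_tailKernel_mul {t : ℝ} (hg : Measurable g) (x : X) :
    ∫⁻ y, tailKernel μ D q t x y * g y ∂μ = tailOp μ D q t g x := by
  unfold tailKernel tailOp
  simp only [← ENNReal.tsum_mul_right, mul_assoc, ← indicator_mul_left]
  rw [lintegral_tsum fun k => (((hg.const_mul _).indicator
    Metric.isOpen_ball.measurableSet).const_mul _).aemeasurable]
  refine tsum_congr fun k => ?_
  rw [lintegral_const_mul' _ _ (by finiteness), ballAverage, ENNReal.div_eq_inv_mul,
    ← lintegral_const_mul _ hg, ← lintegral_indicator Metric.isOpen_ball.measurableSet]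

variable [SecondCountableTopology X] [SFinite μ]

lemma measurableSet_dist_lt (r : ℝ) : MeasurableSet {p : X × X | dist p.2 p.1 < r} :=
  measurableSet_lt (by fun_prop) measurable_const

lemma measurable_dyadicMajorant (r : ℝ) : Measurable fun x => dyadicMajorant μ D x r :=
  Measurable.iSup fun _ =>
    (measurable_measure_prodMk_left (measurableSet_dist_lt _)).div_const _

lemma measurable_ballAverage (hg : Measurable g) (r : ℝ) : Measurable (ballAverage μ D r g) := by
  refine Measurable.div ?_ (measurable_dyadicMajorant r)
  convert! ((hg.comp measurable_snd).indicator (measurableSet_dist_lt r)).lintegral_prod_right'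
    (ν := μ) using 2 with x
  rw [← lintegral_indicator Metric.isOpen_ball.measurableSet]
  rfl

lemma measurable_tailOp (hg : Measurable g) (t : ℝ) : Measurable (tailOp μ D q t g) :=
  Measurable.tsum fun _ => (measurable_ballAverage hg _).const_mul _

lemma lintegral_sq_ballAverage_le (hD : D ≠ 0) {r : ℝ} (hr : 0 < r) (hg : Measurable g) :
    ∫⁻ x, ballAverage μ D r g x ^ 2 ∂μ ≤ D * ∫⁻ x, g x ^ 2 ∂μ := by
  set F : X × X → ℝ≥0∞ := {p : X × X | dist p.2 p.1 < r}.indicator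
    fun p => g p.2 ^ 2 * (dyadicMajorant μ D p.1 r)⁻¹
  have measurable_F : Measurable F := (((hg.comp measurable_snd).pow_const 2).mul
    ((measurable_dyadicMajorant r).comp measurable_fst).inv).indicator (measurableSet_dist_lt r)
  have sq_le (x : X) : ballAverage μ D r g x ^ 2 ≤ ∫⁻ y, F (x, y) ∂μ := by
    refine (sq_ballAverage_le x r hg.aemeasurable).trans_eq ?_
    rw [div_eq_mul_inv, ← lintegral_mul_const _ (hg.pow_const 2),
      ← lintegral_indicator Metric.isOpen_ball.measurableSet]
    rfl
  have lintegral_F_left (y : X) : ∫⁻ x, F (x, y) ∂μ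
      = g y ^ 2 * ∫⁻ x in Metric.ball y r, (dyadicMajorant μ D x r)⁻¹ ∂μ := by
    have measurable_inv : Measurable fun x => (dyadicMajorant μ D x r)⁻¹ :=
      (measurable_dyadicMajorant r).inv
    rw [← lintegral_const_mul _ measurable_inv,
      ← lintegral_indicator Metric.isOpen_ball.measurableSet]
    simp only [Metric.ball, dist_comm _ y]
    rfl
  calc _ ≤ ∫⁻ x, ∫⁻ y, F (x, y) ∂μ ∂μ := lintegral_mono sq_le
    _ = ∫⁻ y, ∫⁻ x, F (x, y) ∂μ ∂μ := lintegral_lintegral_swap measurable_F.aemeasurable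
    _ ≤ ∫⁻ y, g y ^ 2 * D ∂μ := by
        refine lintegral_mono fun y => ?_
        rw [lintegral_F_left]
        gcongr
        exact setLIntegral_ball_inv_dyadicMajorant_le hD hr y
    _ = _ := by rw [lintegral_mul_const _ (hg.pow_const 2), mul_comm]

theorem lintegral_sq_tailOp_le (hD : D ≠ 0) (hq : q < 1) {t : ℝ} (ht : 0 < t)
    (hg : Measurable g) :
    ∫⁻ x, tailOp μ D q t g x ^ 2 ∂μ ≤ ((1 - q)⁻¹ ^ 2 * D : ℝ≥0) * ∫⁻ x, g x ^ 2 ∂μ := by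
  set S := ∑' k : ℕ, (q : ℝ≥0∞) ^ k with hS
  have S_eq : S = ((1 - q)⁻¹ : ℝ≥0) := tsum_coe_pow hq
  have measurable_sq (k : ℕ) :=
    (measurable_ballAverage (μ := μ) (D := D) hg (2 ^ k * t)).pow_const 2
  calc _ ≤ ∫⁻ x, S * ∑' k : ℕ, (q : ℝ≥0∞) ^ k * ballAverage μ D (2 ^ k * t) g x ^ 2 ∂μ :=
        lintegral_mono fun x => sq_tsum_mul_le _ _
    _ = S * ∑' k : ℕ, (q : ℝ≥0∞) ^ k * ∫⁻ x, ballAverage μ D (2 ^ k * t) g x ^ 2 ∂μ := by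
        rw [lintegral_const_mul' _ _ (S_eq ▸ ENNReal.coe_ne_top),
          lintegral_tsum fun k => ((measurable_sq k).const_mul _).aemeasurable]
        simp only [lintegral_const_mul _ (measurable_sq _)]
    _ ≤ S * ∑' k : ℕ, (q : ℝ≥0∞) ^ k * (D * ∫⁻ x, g x ^ 2 ∂μ) := by
        gcongr with k
        exact lintegral_sq_ballAverage_le hD (by positivity) hg
    _ = _ := by
        rw [ENNReal.tsum_mul_right, ← hS, S_eq]
        push_cast
        ring

end DoublingMajorant

section Rates

variable {α : ℝ}

/-- The decay rate of the kernel weights between consecutive dyadic scales. Half of the available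
exponent `α` is spent on the summability over scales, the other half is kept for the decay between
distant levels of the grid. -/
noncomputable def kernelRate (α : ℝ) : ℝ≥0 := (1 / 2 : ℝ≥0) ^ (α / 2)

/-- The decay rate of the interaction between consecutive levels of the dyadic grid. The base is
`2 / 3` because the distances in `goodSet` lose a factor `3 / 4` per level while the scales lose
a factor `1 / 2`. -/
noncomputable def levelRate (α : ℝ) : ℝ≥0 := (2 / 3 : ℝ≥0) ^ (α / 2)

lemma kernelRate_sq (α : ℝ) : kernelRate α ^ 2 = (1 / 2 : ℝ≥0) ^ α := by
  rw [kernelRate, ← NNReal.rpow_natCast, ← NNReal.rpow_mul, Nat.cast_ofNat,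
    div_mul_cancel₀ _ two_ne_zero]

lemma kernelRate_lt_one (hα : 0 < α) : kernelRate α < 1 :=
  NNReal.rpow_lt_one (by rw [div_lt_one₀] <;> norm_num) (by positivity)

lemma levelRate_lt_one (hα : 0 < α) : levelRate α < 1 :=
  NNReal.rpow_lt_one (by rw [div_lt_one₀] <;> norm_num) (by positivity)

lemma levelRate_pos (α : ℝ) : 0 < levelRate α := NNReal.rpow_pos (by positivity)

lemma half_rpow_le_levelRate (hα : 0 < α) : (1 / 2 : ℝ≥0) ^ α ≤ levelRate α := by
  rw [← kernelRate_sq, kernelRate, levelRate, sq, ← NNReal.mul_rpow]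
  refine NNReal.rpow_le_rpow ?_ (by positivity)
  rw [← NNReal.coe_le_coe]
  push_cast
  norm_num

end Rates

section KernelBounds

variable {n : ℕ} {μ : Measure (Fin n → ℝ)} {lam : (Fin n → ℝ) → ℝ → ℝ} {Clam α t : ℝ}

namespace IsUpperDoubling

lemma one_le (h : IsUpperDoubling μ lam Clam) : 1 ≤ Clam := by
  have lam_pos := h.pos 0 1 one_pos
  have lam_le : lam 0 1 ≤ lam 0 (2 * 1) :=
    h.mono 0 (mem_Ioi.2 one_pos) (mem_Ioi.2 (by norm_num)) (by norm_num)
  by_contra Clam_lt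
  nlinarith [h.doubling 0 1 one_pos]

lemma isLocallyFiniteMeasure (h : IsUpperDoubling μ lam Clam) : IsLocallyFiniteMeasure μ :=
  ⟨fun x => ⟨Metric.ball x 1, Metric.ball_mem_nhds x one_pos,
    (h.measure_ball_le x 1 one_pos).trans_lt ENNReal.ofReal_lt_top⟩⟩

lemma le_pow_mul (h : IsUpperDoubling μ lam Clam) (x : Fin n → ℝ) {r : ℝ} (hr : 0 < r) (k : ℕ) :
    lam x (2 ^ k * r) ≤ Clam ^ k * lam x r := by
  have hC := h.one_le
  induction k with
  | zero => simp only [pow_zero, one_mul, le_refl]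
  | succ k ih =>
    calc lam x (2 ^ (k + 1) * r) = lam x (2 * (2 ^ k * r)) := by ring_nf
      _ ≤ Clam * lam x (2 ^ k * r) := h.doubling x _ (by positivity)
      _ ≤ Clam * (Clam ^ k * lam x r) := by gcongr
      _ = _ := by ring

lemma dyadicMajorant_le (h : IsUpperDoubling μ lam Clam) (x : Fin n → ℝ) {r : ℝ} (hr : 0 < r) :
    dyadicMajorant μ Clam.toNNReal x r ≤ ENNReal.ofReal (lam x r) := by
  refine iSup_le fun k => ENNReal.div_le_of_le_mul ?_
  calc _ ≤ ENNReal.ofReal (lam x (2 ^ k * r)) := h.measure_ball_le x _ (by positivity)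
    _ ≤ ENNReal.ofReal (lam x r * Clam ^ k) := by
        rw [mul_comm (lam x r)]
        exact ENNReal.ofReal_le_ofReal (h.le_pow_mul x hr k)
    _ = _ := by
        rw [ENNReal.ofReal_mul (h.pos x r hr).le,
          ENNReal.ofReal_pow (zero_le_one.trans h.one_le)]
        rfl

lemma inv_le_mul_inv (h : IsUpperDoubling μ lam Clam) (x : Fin n → ℝ) {r : ℝ} (hr : 0 < r) :
    (lam x r)⁻¹ ≤ Clam * (lam x (2 * r))⁻¹ := by
  rw [← div_eq_mul_inv, le_div_iff₀ (h.pos x _ (by positivity)), inv_mul_le_iff₀ (h.pos x r hr),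
    mul_comm (lam x r)]
  exact h.doubling x r hr

lemma le_kernelDenom (h : IsUpperDoubling μ lam Clam) (hα : 0 < α) (t : ℝ) (x y : Fin n → ℝ) :
    t ^ α * lam x t ≤ kernelDenom lam α t x y := by
  refine le_add_of_nonneg_right ?_
  rcases (dist_nonneg : 0 ≤ dist x y).eq_or_lt with h0 | h0
  · rw [← h0, Real.zero_rpow hα.ne', zero_mul]
  · exact (mul_pos (Real.rpow_pos_of_pos h0 α) (h.pos x _ h0)).le

lemma le_kernelDenom_of_le_dist (h : IsUpperDoubling μ lam Clam) (hα : 0 ≤ α) (ht : 0 < t)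
    {x y : Fin n → ℝ} {r : ℝ} (hr : 0 < r) (hxy : r ≤ dist x y) :
    r ^ α * lam x r ≤ kernelDenom lam α t x y := by
  have lam_le : lam x r ≤ lam x (dist x y) := h.mono x hr (hr.trans_le hxy) hxy
  have lam_nonneg : 0 ≤ lam x r := (h.pos x r hr).le
  have lam_t_nonneg : 0 ≤ lam x t := (h.pos x t ht).le
  calc r ^ α * lam x r ≤ dist x y ^ α * lam x (dist x y) := by gcongr
    _ ≤ _ := le_add_of_nonneg_left (by positivity)

lemma div_kernelDenom_nonneg (h : IsUpperDoubling μ lam Clam) (hα : 0 < α) (ht : 0 < t)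
    (x y : Fin n → ℝ) : 0 ≤ t ^ α / kernelDenom lam α t x y := by
  have lam_nonneg := (h.pos x t ht).le
  have denom_nonneg := le_trans (by positivity) (h.le_kernelDenom hα t x y)
  positivity

lemma div_kernelDenom_le_inv (h : IsUpperDoubling μ lam Clam) (hα : 0 < α) (ht : 0 < t)
    (x y : Fin n → ℝ) : t ^ α / kernelDenom lam α t x y ≤ (lam x t)⁻¹ := by
  have lam_pos := h.pos x t ht
  have denom_le := h.le_kernelDenom hα t x y
  calc t ^ α / kernelDenom lam α t x y ≤ t ^ α / (t ^ α * lam x t) := by gcongr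
    _ = (lam x t)⁻¹ := by field_simp

lemma div_kernelDenom_le_of_le_dist (h : IsUpperDoubling μ lam Clam) (hα : 0 ≤ α) (ht : 0 < t)
    {x y : Fin n → ℝ} {m : ℕ} (hxy : 2 ^ m * t ≤ dist x y) :
    t ^ α / kernelDenom lam α t x y
      ≤ ((1 / 2 : ℝ) ^ α) ^ m * (Clam * (lam x (2 ^ (m + 1) * t))⁻¹) := by
  have r_pos : 0 < 2 ^ m * t := by positivity
  have lam_pos := h.pos x _ r_pos
  have denom_le := h.le_kernelDenom_of_le_dist hα ht r_pos hxy
  calc t ^ α / kernelDenom lam α t x y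
      ≤ t ^ α / ((2 ^ m * t) ^ α * lam x (2 ^ m * t)) := by gcongr
    _ = ((1 / 2 : ℝ) ^ α) ^ m * (lam x (2 ^ m * t))⁻¹ := by
        rw [Real.mul_rpow (by positivity) ht.le, one_div, Real.inv_rpow two_pos.le,
          ← Real.rpow_pow_comm two_pos.le, inv_pow]
        field_simp
    _ ≤ _ := by
        rw [pow_succ', mul_assoc 2]
        gcongr
        exact h.inv_le_mul_inv x r_pos

lemma exists_div_kernelDenom_le (h : IsUpperDoubling μ lam Clam) (hα : 0 < α) (ht : 0 < t)
    (x y : Fin n → ℝ) :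
    ∃ k : ℕ, dist x y < 2 ^ k * t ∧
      t ^ α / kernelDenom lam α t x y
        ≤ (Clam * 2 ^ α) * ((1 / 2 : ℝ) ^ α) ^ k * (lam x (2 ^ k * t))⁻¹ := by
  classical
  have exists_lt : ∃ k : ℕ, dist x y < 2 ^ k * t := by
    obtain ⟨k, hk⟩ := pow_unbounded_of_one_lt (dist x y / t) one_lt_two
    exact ⟨k, (div_lt_iff₀ ht).1 hk⟩
  refine ⟨Nat.find exists_lt, Nat.find_spec exists_lt, ?_⟩
  rcases hk : Nat.find exists_lt with _ | m
  · have lam_pos := h.pos x t ht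
    simp only [pow_zero, one_mul, mul_one]
    exact (h.div_kernelDenom_le_inv hα ht x y).trans (le_mul_of_one_le_left (by positivity)
      (one_le_mul_of_one_le_of_one_le h.one_le (Real.one_le_rpow one_le_two hα.le)))
  · have le_dist := not_lt.1 (Nat.find_min exists_lt (m := m) (hk ▸ m.lt_succ_self))
    refine (h.div_kernelDenom_le_of_le_dist hα.le ht le_dist).trans_eq ?_
    rw [one_div, Real.inv_rpow two_pos.le, pow_succ (((2 : ℝ) ^ α)⁻¹), inv_pow]
    field_simp

lemma div_kernelDenom_le_tailKernel (h : IsUpperDoubling μ lam Clam) (hα : 0 < α) (ht : 0 < t)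
    (x y : Fin n → ℝ) :
    ENNReal.ofReal (t ^ α / kernelDenom lam α t x y)
      ≤ (Clam.toNNReal * 2 ^ α : ℝ≥0)
        * tailKernel μ Clam.toNNReal (kernelRate α ^ 2) t x y := by
  obtain ⟨k, hk, le_inv⟩ := h.exists_div_kernelDenom_le hα ht x y
  have hC : 0 ≤ Clam := zero_le_one.trans h.one_le
  have r_pos : 0 < 2 ^ k * t := by positivity
  have ofReal_const : ENNReal.ofReal (Clam * 2 ^ α) = (Clam.toNNReal * 2 ^ α : ℝ≥0) := by
    rw [ENNReal.ofReal, Real.toNNReal_mul hC, Real.toNNReal_rpow_of_nonneg two_pos.le,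
      Real.toNNReal_ofNat]
  have ofReal_ratio : ENNReal.ofReal ((1 / 2 : ℝ) ^ α) = ((1 / 2 : ℝ≥0) ^ α : ℝ≥0) := by
    rw [ENNReal.ofReal, Real.toNNReal_rpow_of_nonneg (by norm_num), one_div, Real.toNNReal_inv,
      Real.toNNReal_ofNat, one_div]
  refine (ENNReal.ofReal_le_ofReal le_inv).trans ?_
  rw [ENNReal.ofReal_mul (by positivity), ENNReal.ofReal_mul (by positivity), mul_assoc,
    ENNReal.ofReal_inv_of_pos (h.pos x _ r_pos), ENNReal.ofReal_pow (by positivity), ofReal_const,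
    ofReal_ratio, kernelRate_sq]
  gcongr
  refine le_trans ?_ (ENNReal.le_tsum k)
  rw [indicator_of_mem (Metric.mem_ball'.2 hk)]
  gcongr
  exact h.dyadicMajorant_le x r_pos

end IsUpperDoubling

/-- The form of the hypotheses on `s` used by all estimates: the majorant `lam` is replaced by
`dyadicMajorant μ D`. The decay ratio is written as `q ^ 2` so that a factor `q ^ k` can be given
up to exploit that the integration runs far from `x`. -/
structure HasTailBound (μ : Measure (Fin n → ℝ)) (D q A : ℝ≥0) (α : ℝ)
    (s : ℝ → (Fin n → ℝ) → (Fin n → ℝ) → ℂ) : Prop where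
  measurable : Measurable fun p : ℝ × (Fin n → ℝ) × (Fin n → ℝ) => s p.1 p.2.1 p.2.2
  size : ∀ t, 0 < t → ∀ x y, ‖s t x y‖ₑ ≤ A * tailKernel μ D (q ^ 2) t x y
  holder : ∀ t, 0 < t → ∀ x y z, dist y z < t / 2 →
    ‖s t x y - s t x z‖ₑ
      ≤ A * (ENNReal.ofReal ((dist y z / t) ^ α) * tailKernel μ D (q ^ 2) t x y)

/-- The family `s` extended by zero to `t ≤ 0`. It is measurable on the whole line. -/
noncomputable def positiveTimeKernel (s : ℝ → (Fin n → ℝ) → (Fin n → ℝ) → ℂ) :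
    ℝ → (Fin n → ℝ) → (Fin n → ℝ) → ℂ :=
  fun t x y => if 0 < t then s t x y else 0

variable {Cs : ℝ} {s : ℝ → (Fin n → ℝ) → (Fin n → ℝ) → ℂ}

lemma theta_positiveTimeKernel (f : (Fin n → ℝ) → ℂ) (ht : 0 < t) (x : Fin n → ℝ) :
    theta μ (positiveTimeKernel s) f t x = theta μ s f t x := by
  simp only [theta, positiveTimeKernel, if_pos ht]

namespace IsSquareKernel

lemma measurable_positiveTimeKernel (hs : IsSquareKernel lam α Cs s) :
    Measurable fun p : ℝ × (Fin n → ℝ) × (Fin n → ℝ) =>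
      positiveTimeKernel s p.1 p.2.1 p.2.2 := by
  have measurableSet_pos : MeasurableSet {p : ℝ × (Fin n → ℝ) × (Fin n → ℝ) | 0 < p.1} :=
    measurableSet_lt measurable_const measurable_fst
  refine measurable_of_restrict_of_restrict_compl measurableSet_pos ?_ ?_
  · have measurable_incl : Measurable fun p : {p : ℝ × (Fin n → ℝ) × (Fin n → ℝ) | 0 < p.1} =>
        ((⟨p.1.1, p.2⟩ : Ioi (0 : ℝ)), p.1.2) :=
      (Measurable.subtype_mk (measurable_fst.comp measurable_subtype_coe)).prodMk
        (measurable_snd.comp measurable_subtype_coe)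
    convert! hs.measurable.comp measurable_incl using 1
    ext p
    exact if_pos p.2
  · convert! measurable_const (a := (0 : ℂ)) using 1
    ext p
    exact if_neg p.2

lemma enorm_le_tailKernel (h : IsUpperDoubling μ lam Clam) (hα : 0 < α)
    (hs : IsSquareKernel lam α Cs s) (ht : 0 < t) (x y : Fin n → ℝ) :
    ‖s t x y‖ₑ ≤ (Cs.toNNReal * (Clam.toNNReal * 2 ^ α) : ℝ≥0)
      * tailKernel μ Clam.toNNReal (kernelRate α ^ 2) t x y := by
  rw [ENNReal.coe_mul, mul_assoc, ← ofReal_norm]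
  refine (ENNReal.ofReal_le_ofReal (hs.size t ht x y)).trans ?_
  rw [ENNReal.ofReal_mul' (h.div_kernelDenom_nonneg hα ht x y)]
  exact mul_le_mul_right (h.div_kernelDenom_le_tailKernel hα ht x y) _

lemma enorm_sub_le_tailKernel (h : IsUpperDoubling μ lam Clam) (hα : 0 < α)
    (hs : IsSquareKernel lam α Cs s) (ht : 0 < t) (x : Fin n → ℝ) {y z : Fin n → ℝ}
    (hyz : dist y z < t / 2) :
    ‖s t x y - s t x z‖ₑ ≤ (Cs.toNNReal * (Clam.toNNReal * 2 ^ α) : ℝ≥0)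
      * (ENNReal.ofReal ((dist y z / t) ^ α)
        * tailKernel μ Clam.toNNReal (kernelRate α ^ 2) t x y) := by
  have norm_le :
      ‖s t x y - s t x z‖ ≤ Cs * ((dist y z / t) ^ α * (t ^ α / kernelDenom lam α t x y)) := by
    refine (hs.holder t ht x y z hyz).trans_eq ?_
    rw [Real.div_rpow dist_nonneg ht.le]
    field_simp
  have nonneg := h.div_kernelDenom_nonneg hα ht x y
  rw [ENNReal.coe_mul, mul_assoc, mul_left_comm (ENNReal.ofNNReal _) (ENNReal.ofReal _),
    ← ofReal_norm]
  refine (ENNReal.ofReal_le_ofReal norm_le).trans ?_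
  rw [ENNReal.ofReal_mul' (by positivity), ENNReal.ofReal_mul' nonneg]
  exact mul_le_mul_right (mul_le_mul_right (h.div_kernelDenom_le_tailKernel hα ht x y) _) _

theorem hasTailBound (h : IsUpperDoubling μ lam Clam) (hα : 0 < α)
    (hs : IsSquareKernel lam α Cs s) :
    HasTailBound μ Clam.toNNReal (kernelRate α) (Cs.toNNReal * (Clam.toNNReal * 2 ^ α)) α
      (positiveTimeKernel s) where
  measurable := hs.measurable_positiveTimeKernel
  size t ht x y := by
    simp only [positiveTimeKernel, if_pos ht]
    exact hs.enorm_le_tailKernel h hα ht x y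
  holder t ht x y z hyz := by
    simp only [positiveTimeKernel, if_pos ht]
    exact hs.enorm_sub_le_tailKernel h hα ht x hyz

end IsSquareKernel

end KernelBounds

lemma enorm_integral_le_of_cell {X ι E : Type*} [MeasurableSpace X] [MeasurableSpace ι]
    [Countable ι] [MeasurableSingletonClass ι] [NormedAddCommGroup E] [NormedSpace ℝ E]
    {μ : Measure X} {π : X → ι} (hπ : Measurable π) {F : X → E} (hF : Integrable F μ)
    {G : X → ℝ≥0∞}
    (hFG : ∀ i, ‖∫ x in π ⁻¹' {i}, F x ∂μ‖ₑ ≤ ∫⁻ x in π ⁻¹' {i}, G x ∂μ) :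
    ‖∫ x, F x ∂μ‖ₑ ≤ ∫⁻ x, G x ∂μ := by
  have integral_eq : ∫ x, F x ∂μ = ∑' i, ∫ x in π ⁻¹' {i}, F x ∂μ := by
    rw [← integral_iUnion (fun i => hπ (measurableSet_singleton i)) (fun i j hij =>
      Disjoint.preimage _ (disjoint_singleton.2 hij)) hF.integrableOn, ← preimage_iUnion,
      iUnion_of_singleton, preimage_univ, setIntegral_univ]
  rw [integral_eq, lintegral_eq_tsum_cell μ hπ]
  exact enorm_tsum_le_tsum_enorm.trans (ENNReal.tsum_le_tsum hFG)

section TailBound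

variable {n : ℕ} {μ : Measure (Fin n → ℝ)} {D q A B : ℝ≥0} {α t : ℝ}
  {s : ℝ → (Fin n → ℝ) → (Fin n → ℝ) → ℂ} {f : (Fin n → ℝ) → ℂ}

namespace HasTailBound

lemma measurable_right (hs : HasTailBound μ D q A α s) (t : ℝ) (x : Fin n → ℝ) :
    Measurable (s t x) :=
  hs.measurable.comp (measurable_const.prodMk (measurable_const.prodMk measurable_id))

lemma setLIntegral_enorm_mul_le (hs : HasTailBound μ D q A α s) (ht : 0 < t) {x : Fin n → ℝ}
    {E : Set (Fin n → ℝ)} (hE : MeasurableSet E) {ρ : ℝ} (hρ : ∀ y ∈ E, ρ ≤ dist y x)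
    {κ : ℝ≥0} (hκ : ∀ k : ℕ, ρ < 2 ^ k * t → q ^ k ≤ κ) {g : (Fin n → ℝ) → ℝ≥0∞}
    (hg : Measurable g) :
    ∫⁻ y in E, ‖s t x y‖ₑ * g y ∂μ ≤ A * κ * tailOp μ D q t g x := by
  rw [← lintegral_tailKernel_mul hg, ← lintegral_const_mul' _ _ (by finiteness)]
  refine (setLIntegral_mono' hE fun y hy => ?_).trans (setLIntegral_le_lintegral _ _)
  rw [← mul_assoc, mul_assoc (A : ℝ≥0∞)]
  gcongr
  refine (hs.size t ht x y).trans ?_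
  gcongr
  exact tailKernel_sq_le (hρ y hy) fun k hk => by exact_mod_cast hκ k hk

lemma lintegral_enorm_mul_le (hs : HasTailBound μ D q A α s) (hq : q < 1) (ht : 0 < t)
    (x : Fin n → ℝ) {g : (Fin n → ℝ) → ℝ≥0∞} (hg : Measurable g) :
    ∫⁻ y, ‖s t x y‖ₑ * g y ∂μ ≤ A * tailOp μ D q t g x := by
  simpa only [Measure.restrict_univ, ENNReal.coe_one, mul_one] using
    hs.setLIntegral_enorm_mul_le ht (x := x) MeasurableSet.univ (ρ := 0) (κ := 1)
      (fun _ _ => dist_nonneg) (fun k _ => pow_le_one₀ zero_le hq.le) hg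

lemma enorm_theta_le (hs : HasTailBound μ D q A α s) (hq : q < 1) (ht : 0 < t) (x : Fin n → ℝ)
    (hf : Measurable f) : ‖theta μ s f t x‖ₑ ≤ A * tailOp μ D q t (fun y => ‖f y‖ₑ) x := by
  refine (enorm_integral_le_lintegral_enorm _).trans ?_
  simp only [enorm_mul]
  exact hs.lintegral_enorm_mul_le hq ht x hf.enorm

lemma integrable_of_tailOp (hs : HasTailBound μ D q A α s) (hq : q < 1) (ht : 0 < t)
    (x : Fin n → ℝ) (hf : Measurable f) (hfin : tailOp μ D q t (fun y => ‖f y‖ₑ) x ≠ ∞) :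
    Integrable (fun y => s t x y * f y) μ := by
  refine ⟨((hs.measurable_right t x).mul hf).aestronglyMeasurable, ?_⟩
  rw [hasFiniteIntegral_iff_enorm]
  simp only [enorm_mul]
  exact (hs.lintegral_enorm_mul_le hq ht x hf.enorm).trans_lt
    (ENNReal.mul_lt_top ENNReal.coe_lt_top hfin.lt_top)

lemma integrable_of_memLp (hs : HasTailBound μ D q A α s) (hq : q < 1) (hμ : μ ≠ 0) (ht : 0 < t)
    (x : Fin n → ℝ) (hf : Measurable f) (hf2 : MemLp f 2 μ) :
    Integrable (fun y => s t x y * f y) μ :=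
  hs.integrable_of_tailOp hq ht x hf (tailOp_ne_top_of_memLp hq hμ ht hf2 x)

lemma integrable_of_bounded (hs : HasTailBound μ D q A α s) (hq : q < 1) (ht : 0 < t)
    (x : Fin n → ℝ) (hf : Measurable f) (hB : ∀ x, ‖f x‖ₑ ≤ B) :
    Integrable (fun y => s t x y * f y) μ :=
  hs.integrable_of_tailOp hq ht x hf
    (ne_top_of_le_ne_top ENNReal.coe_ne_top (tailOp_le_of_bounded hq hB t x))

lemma enorm_theta_le_of_bounded (hs : HasTailBound μ D q A α s) (hq : q < 1) (ht : 0 < t)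
    (x : Fin n → ℝ) (hf : Measurable f) (hB : ∀ x, ‖f x‖ₑ ≤ B) :
    ‖theta μ s f t x‖ₑ ≤ (A * (B * (1 - q)⁻¹) : ℝ≥0) := by
  rw [ENNReal.coe_mul]
  exact (hs.enorm_theta_le hq ht x hf).trans (mul_le_mul_right (tailOp_le_of_bounded hq hB t x) _)

lemma enorm_sub_le_of_dist_le (hs : HasTailBound μ D q A α s) (hq : q < 1) (hα : 0 < α)
    (ht : 0 < t) (x : Fin n → ℝ) {y z : Fin n → ℝ} {δ : ℝ} (hδ : δ < t / 2) (hyz : dist y z ≤ δ) :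
    ‖s t x y - s t x z‖ₑ ≤ A * (ENNReal.ofReal ((δ / t) ^ α) * tailKernel μ D q t x y) := by
  have tailKernel_sq_le_self : tailKernel μ D (q ^ 2) t x y ≤ tailKernel μ D q t x y := by
    simpa only [one_mul] using tailKernel_sq_le dist_nonneg (κ := 1)
      fun k _ => pow_le_one₀ zero_le (by exact_mod_cast hq.le)
  refine (hs.holder t ht x y z (hyz.trans_lt hδ)).trans ?_
  gcongr

lemma enorm_setIntegral_le_of_mean_zero (hs : HasTailBound μ D q A α s) (hq : q < 1) (hα : 0 < α)
    (ht : 0 < t) (x : Fin n → ℝ) {E : Set (Fin n → ℝ)} (hE : MeasurableSet E)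
    (hsf : IntegrableOn (fun y => s t x y * f y) E μ) (hf : IntegrableOn f E μ)
    (hmean : ∫ y in E, f y ∂μ = 0) {δ : ℝ} (hδ : δ < t / 2)
    (hdist : ∀ y ∈ E, ∀ z ∈ E, dist y z ≤ δ) :
    ‖∫ y in E, s t x y * f y ∂μ‖ₑ
      ≤ ∫⁻ y in E, A * (ENNReal.ofReal ((δ / t) ^ α) * (tailKernel μ D q t x y * ‖f y‖ₑ)) ∂μ := by
  rcases E.eq_empty_or_nonempty with rfl | ⟨z, hz⟩
  · simp only [Measure.restrict_empty, integral_zero_measure, enorm_zero, zero_le]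
  have subtract_center :
      ∫ y in E, s t x y * f y ∂μ = ∫ y in E, (s t x y - s t x z) * f y ∂μ := by
    simp_rw [sub_mul]
    rw [integral_sub hsf (hf.const_mul _), integral_const_mul, hmean, mul_zero, sub_zero]
  rw [subtract_center]
  refine (enorm_integral_le_lintegral_enorm _).trans (setLIntegral_mono' hE fun y hy => ?_)
  rw [enorm_mul, ← mul_assoc (ENNReal.ofReal _), ← mul_assoc (A : ℝ≥0∞)]
  gcongr
  exact hs.enorm_sub_le_of_dist_le hq hα ht x hδ (hdist y hy z hz)

theorem enorm_theta_le_of_mean_zero {ι : Type*} [MeasurableSpace ι] [Countable ι]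
    [MeasurableSingletonClass ι] (hs : HasTailBound μ D q A α s) (hq : q < 1) (hα : 0 < α)
    (ht : 0 < t) (x : Fin n → ℝ) (hf : Measurable f)
    (hsf : Integrable (fun y => s t x y * f y) μ) {π : (Fin n → ℝ) → ι} (hπ : Measurable π)
    (hfint : ∀ i, IntegrableOn f (π ⁻¹' {i}) μ) (hmean : ∀ i, ∫ y in π ⁻¹' {i}, f y ∂μ = 0)
    {δ : ℝ} (hδ : δ < t / 2) (hdist : ∀ y z, π y = π z → dist y z ≤ δ) :
    ‖theta μ s f t x‖ₑ
      ≤ A * (ENNReal.ofReal ((δ / t) ^ α) * tailOp μ D q t (fun y => ‖f y‖ₑ) x) := by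
  rw [← lintegral_tailKernel_mul hf.enorm, ← lintegral_const_mul' _ _ ENNReal.ofReal_ne_top,
    ← lintegral_const_mul' _ _ ENNReal.coe_ne_top]
  exact enorm_integral_le_of_cell hπ hsf fun i =>
    hs.enorm_setIntegral_le_of_mean_zero hq hα ht x (hπ (measurableSet_singleton i))
      hsf.integrableOn (hfint i) (hmean i) hδ fun y hy z hz => hdist y z (hy.trans hz.symm)

end HasTailBound

end TailBound

section Grid

variable {n : ℕ} {τ L : ℝ} {k : ℕ} {x y : Fin n → ℝ}

/-- The index of the cell containing `x` in the grid of sidelength `L / 2 ^ k`, shifted by `τ`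
in each coordinate. -/
noncomputable def gridIdx (τ L : ℝ) (k : ℕ) (x : Fin n → ℝ) : Fin n → ℤ :=
  fun i => ⌊(x i - τ) / (L / 2 ^ k)⌋

lemma measurable_gridIdx (τ L : ℝ) (k : ℕ) : Measurable (gridIdx (n := n) τ L k) :=
  measurable_pi_lambda _ fun i => Int.measurable_floor.comp (by fun_prop)

lemma factorsThrough_gridIdx_succ (τ L : ℝ) (k : ℕ) :
    (gridIdx (n := n) τ L k).FactorsThrough (gridIdx τ L (k + 1)) := by
  have floor_eq (a : ℝ) : ⌊a / (L / 2 ^ k)⌋ = ⌊a / (L / 2 ^ (k + 1))⌋ / 2 := by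
    have side_eq : L / 2 ^ k = L / 2 ^ (k + 1) * 2 := by rw [pow_succ]; field_simp
    rw [side_eq, ← div_div]
    exact_mod_cast Int.floor_div_natCast (a / (L / 2 ^ (k + 1))) 2
  intro x y h
  funext i
  have idx_eq : ⌊(x i - τ) / (L / 2 ^ (k + 1))⌋ = ⌊(y i - τ) / (L / 2 ^ (k + 1))⌋ := congr_fun h i
  simp only [gridIdx, floor_eq, idx_eq]

lemma gridIdx_preimage (hL : 0 < L) (i : Fin n → ℤ) :
    gridIdx τ L k ⁻¹' {i} = cube (fun j => τ + i j * (L / 2 ^ k)) (L / 2 ^ k) := by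
  have side_pos : 0 < L / 2 ^ k := by positivity
  ext x
  simp only [mem_preimage, mem_singleton_iff, cube, mem_ofPred_eq, mem_Ico, funext_iff, gridIdx]
  refine forall_congr' fun j => ?_
  rw [Int.floor_eq_iff, le_div_iff₀ side_pos, div_lt_iff₀ side_pos]
  constructor <;> rintro ⟨h_le, h_lt⟩ <;> constructor <;> linarith

lemma dist_le_of_gridIdx_eq (hL : 0 < L) (h : gridIdx τ L k x = gridIdx τ L k y) :
    dist x y ≤ L / 2 ^ k := by
  have side_pos : 0 < L / 2 ^ k := by positivity
  refine (dist_pi_le_iff side_pos.le).2 fun i => ?_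
  have abs_sub_lt := Int.abs_sub_lt_one_of_floor_eq_floor (congr_fun h i)
  rw [← sub_div, abs_div, abs_of_pos side_pos, div_lt_one side_pos, sub_sub_sub_cancel_right]
    at abs_sub_lt
  exact abs_sub_lt.le

lemma isRefiningPartition_gridIdx {μ : Measure (Fin n → ℝ)} [IsLocallyFiniteMeasure μ] (τ : ℝ)
    (hL : 0 < L) : IsRefiningPartition μ (gridIdx τ L) where
  level k :=
    { measurable := measurable_gridIdx τ L k
      measure_cell_ne_top := fun _ => (Bornology.IsBounded.measure_lt_top
        (Metric.isBounded_iff.2 ⟨L / 2 ^ k, fun _ hx _ hy =>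
          dist_le_of_gridIdx_eq hL (hx.trans hy.symm)⟩)).ne }
  factorsThrough_succ := factorsThrough_gridIdx_succ τ L

end Grid

section Averaging

variable {Ω X : Type*} [MeasurableSpace Ω] [MeasurableSpace X] {P : Measure Ω} {ν : Measure X}
  [SFinite ν] {G : Set (Ω × X)} {F : X → ℝ≥0∞}

lemma measurable_setLIntegral_section (hG : MeasurableSet G) (hF : Measurable F) :
    Measurable fun ω => ∫⁻ x in Prod.mk ω ⁻¹' G, F x ∂ν := by
  convert! ((hF.comp measurable_snd).indicator hG).lintegral_prod_right' (ν := ν) using 2 with ω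
  rw [← lintegral_indicator (hG.preimage measurable_prodMk_left)]
  rfl

lemma mul_lintegral_le_lintegral_setLIntegral_section [SFinite P] (hG : MeasurableSet G)
    (hF : Measurable F) {δ : ℝ≥0∞} (hδ : ∀ x, δ ≤ P {ω | (ω, x) ∈ G}) :
    δ * ∫⁻ x, F x ∂ν ≤ ∫⁻ ω, ∫⁻ x in Prod.mk ω ⁻¹' G, F x ∂ν ∂P := by
  have measurable_indicator : Measurable (G.indicator fun p => F p.2) :=
    (hF.comp measurable_snd).indicator hG
  calc δ * ∫⁻ x, F x ∂ν ≤ ∫⁻ x, F x * P {ω | (ω, x) ∈ G} ∂ν := by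
        rw [mul_comm, ← lintegral_mul_const _ hF]
        gcongr with x
        exact hδ x
    _ = ∫⁻ x, ∫⁻ ω, G.indicator (fun p => F p.2) (ω, x) ∂P ∂ν := by
        refine lintegral_congr fun x => ?_
        have measurableSet_section : MeasurableSet {ω | (ω, x) ∈ G} :=
          hG.preimage measurable_prodMk_right
        rw [← setLIntegral_const, ← lintegral_indicator measurableSet_section]
        rfl
    _ = ∫⁻ ω, ∫⁻ x, G.indicator (fun p => F p.2) (ω, x) ∂ν ∂P :=
        lintegral_lintegral_swap
          (measurable_indicator.comp (measurable_snd.prodMk measurable_fst)).aemeasurable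
    _ = _ := by
        refine lintegral_congr fun ω => ?_
        rw [← lintegral_indicator (hG.preimage measurable_prodMk_left)]
        rfl

end Averaging

section Good

variable {n : ℕ} {η τ L : ℝ}

/-- The points whose distance to the grid hyperplanes of each level `k ≤ j` is at least
`η (3/4) ^ (j - k)` times the sidelength of that level. The ratio `3/4` makes the exceptional
proportion summable in `j - k`, while these distances still decay more slowly than the scale
`L / 2 ^ j`. -/
def goodSet (η τ L : ℝ) (j : ℕ) : Set (Fin n → ℝ) :=
  {x | ∀ k ≤ j, ∀ (i : Fin n) (m : ℤ),
    η * (3 / 4) ^ (j - k) * (L / 2 ^ k) ≤ |x i - τ - m * (L / 2 ^ k)|}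

lemma abs_sub_floor_le_of_floor_ne {a b : ℝ} (h : ⌊b⌋ ≠ ⌊a⌋) :
    ∃ m : ℤ, |a - m| ≤ |b - a| := by
  rcases lt_or_gt_of_ne h with floor_lt | floor_lt
  · refine ⟨⌊a⌋, ?_⟩
    have b_lt := Int.floor_lt.1 floor_lt
    rw [abs_of_nonneg (sub_nonneg.2 (Int.floor_le a)), abs_sub_comm b,
      abs_of_nonneg (by linarith [Int.floor_le a])]
    linarith
  · refine ⟨⌊b⌋, ?_⟩
    have a_lt := Int.floor_lt.1 floor_lt
    rw [abs_sub_comm a, abs_of_nonneg (sub_nonneg.2 a_lt.le),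
      abs_of_nonneg (by linarith [Int.floor_le b])]
    linarith [Int.floor_le b]

lemma le_dist_of_mem_goodSet (hL : 0 < L) {j k : ℕ} (hk : k ≤ j) {x y : Fin n → ℝ}
    (hx : x ∈ goodSet η τ L j) (hy : gridIdx τ L k y ≠ gridIdx τ L k x) :
    η * (3 / 4) ^ (j - k) * (L / 2 ^ k) ≤ dist y x := by
  obtain ⟨i, floor_ne⟩ := Function.ne_iff.1 hy
  obtain ⟨m, abs_le⟩ := abs_sub_floor_le_of_floor_ne floor_ne
  have side_pos : 0 < L / 2 ^ k := by positivity
  refine (hx k hk i m).trans (le_trans ?_ (dist_le_pi_dist y x i))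
  have rescale (u : ℝ) : |u| = |u / (L / 2 ^ k)| * (L / 2 ^ k) := by
    rw [abs_div, abs_of_pos side_pos, div_mul_cancel₀ _ side_pos.ne']
  rw [Real.dist_eq, rescale (x i - τ - _), rescale (y i - x i)]
  have rescaled_left : (x i - τ - m * (L / 2 ^ k)) / (L / 2 ^ k) = (x i - τ) / (L / 2 ^ k) - m := by
    field_simp
  have rescaled_right :
      (y i - x i) / (L / 2 ^ k) = (y i - τ) / (L / 2 ^ k) - (x i - τ) / (L / 2 ^ k) := by
    ring
  rw [rescaled_left, rescaled_right]
  exact mul_le_mul_of_nonneg_right abs_le side_pos.le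

lemma measurableSet_goodSet_prod (η L : ℝ) (j : ℕ) :
    MeasurableSet {p : ℝ × (Fin n → ℝ) | p.2 ∈ goodSet η p.1 L j} := by
  have eq_iInter : {p : ℝ × (Fin n → ℝ) | p.2 ∈ goodSet η p.1 L j} =
      ⋂ (k : ℕ) (_ : k ≤ j) (i : Fin n) (m : ℤ), {p : ℝ × (Fin n → ℝ) |
        η * (3 / 4) ^ (j - k) * (L / 2 ^ k) ≤ |p.2 i - p.1 - m * (L / 2 ^ k)|} := by
    ext p
    simp only [goodSet, mem_ofPred_eq, mem_iInter]
  rw [eq_iInter]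
  refine MeasurableSet.iInter fun k => MeasurableSet.iInter fun _ => MeasurableSet.iInter fun i =>
    MeasurableSet.iInter fun m => measurableSet_le measurable_const ?_
  exact continuous_abs.measurable.comp (by fun_prop)

lemma measurableSet_goodSet (η τ L : ℝ) (j : ℕ) : MeasurableSet (goodSet (n := n) η τ L j) :=
  (measurableSet_goodSet_prod η L j).preimage measurable_prodMk_left

lemma mem_Icc_of_abs_sub_lt {l : ℝ} (hl : 0 < l) {N : ℕ} {z τ : ℝ} (hτ : τ ∈ Ico 0 (N * l))
    {m : ℤ} (hm : |z - τ - m * l| < l) : m ∈ Finset.Icc (⌊z / l⌋ - N) (⌊z / l⌋ + 1) := by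
  obtain ⟨lower, upper⟩ := abs_lt.1 hm
  have floor_le : ⌊z / l⌋ * l ≤ z := (le_div_iff₀ hl).1 (Int.floor_le _)
  have lt_floor : z < (⌊z / l⌋ + 1) * l := (div_lt_iff₀ hl).1 (Int.lt_floor_add_one _)
  have lt_m : (⌊z / l⌋ : ℝ) - N - 1 < m := by
    refine lt_of_mul_lt_mul_right ?_ hl.le
    linarith [hτ.2]
  have m_lt : (m : ℝ) < ⌊z / l⌋ + 2 := by
    refine lt_of_mul_lt_mul_right ?_ hl.le
    linarith [hτ.1]
  have lt_m' : ⌊z / l⌋ - N - 1 < m := by exact_mod_cast lt_m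
  have m_lt' : m < ⌊z / l⌋ + 2 := by exact_mod_cast m_lt
  exact Finset.mem_Icc.2 ⟨by omega, by omega⟩

lemma volume_near_grid_le {l : ℝ} (hl : 0 < l) {N : ℕ} (hN : 1 ≤ N) (z : ℝ) (hη0 : 0 ≤ η)
    (hη1 : η ≤ 1) :
    volume {τ : ℝ | τ ∈ Ico 0 (N * l) ∧ ∃ m : ℤ, |z - τ - m * l| < η * l}
      ≤ ENNReal.ofReal (6 * η * (N * l)) := by
  set S := Finset.Icc (⌊z / l⌋ - N) (⌊z / l⌋ + 1) with hS
  have covered : {τ : ℝ | τ ∈ Ico 0 (N * l) ∧ ∃ m : ℤ, |z - τ - m * l| < η * l}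
      ⊆ ⋃ m ∈ S, Metric.ball (z - m * l) (η * l) := by
    rintro τ ⟨hτ, m, hm⟩
    refine mem_iUnion₂.2
      ⟨m, mem_Icc_of_abs_sub_lt hl hτ (hm.trans_le (mul_le_of_le_one_left hl.le hη1)), ?_⟩
    rwa [Metric.mem_ball, dist_comm, Real.dist_eq, sub_right_comm]
  have card_le : (S.card : ℝ) ≤ 3 * N := by
    have card_le_nat : S.card ≤ 3 * N := by
      rw [hS, Int.card_Icc]
      omega
    exact_mod_cast card_le_nat
  calc _ ≤ ∑ m ∈ S, volume (Metric.ball (z - m * l) (η * l)) :=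
        (measure_mono covered).trans (measure_biUnion_finset_le _ _)
    _ = ENNReal.ofReal (S.card * (2 * (η * l))) := by
        simp only [Real.volume_ball, Finset.sum_const, nsmul_eq_mul]
        rw [ENNReal.ofReal_mul (p := (S.card : ℝ)) (Nat.cast_nonneg _), ENNReal.ofReal_natCast]
    _ ≤ ENNReal.ofReal (3 * N * (2 * (η * l))) := by gcongr
    _ = _ := by ring_nf

lemma sum_three_quarters_pow_le (j : ℕ) :
    ∑ k ∈ Finset.range (j + 1), (3 / 4 : ℝ) ^ (j - k) ≤ 4 := by
  have reflect := Finset.sum_range_reflect (fun m => (3 / 4 : ℝ) ^ m) (j + 1)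
  simp only [add_tsub_cancel_right] at reflect
  rw [reflect, geom_sum_eq (by norm_num), div_le_iff_of_neg (by norm_num)]
  linarith [show (0 : ℝ) < (3 / 4) ^ (j + 1) by positivity]

lemma volume_not_mem_goodSet_le (hL : 0 < L) (hη0 : 0 ≤ η) (hη : 48 * n * η ≤ 1) (j : ℕ)
    (x : Fin n → ℝ) :
    volume (Ico 0 L \ {τ : ℝ | x ∈ goodSet η τ L j}) ≤ ENNReal.ofReal (L / 2) := by
  have η_le_one (i : Fin n) : η ≤ 1 := by
    have one_le_n : (1 : ℝ) ≤ n := by exact_mod_cast i.pos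
    nlinarith
  have covered : Ico 0 L \ {τ : ℝ | x ∈ goodSet η τ L j}
      ⊆ ⋃ k ∈ Finset.range (j + 1), ⋃ i ∈ (Finset.univ : Finset (Fin n)),
        {τ : ℝ | τ ∈ Ico 0 L ∧ ∃ m : ℤ,
          |x i - τ - m * (L / 2 ^ k)| < (η * (3 / 4) ^ (j - k)) * (L / 2 ^ k)} := by
    rintro τ ⟨hτ, not_good⟩
    simp only [goodSet, mem_ofPred_eq, not_forall, not_le] at not_good
    obtain ⟨k, hk, i, m, hm⟩ := not_good
    simp only [mem_iUnion]
    exact ⟨k, Finset.mem_range.2 (by omega), i, Finset.mem_univ i, hτ, m, hm⟩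
  have near_le (k : ℕ) (i : Fin n) : volume {τ : ℝ | τ ∈ Ico 0 L ∧ ∃ m : ℤ,
      |x i - τ - m * (L / 2 ^ k)| < (η * (3 / 4) ^ (j - k)) * (L / 2 ^ k)}
        ≤ ENNReal.ofReal (6 * (η * (3 / 4) ^ (j - k)) * L) := by
    have le_one : η * (3 / 4) ^ (j - k) ≤ 1 :=
      mul_le_one₀ (η_le_one i) (by positivity) (pow_le_one₀ (by norm_num) (by norm_num))
    simpa only [Nat.cast_pow, Nat.cast_ofNat, mul_div_cancel₀ L (pow_ne_zero k two_ne_zero)] using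
      volume_near_grid_le (N := 2 ^ k) (l := L / 2 ^ k) (by positivity) Nat.one_le_two_pow (x i)
        (by positivity) le_one
  calc _ ≤ ∑ k ∈ Finset.range (j + 1), ∑ _i : Fin n,
        ENNReal.ofReal (6 * (η * (3 / 4) ^ (j - k)) * L) :=
        (measure_mono covered).trans <| (measure_biUnion_finset_le _ _).trans <|
          Finset.sum_le_sum fun k _ => (measure_biUnion_finset_le _ _).trans <|
            Finset.sum_le_sum fun i _ => near_le k i
    _ = ENNReal.ofReal (6 * n * η * L * ∑ k ∈ Finset.range (j + 1), (3 / 4 : ℝ) ^ (j - k)) := by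
        simp only [Finset.sum_const, Finset.card_univ, Fintype.card_fin, nsmul_eq_mul]
        rw [Finset.mul_sum, ENNReal.ofReal_sum_of_nonneg fun k _ => by positivity]
        refine Finset.sum_congr rfl fun k _ => ?_
        rw [← ENNReal.ofReal_natCast, ← ENNReal.ofReal_mul (by positivity)]
        ring_nf
    _ ≤ ENNReal.ofReal (6 * n * η * L * 4) := by
        gcongr
        exact sum_three_quarters_pow_le j
    _ ≤ _ := ENNReal.ofReal_le_ofReal (by nlinarith)

lemma le_volume_goodSet (hL : 0 < L) (hη0 : 0 ≤ η) (hη : 48 * n * η ≤ 1) (j : ℕ)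
    (x : Fin n → ℝ) :
    ENNReal.ofReal (L / 2) ≤ volume.restrict (Ico 0 L) {τ : ℝ | x ∈ goodSet η τ L j} := by
  have measurableSet_shifts : MeasurableSet {τ : ℝ | x ∈ goodSet η τ L j} :=
    (measurableSet_goodSet_prod η L j).preimage measurable_prodMk_right
  have split := measure_inter_add_sdiff (μ := (volume : Measure ℝ)) (Ico 0 L) measurableSet_shifts
  rw [Real.volume_Ico, sub_zero, ← add_halves L,
    ENNReal.ofReal_add (by positivity) (by positivity), add_halves] at split
  rw [Measure.restrict_apply measurableSet_shifts, inter_comm]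
  refine (ENNReal.add_le_add_iff_right (a := ENNReal.ofReal (L / 2)) ENNReal.ofReal_ne_top).1 ?_
  rw [← split]
  gcongr
  exact volume_not_mem_goodSet_le hL hη0 hη j x

theorem tsum_lintegral_le_of_goodSet {μ : Measure (Fin n → ℝ)} [SFinite μ] (hL : 0 < L)
    (hη0 : 0 ≤ η) (hη : 48 * n * η ≤ 1) {F : ℝ × (Fin n → ℝ) → ℝ≥0∞} (hF : Measurable F)
    (I : ℕ → Set ℝ) {M : ℝ≥0∞}
    (hM : ∀ τ, ∑' j, ∫⁻ t in I j, ∫⁻ x in goodSet η τ L j, F (t, x) ∂μ ≤ M) :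
    ∑' j, ∫⁻ t in I j, ∫⁻ x, F (t, x) ∂μ ≤ 2 * M := by
  set ν : ℕ → Measure (ℝ × (Fin n → ℝ)) := fun j => (volume.restrict (I j)).prod μ with hν
  set G : ℕ → Set (ℝ × ℝ × (Fin n → ℝ)) := fun j => {p | p.2.2 ∈ goodSet η p.1 L j} with hG
  have measurableSet_G (j : ℕ) : MeasurableSet (G j) :=
    (measurableSet_goodSet_prod η L j).preimage
      (f := fun p : ℝ × ℝ × (Fin n → ℝ) => (p.1, p.2.2)) (by fun_prop)
  have lintegral_good (j : ℕ) (τ : ℝ) :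
      ∫⁻ p in Prod.mk τ ⁻¹' G j, F p ∂ν j = ∫⁻ t in I j, ∫⁻ x in goodSet η τ L j, F (t, x) ∂μ := by
    have section_eq : Prod.mk τ ⁻¹' G j = univ ×ˢ goodSet η τ L j := by
      ext p
      simp only [hG, mem_preimage, mem_ofPred_eq, mem_prod, mem_univ, true_and]
    rw [section_eq, hν, ← Measure.prod_restrict, Measure.restrict_univ,
      lintegral_prod _ hF.aemeasurable]
  have half_le (j : ℕ) : ENNReal.ofReal (L / 2) * ∫⁻ t in I j, ∫⁻ x, F (t, x) ∂μ
      ≤ ∫⁻ τ in Ico 0 L, ∫⁻ p in Prod.mk τ ⁻¹' G j, F p ∂ν j := by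
    rw [← lintegral_prod _ hF.aemeasurable]
    exact mul_lintegral_le_lintegral_setLIntegral_section (measurableSet_G j) hF
      fun p => le_volume_goodSet hL hη0 hη j p.2
  have half_ne_zero : ENNReal.ofReal (L / 2) ≠ 0 := (ENNReal.ofReal_pos.2 (by positivity)).ne'
  refine (ENNReal.mul_le_mul_iff_right half_ne_zero ENNReal.ofReal_ne_top).1 ?_
  rw [← ENNReal.tsum_mul_left]
  calc _ ≤ ∑' j, ∫⁻ τ in Ico 0 L, ∫⁻ p in Prod.mk τ ⁻¹' G j, F p ∂ν j :=
        ENNReal.tsum_le_tsum half_le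
    _ = ∫⁻ τ in Ico 0 L, ∑' j, ∫⁻ p in Prod.mk τ ⁻¹' G j, F p ∂ν j :=
        (lintegral_tsum fun j =>
          (measurable_setLIntegral_section (measurableSet_G j) hF).aemeasurable).symm
    _ ≤ ∫⁻ _ in Ico 0 L, M := by
        gcongr
        simpa only [lintegral_good] using hM _
    _ = M * ENNReal.ofReal (L / 2 * 2) := by
        rw [setLIntegral_const, Real.volume_Ico, sub_zero, div_mul_cancel₀ L two_ne_zero]
    _ = _ := by
        rw [ENNReal.ofReal_mul (by positivity), ENNReal.ofReal_ofNat]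
        ring

end Good

section LevelEstimates

variable {n : ℕ} {μ : Measure (Fin n → ℝ)} {D A : ℝ≥0} {α τ L η t : ℝ} {j k m : ℕ}
  {s : ℝ → (Fin n → ℝ) → (Fin n → ℝ) → ℂ} {h : (Fin n → ℝ) → ℂ} {x : Fin n → ℝ}

lemma one_le_two_rpow_mul_levelRate_pow (hα : 0 < α) (hm : m < 2) :
    1 ≤ 2 ^ α * levelRate α ^ m := by
  have two_rpow_mul : (2 : ℝ≥0) ^ α * (1 / 2 : ℝ≥0) ^ α = 1 := by
    rw [← NNReal.mul_rpow, mul_one_div_cancel two_ne_zero, NNReal.one_rpow]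
  calc (1 : ℝ≥0) ≤ 2 ^ α * levelRate α ^ 1 := by
        rw [← two_rpow_mul, pow_one]
        gcongr
        exact half_rpow_le_levelRate hα
    _ ≤ _ := mul_le_mul_right
        (pow_le_pow_of_le_one zero_le (levelRate_lt_one hα).le (by omega)) _

lemma ofReal_rpow_div_le (hα : 0 < α) (hL : 0 < L) (ht : L / 2 ^ (j + 1) ≤ t) :
    ENNReal.ofReal ((L / 2 ^ (j + m) / t) ^ α) ≤ (2 ^ α * levelRate α ^ m : ℝ≥0) := by
  have ht0 : 0 < t := lt_of_lt_of_le (by positivity) ht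
  have ratio_le : L / 2 ^ (j + m) / t ≤ 2 * (1 / 2) ^ m := by
    rw [div_le_iff₀ ht0]
    calc L / 2 ^ (j + m) = 2 * (1 / 2) ^ m * (L / 2 ^ (j + 1)) := by
          rw [pow_add, pow_succ, one_div, inv_pow]
          field_simp
      _ ≤ _ := by gcongr
  calc ENNReal.ofReal ((L / 2 ^ (j + m) / t) ^ α)
      ≤ ENNReal.ofReal ((2 * (1 / 2) ^ m) ^ α) := by gcongr
    _ = (2 ^ α * ((1 / 2 : ℝ≥0) ^ α) ^ m : ℝ≥0) := by
        rw [ENNReal.ofReal]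
        congr 1
        rw [← NNReal.coe_inj, Real.coe_toNNReal _ (by positivity)]
        push_cast
        rw [Real.mul_rpow (by norm_num) (by positivity), Real.rpow_pow_comm (by norm_num)]
    _ ≤ _ := by
        gcongr
        exact half_rpow_le_levelRate hα

lemma kernelRate_pow_le_of_lt (hα : 0 < α) (hL : 0 < L) (hη : 0 < η) (hkj : k ≤ j)
    (ht : t ≤ L / 2 ^ j) (hm : η * (3 / 4) ^ (j - k) * (L / 2 ^ k) < 2 ^ m * t) :
    kernelRate α ^ m ≤ η⁻¹.toNNReal ^ (α / 2) * levelRate α ^ (j - k) := by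
  obtain ⟨i, rfl⟩ := Nat.exists_eq_add_of_le hkj
  rw [add_tsub_cancel_left] at hm ⊢
  have lt_two_pow : η * ((3 / 4) ^ i * 2 ^ i) < 2 ^ m := by
    have side_eq : 2 ^ m * (L / 2 ^ (k + i)) = 2 ^ m / 2 ^ i * (L / 2 ^ k) := by
      rw [pow_add]
      field_simp
    have lt_div : η * (3 / 4) ^ i < 2 ^ m / 2 ^ i := by
      refine lt_of_mul_lt_mul_right ?_ (by positivity : 0 ≤ L / 2 ^ k)
      rw [← side_eq]
      exact hm.trans_le (by gcongr)
    rwa [lt_div_iff₀ (by positivity), mul_assoc] at lt_div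
  have base_le : (1 / 2 : ℝ≥0) ^ m ≤ η⁻¹.toNNReal * (2 / 3) ^ i := by
    have pow_eq : (3 / 4 : ℝ) ^ i * 2 ^ i = ((2 / 3) ^ i)⁻¹ := by
      rw [← mul_pow, ← inv_pow]
      norm_num
    rw [pow_eq, ← div_eq_mul_inv, div_lt_iff₀ (by positivity)] at lt_two_pow
    rw [← NNReal.coe_le_coe]
    push_cast
    rw [Real.coe_toNNReal _ (by positivity), one_div, inv_pow, inv_mul_eq_div, inv_eq_one_div,
      div_le_div_iff₀ (by positivity) hη]
    linarith
  calc kernelRate α ^ m = ((1 / 2 : ℝ≥0) ^ m) ^ (α / 2) := by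
        rw [kernelRate, ← NNReal.rpow_mul_natCast, mul_comm, NNReal.rpow_natCast_mul]
    _ ≤ (η⁻¹.toNNReal * (2 / 3) ^ i) ^ (α / 2) := by gcongr
    _ = _ := by
        rw [NNReal.mul_rpow, levelRate, ← NNReal.rpow_natCast_mul, mul_comm (i : ℝ),
          NNReal.rpow_mul_natCast]

namespace HasTailBound

lemma enorm_theta_le_of_level (hs : HasTailBound μ D (kernelRate α) A α s) (hα : 0 < α)
    [IsLocallyFiniteMeasure μ] (hμ : μ ≠ 0) (hL : 0 < L)
    (ht : t ∈ Ioc (L / 2 ^ (j + 1)) (L / 2 ^ j)) (x : Fin n → ℝ) (hh : Measurable h)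
    (hh2 : MemLp h 2 μ) (hmean : ∀ i, ∫ y in gridIdx τ L (j + m) ⁻¹' {i}, h y ∂μ = 0) :
    ‖theta μ s h t x‖ₑ ≤ (A * (2 ^ α * levelRate α ^ m) : ℝ≥0)
      * tailOp μ D (kernelRate α) t (fun y => ‖h y‖ₑ) x := by
  have ht0 : 0 < t := lt_of_le_of_lt (by positivity) ht.1
  have hq := kernelRate_lt_one hα
  rw [ENNReal.coe_mul, mul_assoc]
  rcases lt_or_ge m 2 with hm | hm
  · refine (hs.enorm_theta_le hq ht0 x hh).trans ?_
    gcongr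
    exact le_mul_of_one_le_left' (by exact_mod_cast one_le_two_rpow_mul_levelRate_pow hα hm)
  · have side_lt : L / 2 ^ (j + m) < t / 2 := by
      refine lt_of_le_of_lt ?_ (div_lt_div_of_pos_right ht.1 two_pos)
      rw [div_div, ← pow_succ]
      exact div_le_div_of_nonneg_left hL.le (by positivity)
        (pow_le_pow_right₀ one_le_two (by omega))
    have hπ : IsCellPartition μ (gridIdx τ L (j + m)) :=
      (isRefiningPartition_gridIdx τ hL).level _
    refine (hs.enorm_theta_le_of_mean_zero hq hα ht0 x hh
      (hs.integrable_of_memLp hq hμ ht0 x hh hh2) hπ.measurable (hπ.integrableOn_cell hh2) hmean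
      side_lt fun _ _ => dist_le_of_gridIdx_eq hL).trans ?_
    gcongr
    exact ofReal_rpow_div_le hα hL ht.1.le

lemma lintegral_enorm_mul_enorm_sub_le (hs : HasTailBound μ D (kernelRate α) A α s) (hα : 0 < α)
    (hL : 0 < L) (hη : 0 < η) (hkj : k ≤ j) (ht : t ∈ Ioc (L / 2 ^ (j + 1)) (L / 2 ^ j))
    (hx : x ∈ goodSet η τ L j) (hh : Measurable h) (hconst : h.FactorsThrough (gridIdx τ L k)) :
    ∫⁻ y, ‖s t x y‖ₑ * ‖h y - h x‖ₑ ∂μ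
      ≤ (A * (η⁻¹.toNNReal ^ (α / 2) * levelRate α ^ (j - k)) : ℝ≥0)
        * (tailOp μ D (kernelRate α) t (fun y => ‖h y‖ₑ) x
          + ((1 - kernelRate α)⁻¹ : ℝ≥0) * ‖h x‖ₑ) := by
  set E : Set (Fin n → ℝ) := (gridIdx τ L k ⁻¹' {gridIdx τ L k x})ᶜ
  have measurableSet_E : MeasurableSet E :=
    (measurable_gridIdx τ L k (measurableSet_singleton _)).compl
  have eq_of_notMem (y) (hy : y ∉ E) : h y = h x :=
    hconst (notMem_compl_iff.1 hy)
  set κ : ℝ≥0 := η⁻¹.toNNReal ^ (α / 2) * levelRate α ^ (j - k)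
  calc ∫⁻ y, ‖s t x y‖ₑ * ‖h y - h x‖ₑ ∂μ
      = ∫⁻ y in E, ‖s t x y‖ₑ * ‖h y - h x‖ₑ ∂μ := by
        refine (setLIntegral_eq_of_support_subset fun y hy => ?_).symm
        by_contra notMem
        exact hy (by simp only [eq_of_notMem y notMem, sub_self, enorm_zero, mul_zero])
    _ ≤ ∫⁻ y in E, ‖s t x y‖ₑ * (‖h y‖ₑ + ‖h x‖ₑ * 1) ∂μ := by
        rw [mul_one]
        gcongr with y
        exact enorm_sub_le
    _ ≤ A * κ * tailOp μ D (kernelRate α) t (fun y => ‖h y‖ₑ + ‖h x‖ₑ * 1) x :=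
        hs.setLIntegral_enorm_mul_le (lt_of_le_of_lt (by positivity) ht.1) measurableSet_E
          (fun y hy => le_dist_of_mem_goodSet hL hkj hx hy)
          (fun i hi => kernelRate_pow_le_of_lt hα hL hη hkj ht.2 hi) (hh.enorm.add_const _)
    _ ≤ _ := by
        rw [ENNReal.coe_mul A κ, tailOp_add hh.enorm, enorm_eq_nnnorm (h x), tailOp_const_mul,
          mul_comm (‖h x‖₊ : ℝ≥0∞)]
        gcongr
        exact tailOp_one_le (kernelRate_lt_one hα) t x

end HasTailBound

end LevelEstimates

section Pointwise

variable {n : ℕ} {μ : Measure (Fin n → ℝ)} {D A B c : ℝ≥0} {α τ L η t : ℝ} {j : ℕ}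
  {s : ℝ → (Fin n → ℝ) → (Fin n → ℝ) → ℂ} {b f : (Fin n → ℝ) → ℂ} {x : Fin n → ℝ}

lemma theta_sub_eq_sum {a : ℕ → (Fin n → ℝ) → ℂ} (hf : Integrable (fun y => s t x y * f y) μ)
    (hb : Integrable (fun y => s t x y * b y) μ)
    (ha : ∀ k, Integrable (fun y => s t x y * (b y * a k y)) μ) (j N : ℕ) :
    theta μ s f t x - a j x * theta μ s b t x
      = theta μ s (fun y => f y - b y * a (j + N) y) t x
        + ∑ m ∈ Finset.range N, theta μ s (fun y => b y * (a (j + m + 1) y - a (j + m) y)) t x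
        + ∫ y, s t x y * (b y * (a j y - a j x)) ∂μ := by
  set I : ℕ → ℂ := fun i => ∫ y, s t x y * (b y * a (j + i) y) ∂μ with hI
  have remainder : theta μ s (fun y => f y - b y * a (j + N) y) t x = theta μ s f t x - I N := by
    simp only [theta, mul_sub, hI]
    exact integral_sub hf (ha _)
  have fine (m : ℕ) :
      theta μ s (fun y => b y * (a (j + m + 1) y - a (j + m) y)) t x = I (m + 1) - I m := by
    simp only [theta, mul_sub, hI]
    exact integral_sub (ha _) (ha _)
  have coarse : ∫ y, s t x y * (b y * (a j y - a j x)) ∂μ = I 0 - a j x * theta μ s b t x := by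
    simp only [mul_sub, theta, hI, add_zero]
    rw [integral_sub (ha j) (by simpa only [← mul_assoc] using hb.mul_const (a j x)),
      ← integral_const_mul]
    simp only [mul_comm (b _), mul_left_comm (s _ _ _)]
  rw [remainder, coarse, Finset.sum_congr rfl fun m _ => fine m, Finset.sum_range_sub]
  ring

/-- The contribution of the level `k` of a decomposition `d` to the size of `θ_t` at `x`. -/
noncomputable def levelTerm (μ : Measure (Fin n → ℝ)) (D : ℝ≥0) (α t : ℝ)
    (d : ℕ → (Fin n → ℝ) → ℂ) (x : Fin n → ℝ) (k : ℕ) : ℝ≥0∞ :=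
  tailOp μ D (kernelRate α) t (fun y => ‖d k y‖ₑ) x + ‖d k x‖ₑ

/-- The constant, up to the bounds of the kernel and of `b`, in the comparison of `θ_t f` with
`⟨f⟩ / ⟨b⟩ * θ_t b`: one summand for the levels finer than `t`, one for the coarser ones. -/
noncomputable def levelConst (α η : ℝ) : ℝ≥0 :=
  2 ^ α * (levelRate α)⁻¹ + η⁻¹.toNNReal ^ (α / 2) * (1 - kernelRate α)⁻¹

lemma le_of_forall_le_pow_mul_add {u K M : ℝ≥0∞} {r : ℝ≥0} (hr : r < 1) (hM : M ≠ ∞)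
    (h : ∀ N : ℕ, u ≤ r ^ N * M + K) : u ≤ K := by
  have tendsto_pow : Filter.Tendsto (fun N : ℕ => (r : ℝ≥0∞) ^ N * M + K) Filter.atTop
      (nhds (0 * M + K)) :=
    (ENNReal.Tendsto.mul_const (ENNReal.tendsto_pow_atTop_nhds_zero_of_lt_one
      (by exact_mod_cast hr)) (Or.inr hM)).add tendsto_const_nhds
  rw [zero_mul, zero_add] at tendsto_pow
  exact ge_of_tendsto' tendsto_pow h

namespace HasTailBound

lemma lintegral_enorm_mul_adaptedDiff_sub_le (hs : HasTailBound μ D (kernelRate α) A α s)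
    (hα : 0 < α) (hL : 0 < L) (hη : 0 < η) {k : ℕ} (hkj : k ≤ j)
    (ht : t ∈ Ioc (L / 2 ^ (j + 1)) (L / 2 ^ j)) (hx : x ∈ goodSet η τ L j) :
    ∫⁻ y, ‖s t x y‖ₑ * ‖adaptedDiff μ (gridIdx τ L) b f k y
        - adaptedDiff μ (gridIdx τ L) b f k x‖ₑ ∂μ
      ≤ (A * (η⁻¹.toNNReal ^ (α / 2) * (1 - kernelRate α)⁻¹) : ℝ≥0)
        * ((levelRate α : ℝ≥0∞) ^ j.dist k
          * levelTerm μ D α t (adaptedDiff μ (gridIdx τ L) b f) x k) := by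
  have one_le : (1 : ℝ≥0) ≤ (1 - kernelRate α)⁻¹ :=
    (one_le_inv₀ (tsub_pos_of_lt (kernelRate_lt_one hα))).2 tsub_le_self
  refine (hs.lintegral_enorm_mul_enorm_sub_le hα hL hη hkj ht hx
    (measurable_adaptedDiff (measurable_gridIdx τ L) b f k)
    (factorsThrough_adaptedDiff (factorsThrough_gridIdx_succ τ L) b f k)).trans ?_
  rw [Nat.dist_eq_sub_of_le_right hkj]
  set d := adaptedDiff μ (gridIdx τ L) b f k
  calc _ ≤ ((A * (η⁻¹.toNNReal ^ (α / 2) * levelRate α ^ (j - k)) : ℝ≥0) : ℝ≥0∞)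
        * (((1 - kernelRate α)⁻¹ : ℝ≥0) * (tailOp μ D (kernelRate α) t (fun y => ‖d y‖ₑ) x
          + ‖d x‖ₑ)) := by
        rw [mul_add (ENNReal.ofNNReal (1 - kernelRate α)⁻¹)]
        gcongr
        exact le_mul_of_one_le_left' (by exact_mod_cast one_le)
    _ = _ := by
        rw [levelTerm]
        push_cast
        ring

lemma enorm_coarse_le (hs : HasTailBound μ D (kernelRate α) A α s) (hα : 0 < α) (hL : 0 < L)
    (hη : 0 < η) (hB : ∀ x, ‖b x‖ₑ ≤ B) (ht : t ∈ Ioc (L / 2 ^ (j + 1)) (L / 2 ^ j))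
    (hx : x ∈ goodSet η τ L j) :
    ‖∫ y, s t x y * (b y * (adaptedCoeff μ (gridIdx τ L j) b f y
        - adaptedCoeff μ (gridIdx τ L j) b f x)) ∂μ‖ₑ
      ≤ (A * B * (η⁻¹.toNNReal ^ (α / 2) * (1 - kernelRate α)⁻¹) : ℝ≥0)
        * ∑ k ∈ Finset.range (j + 1), (levelRate α : ℝ≥0∞) ^ j.dist k
          * levelTerm μ D α t (adaptedDiff μ (gridIdx τ L) b f) x k := by
  set d := adaptedDiff μ (gridIdx τ L) b f
  have measurable_summand (k : ℕ) : Measurable fun y => ‖s t x y‖ₑ * ‖d k y - d k x‖ₑ :=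
    (hs.measurable_right t x).enorm.mul
      ((measurable_adaptedDiff (measurable_gridIdx τ L) b f k).sub_const _).enorm
  calc _ ≤ ∫⁻ y, B * ∑ k ∈ Finset.range (j + 1), ‖s t x y‖ₑ * ‖d k y - d k x‖ₑ ∂μ := by
        refine (enorm_integral_le_lintegral_enorm _).trans (lintegral_mono fun y => ?_)
        rw [← sum_adaptedDiff, ← sum_adaptedDiff, ← Finset.sum_sub_distrib, enorm_mul, enorm_mul,
          ← Finset.mul_sum, mul_left_comm]
        gcongr
        · exact hB y
        · exact enorm_sum_le _ _
    _ = B * ∑ k ∈ Finset.range (j + 1), ∫⁻ y, ‖s t x y‖ₑ * ‖d k y - d k x‖ₑ ∂μ := by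
        rw [lintegral_const_mul' _ _ ENNReal.coe_ne_top,
          lintegral_finsetSum _ fun k _ => measurable_summand k]
    _ ≤ B * ∑ k ∈ Finset.range (j + 1),
          (A * (η⁻¹.toNNReal ^ (α / 2) * (1 - kernelRate α)⁻¹) : ℝ≥0)
            * ((levelRate α : ℝ≥0∞) ^ j.dist k * levelTerm μ D α t d x k) := by
        gcongr with k hk
        exact hs.lintegral_enorm_mul_adaptedDiff_sub_le hα hL hη
          (Nat.lt_succ_iff.1 (Finset.mem_range.1 hk)) ht hx
    _ = _ := by
        rw [← Finset.mul_sum, ← mul_assoc, ← ENNReal.coe_mul, mul_left_comm, mul_assoc]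

lemma enorm_fine_le (hs : HasTailBound μ D (kernelRate α) A α s) (hα : 0 < α)
    [IsLocallyFiniteMeasure μ] (hμ : μ ≠ 0) (hL : 0 < L) (hb : Measurable b)
    (hB : ∀ x, ‖b x‖ₑ ≤ B) (hacc : ∀ k, IsAccretiveOn μ (gridIdx τ L k) b c) (hc : 0 < c)
    (hf2 : MemLp f 2 μ) (ht : t ∈ Ioc (L / 2 ^ (j + 1)) (L / 2 ^ j)) (x : Fin n → ℝ) (m : ℕ) :
    ‖theta μ s (fun y => b y * adaptedDiff μ (gridIdx τ L) b f (j + m + 1) y) t x‖ₑ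
      ≤ (A * B * (2 ^ α * (levelRate α)⁻¹) : ℝ≥0)
        * ((levelRate α : ℝ≥0∞) ^ j.dist (j + m + 1)
          * levelTerm μ D α t (adaptedDiff μ (gridIdx τ L) b f) x (j + m + 1)) := by
  have hπ : IsRefiningPartition μ (gridIdx τ L) := isRefiningPartition_gridIdx τ hL
  have dist_eq : j.dist (j + m + 1) = m + 1 := by
    rw [Nat.dist_eq_sub_of_le (by omega)]
    omega
  have const_eq : A * (2 ^ α * levelRate α ^ m) * B
      = A * B * (2 ^ α * (levelRate α)⁻¹) * levelRate α ^ (m + 1) := by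
    have := (levelRate_pos α).ne'
    field_simp
    ring
  rw [dist_eq]
  set d := adaptedDiff μ (gridIdx τ L) b f (j + m + 1)
  calc ‖theta μ s (fun y => b y * d y) t x‖ₑ
      ≤ (A * (2 ^ α * levelRate α ^ m) : ℝ≥0)
        * tailOp μ D (kernelRate α) t (fun y => ‖b y * d y‖ₑ) x :=
        hs.enorm_theta_le_of_level hα hμ hL ht x
          (hb.mul (measurable_adaptedDiff (measurable_gridIdx τ L) b f _))
          (hπ.memLp_mul_adaptedDiff_succ hb hB hacc hc hf2 _)
          (hπ.setIntegral_cell_mul_adaptedDiff_succ hb hB hacc hc hf2 _)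
    _ ≤ (A * (2 ^ α * levelRate α ^ m) : ℝ≥0)
        * (B * levelTerm μ D α t (adaptedDiff μ (gridIdx τ L) b f) x (j + m + 1)) := by
        gcongr
        refine le_trans ?_ (mul_le_mul_right le_self_add _)
        rw [← tailOp_const_mul]
        refine tailOp_mono (fun y => ?_) x
        rw [enorm_mul]
        gcongr
        exact hB y
    _ = _ := by
        rw [← mul_assoc, ← ENNReal.coe_mul, const_eq, ENNReal.coe_mul, ENNReal.coe_pow, mul_assoc]

lemma exists_enorm_remainder_le (hs : HasTailBound μ D (kernelRate α) A α s) (hα : 0 < α)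
    [IsLocallyFiniteMeasure μ] (hμ : μ ≠ 0) (hL : 0 < L) (hb : Measurable b)
    (hB : ∀ x, ‖b x‖ₑ ≤ B) (hacc : ∀ k, IsAccretiveOn μ (gridIdx τ L k) b c) (hc : 0 < c)
    (hf : Measurable f) (hf2 : MemLp f 2 μ) (ht : t ∈ Ioc (L / 2 ^ (j + 1)) (L / 2 ^ j))
    (x : Fin n → ℝ) :
    ∃ M : ℝ≥0∞, M ≠ ∞ ∧ ∀ N,
      ‖theta μ s (fun y => f y - b y * adaptedCoeff μ (gridIdx τ L (j + N)) b f y) t x‖ₑ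
        ≤ (levelRate α : ℝ≥0∞) ^ N * M := by
  have ht0 : 0 < t := lt_of_le_of_lt (by positivity) ht.1
  have hπ (k : ℕ) : IsCellPartition μ (gridIdx τ L k) := (isRefiningPartition_gridIdx τ hL).level k
  set S := ∫⁻ y, ‖f y‖ₑ ^ 2 ∂μ
  have S_ne_top : S ≠ ∞ := ((memLp_two_iff_lintegral hf2.1).1 hf2).ne
  have majorant_ne_zero : dyadicMajorant μ D x t ≠ 0 := dyadicMajorant_ne_zero hμ x ht0
  refine ⟨(A * 2 ^ α : ℝ≥0) * (((1 - kernelRate α)⁻¹ : ℝ≥0)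
    * (1 + 2 * (S + B ^ 2 * ((c⁻¹ : ℝ≥0) ^ 2 * S)) / dyadicMajorant μ D x t)),
    by finiteness, fun N => ?_⟩
  have measurable_residual :
      Measurable fun y => f y - b y * adaptedCoeff μ (gridIdx τ L (j + N)) b f y :=
    hf.sub (hb.mul (measurable_adaptedCoeff (measurable_gridIdx τ L _) b f))
  refine (hs.enorm_theta_le_of_level hα hμ hL ht x measurable_residual
    (hf2.sub ((hacc _).memLp_mul_adaptedCoeff hc (hπ _) hb hB hf2))
    ((hacc _).setIntegral_cell_sub_mul_adaptedCoeff hc (hπ _) hb hB hf2)).trans ?_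
  calc _ ≤ ((A * (2 ^ α * levelRate α ^ N) : ℝ≥0) : ℝ≥0∞) * (((1 - kernelRate α)⁻¹ : ℝ≥0)
        * (1 + 2 * (S + B ^ 2 * ((c⁻¹ : ℝ≥0) ^ 2 * S)) / dyadicMajorant μ D x t)) := by
        gcongr
        refine (tailOp_le_one_add_lintegral_sq (kernelRate_lt_one hα) ht0
          measurable_residual.enorm.aemeasurable x).trans ?_
        gcongr
        exact (hacc _).lintegral_sub_mul_adaptedCoeff_sq_le hc (hπ _) hB hf2.1
    _ = _ := by
        push_cast
        ring

theorem enorm_theta_sub_le (hs : HasTailBound μ D (kernelRate α) A α s) (hα : 0 < α)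
    [IsLocallyFiniteMeasure μ] (hμ : μ ≠ 0) (hL : 0 < L) (hη : 0 < η) (hb : Measurable b)
    (hB : ∀ x, ‖b x‖ₑ ≤ B) (hacc : ∀ k, IsAccretiveOn μ (gridIdx τ L k) b c) (hc : 0 < c)
    (hf : Measurable f) (hf2 : MemLp f 2 μ) (ht : t ∈ Ioc (L / 2 ^ (j + 1)) (L / 2 ^ j))
    (hx : x ∈ goodSet η τ L j) :
    ‖theta μ s f t x - adaptedCoeff μ (gridIdx τ L j) b f x * theta μ s b t x‖ₑ
      ≤ (A * B * levelConst α η : ℝ≥0) * ∑' k, (levelRate α : ℝ≥0∞) ^ j.dist k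
          * levelTerm μ D α t (adaptedDiff μ (gridIdx τ L) b f) x k := by
  have ht0 : 0 < t := lt_of_le_of_lt (by positivity) ht.1
  have hq := kernelRate_lt_one hα
  have hπ (k : ℕ) : IsCellPartition μ (gridIdx τ L k) := (isRefiningPartition_gridIdx τ hL).level k
  obtain ⟨M, hM, remainder_le⟩ :=
    hs.exists_enorm_remainder_le hα hμ hL hb hB hacc hc hf hf2 ht x
  set g : ℕ → ℝ≥0∞ := fun k => (levelRate α : ℝ≥0∞) ^ j.dist k
    * levelTerm μ D α t (adaptedDiff μ (gridIdx τ L) b f) x k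
  refine le_of_forall_le_pow_mul_add (levelRate_lt_one hα) hM fun N => ?_
  rw [theta_sub_eq_sum (a := fun k => adaptedCoeff μ (gridIdx τ L k) b f)
    (hs.integrable_of_memLp hq hμ ht0 x hf hf2) (hs.integrable_of_bounded hq ht0 x hb hB)
    (fun k => hs.integrable_of_memLp hq hμ ht0 x
      (hb.mul (measurable_adaptedCoeff (measurable_gridIdx τ L k) b f))
      ((hacc k).memLp_mul_adaptedCoeff hc (hπ k) hb hB hf2)) j N]
  have fine_le : ‖∑ m ∈ Finset.range N,
      theta μ s (fun y => b y * adaptedDiff μ (gridIdx τ L) b f (j + m + 1) y) t x‖ₑ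
        ≤ (A * B * (2 ^ α * (levelRate α)⁻¹) : ℝ≥0) * ∑' k, g k :=
    calc _ ≤ ∑ m ∈ Finset.range N,
          ((A * B * (2 ^ α * (levelRate α)⁻¹) : ℝ≥0) : ℝ≥0∞) * g (j + m + 1) :=
          (enorm_sum_le _ _).trans
            (Finset.sum_le_sum fun m _ => hs.enorm_fine_le hα hμ hL hb hB hacc hc hf2 ht x m)
      _ ≤ _ := by
          rw [← Finset.mul_sum]
          gcongr
          exact (ENNReal.sum_le_tsum _).trans (ENNReal.tsum_comp_le_tsum_of_injective
            (fun _ _ h => by omega) g)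
  have coarse_le := (hs.enorm_coarse_le (f := f) hα hL hη hB ht hx).trans
    (mul_le_mul_right (ENNReal.sum_le_tsum (f := g) _) _)
  refine (enorm_add_le _ _).trans (le_trans
    (add_le_add ((enorm_add_le _ _).trans (add_le_add (remainder_le N) fine_le)) coarse_le) ?_)
  rw [levelConst, mul_add (A * B), ENNReal.coe_add, add_mul, add_assoc]

end HasTailBound

end Pointwise

section Whitney

lemma tsum_measure_inter_le_of_encard_le {X ι : Type*} [MeasurableSpace X] {μ : Measure X}
    {s : ι → Set X} {M : ℕ} (hs : ∀ i, MeasurableSet (s i))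
    (hM : ∀ x, {i | x ∈ s i}.encard ≤ M) (S : Set X) : ∑' i, μ (s i ∩ S) ≤ M * μ S :=
  calc ∑' i, μ (s i ∩ S) = ∑' i, μ.restrict (s i) S :=
        tsum_congr fun i => by rw [Measure.restrict_apply' (hs i), inter_comm]
    _ ≤ Measure.sum (fun i => μ.restrict (s i)) S := Measure.le_sum_apply _ _
    _ ≤ (M • μ.restrict (⋃ i, s i)) S := Measure.sum_restrict_le hs hM S
    _ ≤ M * μ S := by
        rw [Measure.smul_apply, nsmul_eq_mul]
        gcongr
        exact Measure.restrict_le_self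

lemma exists_mem_Ioc_div_two_pow {L t : ℝ} (ht : t ∈ Ioc 0 L) :
    ∃ j : ℕ, t ∈ Ioc (L / 2 ^ (j + 1)) (L / 2 ^ j) := by
  have hL : 0 < L := ht.1.trans_le ht.2
  obtain ⟨j, lower, upper⟩ := exists_nat_pow_near_of_lt_one (x := t / L) (y := 1 / 2)
    (div_pos ht.1 hL) ((div_le_one hL).2 ht.2) (by norm_num) (by norm_num)
  rw [lt_div_iff₀ hL, one_div, inv_pow, inv_mul_eq_div] at lower
  rw [div_le_iff₀ hL, one_div, inv_pow, inv_mul_eq_div] at upper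
  exact ⟨j, lower, upper⟩

variable {n : ℕ} {μ : Measure (Fin n → ℝ)} {G : ℝ × (Fin n → ℝ) → ℝ≥0∞} {C : ℝ≥0} {l p : ℝ}

lemma measurableSet_cube (a : Fin n → ℝ) (l : ℝ) : MeasurableSet (cube a l) := by
  have cube_eq : cube a l = Set.pi univ fun i => Ico (a i) (a i + l) := by
    ext x
    simp only [cube, mem_ofPred_eq, mem_pi, mem_univ, true_imp_iff]
  rw [cube_eq]
  exact MeasurableSet.univ_pi fun i => measurableSet_Ico

lemma update_notMem_cube (a : Fin n → ℝ) (l : ℝ) (x : Fin n → ℝ) (i : Fin n) :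
    Function.update x i (a i + l) ∈ (cube a l)ᶜ := fun h => by
  have := (h i).2
  rw [Function.update_self] at this
  exact lt_irrefl _ this

lemma infDist_compl_cube_le (hn : 1 ≤ n) {a x : Fin n → ℝ} (hx : x ∈ cube a l) :
    Metric.infDist x (cube a l)ᶜ ≤ l := by
  set i : Fin n := ⟨0, hn⟩
  obtain ⟨lower, upper⟩ := hx i
  refine (Metric.infDist_le_dist_of_mem (update_notMem_cube a l x i)).trans
    ((dist_pi_le_iff (by linarith)).2 fun k => ?_)
  rcases eq_or_ne k i with rfl | hk
  · rw [Function.update_self, Real.dist_eq, abs_le]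
    constructor <;> linarith
  · rw [Function.update_of_ne hk, dist_self]
    linarith

lemma dist_le_of_mem_triple (hp : 0 < p) {a x y : Fin n → ℝ} (hx : x ∈ cube a p)
    (hy : y ∈ cube (fun i => a i - p) (3 * p)) : dist x y ≤ 2 * p := by
  refine (dist_pi_le_iff (by positivity)).2 fun i => ?_
  have hxi := hx i
  have hyi := hy i
  rw [mem_Ico] at hxi hyi
  rw [Real.dist_eq, abs_le]
  constructor <;> linarith

lemma encard_setOf_mem_triple_le (hp : 0 < p) (y : Fin n → ℝ) :
    {m : Fin n → ℤ | y ∈ cube (fun j => m j * p - p) (3 * p)}.encard ≤ (3 ^ n : ℕ) := by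
  set T : Finset (Fin n → ℤ) :=
    Fintype.piFinset fun j => Finset.Icc (⌊y j / p⌋ - 1) (⌊y j / p⌋ + 1) with hT
  have subset_T : {m : Fin n → ℤ | y ∈ cube (fun j => m j * p - p) (3 * p)} ⊆ T := by
    refine fun m hm => Fintype.mem_piFinset.2 fun j => Finset.mem_Icc.2 ?_
    obtain ⟨lower, upper⟩ := hm j
    have le_floor : m j - 1 ≤ ⌊y j / p⌋ := by
      rw [Int.le_floor, le_div_iff₀ hp]
      push_cast
      linarith
    have floor_lt : ⌊y j / p⌋ < m j + 2 := by
      rw [Int.floor_lt, div_lt_iff₀ hp]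
      push_cast
      linarith
    omega
  have card_T : T.card = 3 ^ n := by
    rw [hT, Fintype.card_piFinset, Finset.prod_congr rfl fun j _ => show _ = 3 by
      rw [Int.card_Icc]
      omega, Finset.prod_const, Finset.card_univ, Fintype.card_fin]
  exact (encard_le_encard subset_T).trans_eq (by rw [encard_coe_eq_coe_finsetCard, card_T])

/-- The points whose distance to the complement of `Q` lies in `(u, v]`, a layer of the Whitney
decomposition of `Q`. -/
def boundaryLayer (Q : Set (Fin n → ℝ)) (u v : ℝ) : Set (Fin n → ℝ) :=
  {x | Metric.infDist x Qᶜ ∈ Ioc u v}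

lemma measurableSet_boundaryLayer (Q : Set (Fin n → ℝ)) (u v : ℝ) :
    MeasurableSet (boundaryLayer Q u v) :=
  (Metric.continuous_infDist_pt _).measurable measurableSet_Ioc

lemma boundaryLayer_subset (Q : Set (Fin n → ℝ)) {u : ℝ} (hu : 0 ≤ u) (v : ℝ) :
    boundaryLayer Q u v ⊆ Q := fun x hx => by
  by_contra h
  exact (hu.trans_lt hx.1).ne' (Metric.infDist_zero_of_mem h)

lemma encard_setOf_mem_boundaryLayer_le (Q : Set (Fin n → ℝ)) (hp : 0 < p) (x : Fin n → ℝ) :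
    {i : ℕ | x ∈ boundaryLayer Q (2 * (p / 2 ^ i)) (16 * (p / 2 ^ i))}.encard ≤ (3 : ℕ) := by
  set I := {i : ℕ | x ∈ boundaryLayer Q (2 * (p / 2 ^ i)) (16 * (p / 2 ^ i))}
  have lt_add_three {i j : ℕ} (hi : i ∈ I) (hj : j ∈ I) : j < i + 3 := by
    have lt : 2 * (p / 2 ^ i) < 16 * (p / 2 ^ j) := hi.1.trans_le hj.2
    by_contra! hij
    have le : p / 2 ^ j ≤ p / 2 ^ (i + 3) := by
      gcongr
      norm_num
    rw [pow_add, ← div_div] at le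
    linarith
  rcases I.eq_empty_or_nonempty with hI | hI
  · simp only [hI, encard_empty, zero_le]
  · have subset_Ico : I ⊆ Finset.Ico (sInf I) (sInf I + 3) := fun j hj =>
      Finset.mem_coe.2 (Finset.mem_Ico.2 ⟨Nat.sInf_le hj, lt_add_three (Nat.sInf_mem hI) hj⟩)
    refine (encard_le_encard subset_Ico).trans_eq ?_
    rw [encard_coe_eq_coe_finsetCard, Nat.card_Ico, Nat.add_sub_cancel_left]

lemma tsum_measure_boundaryLayer_le (Q : Set (Fin n → ℝ)) (hp : 0 < p) :
    ∑' i : ℕ, μ (boundaryLayer Q (2 * (p / 2 ^ i)) (16 * (p / 2 ^ i))) ≤ 3 * μ Q :=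
  calc _ = ∑' i : ℕ, μ (boundaryLayer Q (2 * (p / 2 ^ i)) (16 * (p / 2 ^ i)) ∩ Q) :=
        tsum_congr fun i => by rw [inter_eq_left.2 (boundaryLayer_subset Q (by positivity) _)]
    _ ≤ _ := tsum_measure_inter_le_of_encard_le (fun i => measurableSet_boundaryLayer Q _ _)
        (encard_setOf_mem_boundaryLayer_le Q hp) Q

lemma triple_subset_boundaryLayer (hp : 0 < p) {Q : Set (Fin n → ℝ)} {a x : Fin n → ℝ}
    (hx : x ∈ cube a p) (hxQ : x ∈ boundaryLayer Q (4 * p) (8 * p)) :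
    cube (fun i => a i - p) (3 * p) ⊆ boundaryLayer Q (2 * p) (16 * p) := by
  intro y hy
  have dist_le := dist_le_of_mem_triple hp hx hy
  have le_y : Metric.infDist x Qᶜ ≤ Metric.infDist y Qᶜ + dist x y :=
    Metric.infDist_le_infDist_add_dist
  have le_x : Metric.infDist y Qᶜ ≤ Metric.infDist x Qᶜ + dist y x :=
    Metric.infDist_le_infDist_add_dist
  rw [dist_comm] at le_x
  obtain ⟨lower, upper⟩ := hxQ
  exact ⟨by linarith, by linarith⟩

lemma lintegral_Ioo_infDist_le (hn : 1 ≤ n) {a x : Fin n → ℝ} (hx : x ∈ cube a l) :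
    ∫⁻ t in Ioo 0 (Metric.infDist x (cube a l)ᶜ / 8), G (t, x)
      ≤ ∑' i : ℕ, (boundaryLayer (cube a l) (4 * (l / 8 / 2 ^ i)) (8 * (l / 8 / 2 ^ i))).indicator
          (fun x => ∫⁻ t in Ioo 0 (l / 8 / 2 ^ i), G (t, x)) x := by
  rcases (Metric.infDist_nonneg (x := x) (s := (cube a l)ᶜ)).eq_or_lt with
    infDist_zero | infDist_pos
  · simp only [← infDist_zero, zero_div, Ioo_self, Measure.restrict_empty,
      lintegral_zero_measure, zero_le]
  obtain ⟨i, lower, upper⟩ :=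
    exists_mem_Ioc_div_two_pow ⟨infDist_pos, infDist_compl_cube_le hn hx⟩
  have l_eq : l / 2 ^ i = 8 * (l / 8 / 2 ^ i) := by ring
  rw [pow_succ, ← div_div] at lower
  refine le_trans ?_ (ENNReal.le_tsum i)
  have mem_layer :
      x ∈ boundaryLayer (cube a l) (4 * (l / 8 / 2 ^ i)) (8 * (l / 8 / 2 ^ i)) :=
    ⟨by linarith, by linarith⟩
  rw [indicator_of_mem mem_layer]
  exact lintegral_mono_set (Ioo_subset_Ioo_right (by linarith))

/-- The Carleson condition for a density `G` on the upper half space with respect to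
`μ` and Lebesgue measure, with the tripled cube on the right-hand side. -/
def IsCarlesonDensity (μ : Measure (Fin n → ℝ)) (C : ℝ≥0) (G : ℝ × (Fin n → ℝ) → ℝ≥0∞) : Prop :=
  ∀ (a : Fin n → ℝ) (l : ℝ), 0 < l →
    ∫⁻ t in Ioo 0 l, ∫⁻ x in cube a l, G (t, x) ∂μ ≤ C * μ (cube (fun i => a i - l) (3 * l))

namespace IsCarlesonDensity

lemma setLIntegral_cube_inter_boundaryLayer_le [SFinite μ] (hG : IsCarlesonDensity μ C G)
    (hGm : Measurable G) (Q : Set (Fin n → ℝ)) (a : Fin n → ℝ) (hp : 0 < p) :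
    ∫⁻ x in cube a p ∩ boundaryLayer Q (4 * p) (8 * p), (∫⁻ t in Ioo 0 p, G (t, x)) ∂μ
      ≤ C * μ (cube (fun i => a i - p) (3 * p) ∩ boundaryLayer Q (2 * p) (16 * p)) := by
  rcases (cube a p ∩ boundaryLayer Q (4 * p) (8 * p)).eq_empty_or_nonempty with h | ⟨x, hx⟩
  · simp only [h, Measure.restrict_empty, lintegral_zero_measure, zero_le]
  · rw [inter_eq_left.2 (triple_subset_boundaryLayer hp hx.1 hx.2)]
    calc _ ≤ ∫⁻ x in cube a p, (∫⁻ t in Ioo 0 p, G (t, x)) ∂μ :=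
          lintegral_mono_set inter_subset_left
      _ = ∫⁻ t in Ioo 0 p, ∫⁻ x in cube a p, G (t, x) ∂μ :=
          lintegral_lintegral_swap (f := fun x t => G (t, x))
            (hGm.comp measurable_swap).aemeasurable
      _ ≤ _ := hG a p hp

lemma setLIntegral_boundaryLayer_le [SFinite μ] (hG : IsCarlesonDensity μ C G)
    (hGm : Measurable G) (Q : Set (Fin n → ℝ)) (hp : 0 < p) :
    ∫⁻ x in boundaryLayer Q (4 * p) (8 * p), (∫⁻ t in Ioo 0 p, G (t, x)) ∂μ
      ≤ (C * 3 ^ n : ℝ≥0) * μ (boundaryLayer Q (2 * p) (16 * p)) := by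
  have cell_eq (m : Fin n → ℤ) : gridIdx 0 p 0 ⁻¹' {m} = cube (fun j => m j * p) p := by
    simpa only [pow_zero, div_one, zero_add] using gridIdx_preimage (τ := 0) (k := 0) hp m
  rw [lintegral_eq_tsum_cell _ (measurable_gridIdx 0 p 0)]
  calc _ ≤ ∑' m : Fin n → ℤ,
        C * μ (cube (fun j => m j * p - p) (3 * p) ∩ boundaryLayer Q (2 * p) (16 * p)) := by
        refine ENNReal.tsum_le_tsum fun m => ?_
        rw [cell_eq, Measure.restrict_restrict (measurableSet_cube _ _)]
        exact hG.setLIntegral_cube_inter_boundaryLayer_le hGm Q _ hp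
    _ ≤ C * ((3 ^ n : ℕ) * μ (boundaryLayer Q (2 * p) (16 * p))) := by
        rw [ENNReal.tsum_mul_left]
        gcongr
        exact tsum_measure_inter_le_of_encard_le (fun m => measurableSet_cube _ _)
          (encard_setOf_mem_triple_le hp) _
    _ = _ := by
        push_cast
        ring

/-- The triples of small Whitney cubes stay inside the cube and overlap boundedly. -/
theorem setLIntegral_cube_infDist_le [SFinite μ] (hG : IsCarlesonDensity μ C G)
    (hGm : Measurable G) (hn : 1 ≤ n) (a : Fin n → ℝ) (hl : 0 < l) :
    ∫⁻ x in cube a l, (∫⁻ t in Ioo 0 (Metric.infDist x (cube a l)ᶜ / 8), G (t, x)) ∂μ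
      ≤ (3 * 3 ^ n * C : ℝ≥0) * μ (cube a l) := by
  set Q := cube a l
  set p : ℕ → ℝ := fun i => l / 8 / 2 ^ i
  set layer : ℕ → Set (Fin n → ℝ) := fun i => boundaryLayer Q (4 * p i) (8 * p i)
  have measurable_section (i : ℕ) : Measurable fun x => ∫⁻ t in Ioo 0 (p i), G (t, x) :=
    hGm.lintegral_prod_left'
  have measurableSet_layer (i : ℕ) : MeasurableSet (layer i) := measurableSet_boundaryLayer Q _ _
  calc _ ≤ ∫⁻ x in Q, ∑' i, (layer i).indicator (fun x => ∫⁻ t in Ioo 0 (p i), G (t, x)) x ∂μ :=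
        setLIntegral_mono' (measurableSet_cube _ _) fun x hx => lintegral_Ioo_infDist_le hn hx
    _ ≤ ∫⁻ x, ∑' i, (layer i).indicator (fun x => ∫⁻ t in Ioo 0 (p i), G (t, x)) x ∂μ :=
        setLIntegral_le_lintegral _ _
    _ = ∑' i, ∫⁻ x in layer i, (∫⁻ t in Ioo 0 (p i), G (t, x)) ∂μ := by
        rw [lintegral_tsum fun i =>
          ((measurable_section i).indicator (measurableSet_layer i)).aemeasurable]
        exact tsum_congr fun i => lintegral_indicator (measurableSet_layer i) _
    _ ≤ ∑' i, (C * 3 ^ n : ℝ≥0) * μ (boundaryLayer Q (2 * p i) (16 * p i)) :=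
        ENNReal.tsum_le_tsum fun i => hG.setLIntegral_boundaryLayer_le hGm Q (by positivity)
    _ ≤ (C * 3 ^ n : ℝ≥0) * (3 * μ Q) := by
        rw [ENNReal.tsum_mul_left]
        gcongr
        exact tsum_measure_boundaryLayer_le Q (by positivity)
    _ = _ := by
        push_cast
        ring

end IsCarlesonDensity

end Whitney

section GoodDensity

lemma tsum_pow_dist_le {r : ℝ≥0} (hr : r < 1) (j : ℕ) :
    ∑' k, (r : ℝ≥0∞) ^ j.dist k ≤ (2 * (1 - r)⁻¹ : ℝ≥0) := by
  rw [← ENNReal.summable.sum_add_tsum_nat_add' (k := j), two_mul, ENNReal.coe_add,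
    ← tsum_coe_pow hr]
  refine add_le_add ?_ (ENNReal.tsum_le_tsum fun k => le_of_eq ?_)
  · rw [← Finset.sum_range_reflect]
    refine (Finset.sum_le_sum fun k hk => ?_).trans (ENNReal.sum_le_tsum (Finset.range j))
    have dist_eq : j.dist (j - 1 - k) = k + 1 := by
      have := Finset.mem_range.1 hk
      rw [Nat.dist_eq_sub_of_le_right (by omega)]
      omega
    rw [dist_eq]
    exact pow_le_pow_of_le_one zero_le (by exact_mod_cast hr.le) (Nat.le_succ k)
  · rw [Nat.dist_eq_sub_of_le (by omega), Nat.add_sub_cancel]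

lemma setLIntegral_inv_Ioc_div_two_pow_le {L : ℝ} (hL : 0 < L) (j : ℕ) :
    ∫⁻ t in Ioc (L / 2 ^ (j + 1)) (L / 2 ^ j), (ENNReal.ofReal t)⁻¹ ≤ 1 := by
  set p := L / 2 ^ (j + 1) with hp
  have : 0 < p := by positivity
  have two_mul_p : L / 2 ^ j = 2 * p := by
    rw [hp, pow_succ]
    field_simp
  rw [two_mul_p]
  calc _ ≤ ∫⁻ _ in Ioc p (2 * p), (ENNReal.ofReal p)⁻¹ := by
        refine setLIntegral_mono' measurableSet_Ioc fun t ht => ?_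
        gcongr
        exact ht.1.le
    _ = (ENNReal.ofReal p)⁻¹ * ENNReal.ofReal p := by
        rw [setLIntegral_const, Real.volume_Ioc, two_mul, add_sub_cancel_right]
    _ ≤ 1 := ENNReal.inv_mul_le_one _

lemma pairwise_disjoint_Ioc_div_two_pow {L : ℝ} (hL : 0 < L) :
    Pairwise (Function.onFun Disjoint fun j : ℕ => Ioc (L / 2 ^ (j + 1)) (L / 2 ^ j)) := by
  have antitone : Antitone fun j : ℕ => L / 2 ^ j := fun i j hij =>
    div_le_div_of_nonneg_left hL.le (by positivity) (pow_le_pow_right₀ one_le_two hij)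
  exact antitone.pairwise_disjoint_on_Ioc_succ

variable {n : ℕ} {μ : Measure (Fin n → ℝ)} {τ L η : ℝ} {G : ℝ × (Fin n → ℝ) → ℝ≥0∞} {C M : ℝ≥0}
  {j l : ℕ}

/-- The part of a density on the upper half space over the good points at the scales
`t ∈ (L / 2 ^ (j + 1), L / 2 ^ j]`, integrated in `t`. -/
noncomputable def goodDensity (η τ L : ℝ) (G : ℝ × (Fin n → ℝ) → ℝ≥0∞) (j : ℕ) :
    (Fin n → ℝ) → ℝ≥0∞ :=
  (goodSet η τ L j).indicator fun x => ∫⁻ t in Ioc (L / 2 ^ (j + 1)) (L / 2 ^ j), G (t, x)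

lemma measurable_goodDensity (hG : Measurable G) (j : ℕ) : Measurable (goodDensity η τ L G j) :=
  Measurable.indicator hG.lintegral_prod_left' (measurableSet_goodSet η τ L j)

lemma goodDensity_le (hL : 0 < L) (hM : ∀ t, 0 < t → ∀ x, G (t, x) ≤ M * (ENNReal.ofReal t)⁻¹)
    (j : ℕ) (x : Fin n → ℝ) : goodDensity η τ L G j x ≤ M := by
  refine indicator_apply_le' (fun _ => ?_) (fun _ => zero_le)
  calc _ ≤ ∫⁻ t in Ioc (L / 2 ^ (j + 1)) (L / 2 ^ j), M * (ENNReal.ofReal t)⁻¹ :=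
        setLIntegral_mono' measurableSet_Ioc fun t ht =>
          hM t (lt_of_le_of_lt (by positivity) ht.1) x
    _ ≤ M * 1 := by
        rw [lintegral_const_mul' _ _ ENNReal.coe_ne_top]
        gcongr
        exact setLIntegral_inv_Ioc_div_two_pow_le hL j
    _ = M := mul_one _

lemma lt_infDist_of_mem_goodSet (hn : 1 ≤ n) (hL : 0 < L) (hη : 0 < η) {k : ℕ}
    {i : Fin n → ℤ} (hl : (2 / 3 : ℝ) ^ l ≤ η / 16) {x : Fin n → ℝ}
    (hxi : x ∈ gridIdx τ L k ⁻¹' {i}) (hx : x ∈ goodSet η τ L (k + l)) :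
    L / 2 ^ (k + l) < Metric.infDist x (gridIdx τ L k ⁻¹' {i})ᶜ / 8 := by
  have compl_nonempty : (gridIdx τ L k ⁻¹' {i})ᶜ.Nonempty := by
    rw [gridIdx_preimage hL]
    exact ⟨_, update_notMem_cube _ _ 0 ⟨0, hn⟩⟩
  have le_infDist : η * (3 / 4) ^ l * (L / 2 ^ k)
      ≤ Metric.infDist x (gridIdx τ L k ⁻¹' {i})ᶜ := by
    refine (Metric.le_infDist compl_nonempty).2 fun y hy => ?_
    have idx_ne : gridIdx τ L k y ≠ gridIdx τ L k x := fun h => hy (h.trans hxi)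
    simpa only [add_tsub_cancel_left, dist_comm] using
      le_dist_of_mem_goodSet hL (Nat.le_add_right k l) hx idx_ne
  have scale_le : L / 2 ^ (k + l) ≤ η / 16 * (3 / 4) ^ l * (L / 2 ^ k) :=
    calc L / 2 ^ (k + l) = (2 / 3) ^ l * (3 / 4) ^ l * (L / 2 ^ k) := by
          rw [← mul_pow, pow_add, show (2 / 3 * (3 / 4) : ℝ) = 1 / 2 by norm_num, one_div, inv_pow]
          field_simp
      _ ≤ _ := by gcongr
  have : 0 < η * (3 / 4) ^ l * (L / 2 ^ k) := by positivity
  linarith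

lemma tsum_goodDensity_add_le (hn : 1 ≤ n) (hL : 0 < L) (hη : 0 < η) {k : ℕ} {i : Fin n → ℤ}
    (hl : (2 / 3 : ℝ) ^ l ≤ η / 16) {x : Fin n → ℝ} (hxi : x ∈ gridIdx τ L k ⁻¹' {i}) :
    ∑' m, goodDensity η τ L G (k + (m + l)) x
      ≤ ∫⁻ t in Ioo 0 (Metric.infDist x (gridIdx τ L k ⁻¹' {i})ᶜ / 8), G (t, x) := by
  set d := Metric.infDist x (gridIdx τ L k ⁻¹' {i})ᶜ / 8
  set J : ℕ → Set ℝ := fun m => Ioc (L / 2 ^ (k + (m + l) + 1)) (L / 2 ^ (k + (m + l)))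
  have disjoint_J : Pairwise (Function.onFun Disjoint J) := fun m m' h =>
    pairwise_disjoint_Ioc_div_two_pow hL (by omega : k + (m + l) ≠ k + (m' + l))
  have goodDensity_le_setLIntegral (m : ℕ) :
      goodDensity η τ L G (k + (m + l)) x ≤ ∫⁻ t in J m, (Ioo 0 d).indicator (G ⟨·, x⟩) t := by
    refine indicator_apply_le' (fun hx => ?_) (fun _ => zero_le)
    have pow_le : (2 / 3 : ℝ) ^ (m + l) ≤ η / 16 :=
      (pow_le_pow_of_le_one (by norm_num) (by norm_num) (Nat.le_add_left l m)).trans hl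
    refine setLIntegral_mono' measurableSet_Ioc fun t ht => ?_
    have mem_Ioo : t ∈ Ioo 0 d := ⟨lt_of_le_of_lt (by positivity) ht.1,
      ht.2.trans_lt (lt_infDist_of_mem_goodSet hn hL hη pow_le hxi hx)⟩
    rw [indicator_of_mem mem_Ioo]
  calc _ ≤ ∑' m, ∫⁻ t in J m, (Ioo 0 d).indicator (G ⟨·, x⟩) t :=
        ENNReal.tsum_le_tsum goodDensity_le_setLIntegral
    _ = ∫⁻ t in ⋃ m, J m, (Ioo 0 d).indicator (G ⟨·, x⟩) t :=
        (lintegral_iUnion (fun _ => measurableSet_Ioc) disjoint_J _).symm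
    _ ≤ ∫⁻ t, (Ioo 0 d).indicator (G ⟨·, x⟩) t := setLIntegral_le_lintegral _ _
    _ = ∫⁻ t in Ioo 0 d, G (t, x) := lintegral_indicator measurableSet_Ioo _

theorem IsCarlesonDensity.tsum_setLIntegral_goodDensity_le [SFinite μ]
    (hG : IsCarlesonDensity μ C G) (hGm : Measurable G) (hn : 1 ≤ n) (hL : 0 < L) (hη : 0 < η)
    (hM : ∀ t, 0 < t → ∀ x, G (t, x) ≤ M * (ENNReal.ofReal t)⁻¹)
    (hl : (2 / 3 : ℝ) ^ l ≤ η / 16) (k : ℕ) (i : Fin n → ℤ) :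
    ∑' m, ∫⁻ x in gridIdx τ L k ⁻¹' {i}, goodDensity η τ L G (k + m) x ∂μ
      ≤ (l * M + 3 * 3 ^ n * C : ℝ≥0) * μ (gridIdx τ L k ⁻¹' {i}) := by
  set Q := gridIdx τ L k ⁻¹' {i} with hQ
  have measurableSet_Q : MeasurableSet Q := measurable_gridIdx τ L k (measurableSet_singleton i)
  have coarse_le : ∑ m ∈ Finset.range l, ∫⁻ x in Q, goodDensity η τ L G (k + m) x ∂μ
      ≤ (l * M : ℝ≥0) * μ Q :=
    calc _ ≤ ∑ _ ∈ Finset.range l, (M : ℝ≥0∞) * μ Q := by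
          refine Finset.sum_le_sum fun m _ => ?_
          rw [← setLIntegral_const]
          exact lintegral_mono fun x => goodDensity_le hL hM _ x
      _ = _ := by
          rw [Finset.sum_const, Finset.card_range, nsmul_eq_mul, ENNReal.coe_mul,
            ENNReal.coe_natCast, mul_assoc]
  have fine_le : ∑' m, ∫⁻ x in Q, goodDensity η τ L G (k + (m + l)) x ∂μ
      ≤ (3 * 3 ^ n * C : ℝ≥0) * μ Q :=
    calc _ = ∫⁻ x in Q, ∑' m, goodDensity η τ L G (k + (m + l)) x ∂μ :=
          (lintegral_tsum fun _ => (measurable_goodDensity hGm _).aemeasurable).symm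
      _ ≤ ∫⁻ x in Q, (∫⁻ t in Ioo 0 (Metric.infDist x Qᶜ / 8), G (t, x)) ∂μ :=
          setLIntegral_mono' measurableSet_Q fun x hx => tsum_goodDensity_add_le hn hL hη hl hx
      _ ≤ _ := by
          rw [hQ, gridIdx_preimage hL]
          exact hG.setLIntegral_cube_infDist_le hGm hn _ (by positivity)
  rw [← ENNReal.summable.sum_add_tsum_nat_add' (k := l), ENNReal.coe_add, add_mul]
  exact add_le_add coarse_le fine_le

end GoodDensity

section SquareFunction

lemma tsum_tsum_pow_dist_mul_le {r : ℝ≥0} (hr : r < 1) (N : ℕ → ℝ≥0∞) :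
    ∑' j : ℕ, ∑' k, (r : ℝ≥0∞) ^ j.dist k * N k ≤ (2 * (1 - r)⁻¹ : ℝ≥0) * ∑' k, N k := by
  rw [ENNReal.tsum_comm, ← ENNReal.tsum_mul_left]
  refine ENNReal.tsum_le_tsum fun k => ?_
  rw [ENNReal.tsum_mul_right]
  simp only [Nat.dist_comm _ k]
  gcongr
  exact tsum_pow_dist_le hr k

variable {n : ℕ} {μ : Measure (Fin n → ℝ)} {D A B c C : ℝ≥0} {α τ L η t : ℝ} {j l : ℕ}
  {s : ℝ → (Fin n → ℝ) → (Fin n → ℝ) → ℂ} {b f : (Fin n → ℝ) → ℂ} {x : Fin n → ℝ}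

lemma lintegral_levelTerm_sq_le [SFinite μ] (hα : 0 < α) (hD : D ≠ 0) (ht : 0 < t)
    {d : ℕ → (Fin n → ℝ) → ℂ} {k : ℕ} (hd : Measurable (d k)) :
    ∫⁻ x, levelTerm μ D α t d x k ^ 2 ∂μ
      ≤ (2 * ((1 - kernelRate α)⁻¹ ^ 2 * D) + 2 : ℝ≥0) * ∫⁻ x, ‖d k x‖ₑ ^ 2 ∂μ := by
  set tail := tailOp μ D (kernelRate α) t fun y => ‖d k y‖ₑ
  have measurable_tail : Measurable tail := measurable_tailOp hd.enorm t
  calc _ ≤ ∫⁻ x, (2 * tail x ^ 2 + 2 * ‖d k x‖ₑ ^ 2) ∂μ :=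
        lintegral_mono fun x => ennreal_add_sq_le _ _
    _ = 2 * ∫⁻ x, tail x ^ 2 ∂μ + 2 * ∫⁻ x, ‖d k x‖ₑ ^ 2 ∂μ := by
        rw [lintegral_add_left ((measurable_tail.pow_const 2).const_mul 2),
          lintegral_const_mul' _ _ (by finiteness), lintegral_const_mul' _ _ (by finiteness)]
    _ ≤ 2 * (((1 - kernelRate α)⁻¹ ^ 2 * D : ℝ≥0) * ∫⁻ x, ‖d k x‖ₑ ^ 2 ∂μ)
        + 2 * ∫⁻ x, ‖d k x‖ₑ ^ 2 ∂μ := by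
        gcongr
        exact lintegral_sq_tailOp_le hD (kernelRate_lt_one hα) ht hd.enorm
    _ = _ := by
        push_cast
        ring

lemma lintegral_sq_tsum_levelTerm_le [SFinite μ] (hα : 0 < α) (hD : D ≠ 0) (ht : 0 < t)
    {d : ℕ → (Fin n → ℝ) → ℂ} (hd : ∀ k, Measurable (d k)) (j : ℕ) :
    ∫⁻ x, (∑' k, (levelRate α : ℝ≥0∞) ^ j.dist k * levelTerm μ D α t d x k) ^ 2 ∂μ
      ≤ (2 * (1 - levelRate α)⁻¹ * (2 * ((1 - kernelRate α)⁻¹ ^ 2 * D) + 2) : ℝ≥0)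
        * ∑' k, (levelRate α : ℝ≥0∞) ^ j.dist k * ∫⁻ x, ‖d k x‖ₑ ^ 2 ∂μ := by
  have measurable_levelTerm (k : ℕ) : Measurable fun x => levelTerm μ D α t d x k :=
    (measurable_tailOp (hd k).enorm t).add (hd k).enorm
  set S : ℝ≥0 := 2 * (1 - levelRate α)⁻¹
  set T : ℝ≥0 := 2 * ((1 - kernelRate α)⁻¹ ^ 2 * D) + 2
  calc _ ≤ ∫⁻ x, S * ∑' k, (levelRate α : ℝ≥0∞) ^ j.dist k * levelTerm μ D α t d x k ^ 2 ∂μ := by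
        refine lintegral_mono fun x => (sq_tsum_mul_le _ _).trans ?_
        gcongr
        exact tsum_pow_dist_le (levelRate_lt_one hα) j
    _ = S * ∑' k, (levelRate α : ℝ≥0∞) ^ j.dist k * ∫⁻ x, levelTerm μ D α t d x k ^ 2 ∂μ := by
        rw [lintegral_const_mul' _ _ ENNReal.coe_ne_top, lintegral_tsum fun k =>
          (((measurable_levelTerm k).pow_const 2).const_mul _).aemeasurable]
        simp only [lintegral_const_mul _ ((measurable_levelTerm _).pow_const 2)]
    _ ≤ S * ∑' k, (levelRate α : ℝ≥0∞) ^ j.dist k * (T * ∫⁻ x, ‖d k x‖ₑ ^ 2 ∂μ) := by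
        gcongr with k
        exact lintegral_levelTerm_sq_le hα hD ht (hd k)
    _ = _ := by
        simp only [mul_left_comm _ (T : ℝ≥0∞)]
        rw [ENNReal.tsum_mul_left, ENNReal.coe_mul S T, mul_assoc]

/-- The density of the square function of `θ f` with respect to `μ` and Lebesgue measure on the
upper half space: `|θ_t f(x)|² / t`. -/
noncomputable def squareDensity (μ : Measure (Fin n → ℝ))
    (s : ℝ → (Fin n → ℝ) → (Fin n → ℝ) → ℂ) (f : (Fin n → ℝ) → ℂ) (p : ℝ × (Fin n → ℝ)) : ℝ≥0∞ :=
  ‖theta μ s f p.1 p.2‖ₑ ^ 2 * (ENNReal.ofReal p.1)⁻¹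

/-- The constant in the `L²` estimate, at the scales of one level, of the difference between
`θ_t f` and `⟨f⟩ / ⟨b⟩ * θ_t b`. -/
noncomputable def offDiagonalConst (α η : ℝ) (D A B : ℝ≥0) : ℝ≥0 :=
  2 * (A * B * levelConst α η) ^ 2
    * (2 * (1 - levelRate α)⁻¹ * (2 * ((1 - kernelRate α)⁻¹ ^ 2 * D) + 2))

/-- The constant in the Carleson condition which `goodDensity` inherits from the density
`squareDensity μ s b`: the first `l` levels below a cell are estimated by the pointwise bound of
`θ_t b`, the others by the Carleson condition with constant `C`. The summand `1` keeps it
positive. -/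
noncomputable def carlesonConst (n : ℕ) (α : ℝ) (A B C : ℝ≥0) (l : ℕ) : ℝ≥0 :=
  l * (A * (B * (1 - kernelRate α)⁻¹)) ^ 2 + 3 * 3 ^ n * C + 1

/-- The constant in the square function estimate over the good points of one grid. -/
noncomputable def goodConst (n : ℕ) (α η : ℝ) (D A B c C : ℝ≥0) (l : ℕ) : ℝ≥0 :=
  offDiagonalConst α η D A B * (2 * (1 - levelRate α)⁻¹) * adaptedConst B c
    + 2 * (4 * c⁻¹ ^ 2 * carlesonConst n α A B C l)

lemma setLIntegral_goodSet_eq_goodDensity [SFinite μ] {G : ℝ × (Fin n → ℝ) → ℝ≥0∞}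
    (hG : Measurable G) {w : (Fin n → ℝ) → ℝ≥0∞} (hw : Measurable w) (j : ℕ) :
    ∫⁻ t in Ioc (L / 2 ^ (j + 1)) (L / 2 ^ j), ∫⁻ x in goodSet η τ L j, w x * G (t, x) ∂μ
      = ∫⁻ x, w x * goodDensity η τ L G j x ∂μ := by
  rw [lintegral_lintegral_swap (f := fun t x => w x * G (t, x))
    ((hw.comp measurable_snd).mul hG).aemeasurable,
    ← lintegral_indicator (measurableSet_goodSet η τ L j)]
  refine lintegral_congr fun x => ?_
  by_cases hx : x ∈ goodSet η τ L j
  · rw [goodDensity, indicator_of_mem hx, indicator_of_mem hx,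
      lintegral_const_mul _ (f := fun t => G (t, x)) (hG.comp measurable_prodMk_right)]
  · rw [goodDensity, indicator_of_notMem hx, indicator_of_notMem hx, mul_zero]

namespace HasTailBound

lemma measurable_theta [SFinite μ] {q : ℝ≥0} (hs : HasTailBound μ D q A α s)
    (hf : Measurable f) : Measurable fun p : ℝ × (Fin n → ℝ) => theta μ s f p.1 p.2 := by
  have measurable_integrand : Measurable fun z : (ℝ × (Fin n → ℝ)) × (Fin n → ℝ) =>
      s z.1.1 z.1.2 z.2 * f z.2 :=
    (hs.measurable.comp (by fun_prop : Measurable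
      fun z : (ℝ × (Fin n → ℝ)) × (Fin n → ℝ) => (z.1.1, z.1.2, z.2))).mul
      (hf.comp measurable_snd)
  exact measurable_integrand.stronglyMeasurable.integral_prod_right'.measurable

lemma measurable_squareDensity [SFinite μ] {q : ℝ≥0}
    (hs : HasTailBound μ D q A α s) (hf : Measurable f) : Measurable (squareDensity μ s f) :=
  ((hs.measurable_theta hf).enorm.pow_const 2).mul
    (ENNReal.measurable_ofReal.comp measurable_fst).inv

lemma squareDensity_le_of_mem_goodSet (hs : HasTailBound μ D (kernelRate α) A α s) (hα : 0 < α)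
    [IsLocallyFiniteMeasure μ] (hμ : μ ≠ 0) (hL : 0 < L) (hη : 0 < η) (hb : Measurable b)
    (hB : ∀ x, ‖b x‖ₑ ≤ B) (hacc : ∀ k, IsAccretiveOn μ (gridIdx τ L k) b c) (hc : 0 < c)
    (hf : Measurable f) (hf2 : MemLp f 2 μ) (ht : t ∈ Ioc (L / 2 ^ (j + 1)) (L / 2 ^ j))
    (hx : x ∈ goodSet η τ L j) :
    squareDensity μ s f (t, x)
      ≤ (2 * (A * B * levelConst α η) ^ 2 : ℝ≥0) * (ENNReal.ofReal t)⁻¹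
          * (∑' k, (levelRate α : ℝ≥0∞) ^ j.dist k
            * levelTerm μ D α t (adaptedDiff μ (gridIdx τ L) b f) x k) ^ 2
        + 2 * (‖adaptedCoeff μ (gridIdx τ L j) b f x‖ₑ ^ 2 * squareDensity μ s b (t, x)) := by
  set K := A * B * levelConst α η
  set a := adaptedCoeff μ (gridIdx τ L j) b f x
  set Y := ∑' k, (levelRate α : ℝ≥0∞) ^ j.dist k
    * levelTerm μ D α t (adaptedDiff μ (gridIdx τ L) b f) x k
  have enorm_theta_le : ‖theta μ s f t x‖ₑ ≤ K * Y + ‖a‖ₑ * ‖theta μ s b t x‖ₑ :=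
    calc ‖theta μ s f t x‖ₑ = ‖(theta μ s f t x - a * theta μ s b t x) + a * theta μ s b t x‖ₑ := by
          rw [sub_add_cancel]
      _ ≤ _ := enorm_add_le _ _
      _ ≤ _ := by
          rw [enorm_mul]
          gcongr
          exact hs.enorm_theta_sub_le hα hμ hL hη hb hB hacc hc hf hf2 ht hx
  calc squareDensity μ s f (t, x)
      ≤ (2 * (K * Y) ^ 2 + 2 * (‖a‖ₑ * ‖theta μ s b t x‖ₑ) ^ 2) * (ENNReal.ofReal t)⁻¹ := by
        rw [squareDensity]
        gcongr
        exact (pow_le_pow_left' enorm_theta_le 2).trans (ennreal_add_sq_le _ _)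
    _ = _ := by
        simp only [squareDensity]
        push_cast
        ring

lemma setLIntegral_goodSet_squareDensity_le (hs : HasTailBound μ D (kernelRate α) A α s)
    (hα : 0 < α) (hD : D ≠ 0) [IsLocallyFiniteMeasure μ] (hμ : μ ≠ 0) (hL : 0 < L) (hη : 0 < η)
    (hb : Measurable b) (hB : ∀ x, ‖b x‖ₑ ≤ B)
    (hacc : ∀ k, IsAccretiveOn μ (gridIdx τ L k) b c) (hc : 0 < c) (hf : Measurable f)
    (hf2 : MemLp f 2 μ) (ht : t ∈ Ioc (L / 2 ^ (j + 1)) (L / 2 ^ j)) :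
    ∫⁻ x in goodSet η τ L j, squareDensity μ s f (t, x) ∂μ
      ≤ (offDiagonalConst α η D A B : ℝ≥0∞) * (∑' k, (levelRate α : ℝ≥0∞) ^ j.dist k
          * ∫⁻ x, ‖adaptedDiff μ (gridIdx τ L) b f k x‖ₑ ^ 2 ∂μ) * (ENNReal.ofReal t)⁻¹
        + 2 * ∫⁻ x in goodSet η τ L j,
          ‖adaptedCoeff μ (gridIdx τ L j) b f x‖ₑ ^ 2 * squareDensity μ s b (t, x) ∂μ := by
  have ht0 : 0 < t := lt_of_le_of_lt (by positivity) ht.1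
  have inv_ne_top : (ENNReal.ofReal t)⁻¹ ≠ ∞ := by simpa using ht0
  set K := A * B * levelConst α η with hK
  set a := adaptedCoeff μ (gridIdx τ L j) b f
  set Y : (Fin n → ℝ) → ℝ≥0∞ := fun x => ∑' k, (levelRate α : ℝ≥0∞) ^ j.dist k
    * levelTerm μ D α t (adaptedDiff μ (gridIdx τ L) b f) x k
  have measurable_diagonal : Measurable fun x => 2 * (‖a x‖ₑ ^ 2 * squareDensity μ s b (t, x)) :=
    (((measurable_adaptedCoeff (measurable_gridIdx τ L j) b f).enorm.pow_const 2).mul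
      ((hs.measurable_squareDensity hb).comp measurable_prodMk_left)).const_mul 2
  calc _ ≤ ∫⁻ x in goodSet η τ L j, ((2 * K ^ 2 : ℝ≥0) * (ENNReal.ofReal t)⁻¹ * Y x ^ 2
          + 2 * (‖a x‖ₑ ^ 2 * squareDensity μ s b (t, x))) ∂μ :=
        setLIntegral_mono' (measurableSet_goodSet η τ L j) fun x hx =>
          hs.squareDensity_le_of_mem_goodSet hα hμ hL hη hb hB hacc hc hf hf2 ht hx
    _ = (2 * K ^ 2 : ℝ≥0) * (ENNReal.ofReal t)⁻¹ * ∫⁻ x in goodSet η τ L j, Y x ^ 2 ∂μ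
          + 2 * ∫⁻ x in goodSet η τ L j, ‖a x‖ₑ ^ 2 * squareDensity μ s b (t, x) ∂μ := by
        rw [lintegral_add_right _ measurable_diagonal, lintegral_const_mul' _ _ (by finiteness),
          lintegral_const_mul' _ _ (by finiteness)]
    _ ≤ (2 * K ^ 2 : ℝ≥0) * (ENNReal.ofReal t)⁻¹ * (_ * _) + _ := by
        gcongr
        exact (setLIntegral_le_lintegral _ _).trans (lintegral_sq_tsum_levelTerm_le hα hD ht0
          (measurable_adaptedDiff (measurable_gridIdx τ L) b f) j)
    _ = _ := by
        rw [offDiagonalConst, ← hK, ENNReal.coe_mul (2 * K ^ 2)]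
        ring

lemma setLIntegral_Ioc_goodSet_squareDensity_le (hs : HasTailBound μ D (kernelRate α) A α s)
    (hα : 0 < α) (hD : D ≠ 0) [IsLocallyFiniteMeasure μ] (hμ : μ ≠ 0) (hL : 0 < L) (hη : 0 < η)
    (hb : Measurable b) (hB : ∀ x, ‖b x‖ₑ ≤ B)
    (hacc : ∀ k, IsAccretiveOn μ (gridIdx τ L k) b c) (hc : 0 < c) (hf : Measurable f)
    (hf2 : MemLp f 2 μ) (j : ℕ) :
    ∫⁻ t in Ioc (L / 2 ^ (j + 1)) (L / 2 ^ j), ∫⁻ x in goodSet η τ L j,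
        squareDensity μ s f (t, x) ∂μ
      ≤ (offDiagonalConst α η D A B : ℝ≥0∞) * (∑' k, (levelRate α : ℝ≥0∞) ^ j.dist k
          * ∫⁻ x, ‖adaptedDiff μ (gridIdx τ L) b f k x‖ₑ ^ 2 ∂μ)
        + 2 * ∫⁻ x, ‖adaptedCoeff μ (gridIdx τ L j) b f x‖ₑ ^ 2
          * goodDensity η τ L (squareDensity μ s b) j x ∂μ := by
  set R := (offDiagonalConst α η D A B : ℝ≥0∞) * ∑' k, (levelRate α : ℝ≥0∞) ^ j.dist k
    * ∫⁻ x, ‖adaptedDiff μ (gridIdx τ L) b f k x‖ₑ ^ 2 ∂μ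
  have measurable_inv : Measurable fun t : ℝ => (ENNReal.ofReal t)⁻¹ :=
    ENNReal.measurable_ofReal.inv
  refine (setLIntegral_mono' measurableSet_Ioc fun t ht =>
    hs.setLIntegral_goodSet_squareDensity_le hα hD hμ hL hη hb hB hacc hc hf hf2 ht).trans ?_
  rw [lintegral_add_left (measurable_inv.const_mul _), lintegral_const_mul _ measurable_inv,
    lintegral_const_mul' _ _ (by finiteness),
    setLIntegral_goodSet_eq_goodDensity (hs.measurable_squareDensity hb)
      ((measurable_adaptedCoeff (measurable_gridIdx τ L j) b f).enorm.pow_const 2)]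
  gcongr
  exact mul_le_of_le_one_right zero_le (setLIntegral_inv_Ioc_div_two_pow_le hL j)

lemma tsum_lintegral_adaptedCoeff_sq_mul_goodDensity_le
    (hs : HasTailBound μ D (kernelRate α) A α s) (hα : 0 < α) [IsLocallyFiniteMeasure μ]
    (hn : 1 ≤ n) (hL : 0 < L) (hη : 0 < η) (hb : Measurable b) (hB : ∀ x, ‖b x‖ₑ ≤ B)
    (hacc : ∀ k, IsAccretiveOn μ (gridIdx τ L k) b c) (hc : 0 < c)
    (hcar : IsCarlesonDensity μ C (squareDensity μ s b)) (hl : (2 / 3 : ℝ) ^ l ≤ η / 16)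
    (hf : Measurable f) :
    ∑' j, ∫⁻ x, ‖adaptedCoeff μ (gridIdx τ L j) b f x‖ₑ ^ 2
        * goodDensity η τ L (squareDensity μ s b) j x ∂μ
      ≤ (4 * c⁻¹ ^ 2 * carlesonConst n α A B C l : ℝ≥0) * ∫⁻ x, ‖f x‖ₑ ^ 2 ∂μ := by
  set G := squareDensity μ s b
  set W := carlesonConst n α A B C l with hW
  have hπ : IsRefiningPartition μ (gridIdx (n := n) τ L) := isRefiningPartition_gridIdx τ hL
  have measurable_G : Measurable G := hs.measurable_squareDensity hb
  have G_le (t : ℝ) (ht : 0 < t) (x : Fin n → ℝ) :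
      G (t, x) ≤ ((A * (B * (1 - kernelRate α)⁻¹)) ^ 2 : ℝ≥0) * (ENNReal.ofReal t)⁻¹ := by
    rw [ENNReal.coe_pow]
    exact mul_le_mul_left (pow_le_pow_left'
      (hs.enorm_theta_le_of_bounded (kernelRate_lt_one hα) ht x hb hB) 2) _
  have carleson (k : ℕ) (i : Fin n → ℤ) :
      ∑' m, ∫⁻ x in gridIdx τ L k ⁻¹' {i}, goodDensity η τ L G (k + m) x ∂μ
        ≤ W * μ (gridIdx τ L k ⁻¹' {i}) := by
    refine (hcar.tsum_setLIntegral_goodDensity_le measurable_G hn hL hη G_le hl k i).trans ?_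
    gcongr
    exact le_self_add
  have W_ne_zero : (W : ℝ≥0∞) ≠ 0 := by
    rw [hW, carlesonConst]
    positivity
  calc _ ≤ ∑' j, (c⁻¹ ^ 2 : ℝ≥0) * ∫⁻ x, cellLAverage μ (gridIdx τ L j) (fun y => ‖f y‖ₑ) x ^ 2
        * goodDensity η τ L G j x ∂μ := by
        refine ENNReal.tsum_le_tsum fun j => ?_
        rw [← lintegral_const_mul' _ _ ENNReal.coe_ne_top]
        refine lintegral_mono fun x => ?_
        rw [← mul_assoc, ENNReal.coe_pow, ← mul_pow]
        gcongr
        exact ((hacc j).enorm_adaptedCoeff_le hc (hπ.level j) f x).trans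
          (mul_le_mul_right (enorm_cellAverage_le f x) _)
    _ ≤ (c⁻¹ ^ 2 : ℝ≥0) * (4 * W * ∫⁻ x, ‖f x‖ₑ ^ 2 ∂μ) := by
        rw [ENNReal.tsum_mul_left]
        gcongr
        exact hπ.carleson_embedding (measurable_goodDensity measurable_G) W_ne_zero
          ENNReal.coe_ne_top carleson hf.enorm.aemeasurable
    _ = _ := by
        push_cast
        ring

theorem tsum_setLIntegral_goodSet_squareDensity_le (hs : HasTailBound μ D (kernelRate α) A α s)
    (hα : 0 < α) (hD : D ≠ 0) [IsLocallyFiniteMeasure μ] (hμ : μ ≠ 0) (hn : 1 ≤ n) (hL : 0 < L)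
    (hη : 0 < η) (hb : Measurable b) (hB0 : 0 < B) (hB : ∀ x, ‖b x‖ₑ ≤ B)
    (hacc : ∀ k, IsAccretiveOn μ (gridIdx τ L k) b c) (hc : 0 < c)
    (hcar : IsCarlesonDensity μ C (squareDensity μ s b)) (hl : (2 / 3 : ℝ) ^ l ≤ η / 16)
    (hf : Measurable f) (hf2 : MemLp f 2 μ) :
    ∑' j : ℕ, ∫⁻ t in Ioc (L / 2 ^ (j + 1)) (L / 2 ^ j), ∫⁻ x in goodSet η τ L j,
        squareDensity μ s f (t, x) ∂μ
      ≤ goodConst n α η D A B c C l * ∫⁻ x, ‖f x‖ₑ ^ 2 ∂μ := by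
  set K := offDiagonalConst α η D A B with hK
  set N : ℕ → ℝ≥0∞ := fun k => ∫⁻ x, ‖adaptedDiff μ (gridIdx τ L) b f k x‖ₑ ^ 2 ∂μ
  set diagonal : ℕ → ℝ≥0∞ := fun j => ∫⁻ x, ‖adaptedCoeff μ (gridIdx τ L j) b f x‖ₑ ^ 2
    * goodDensity η τ L (squareDensity μ s b) j x ∂μ
  calc _ ≤ ∑' j : ℕ, ((K : ℝ≥0∞) * (∑' k, (levelRate α : ℝ≥0∞) ^ j.dist k * N k)
          + 2 * diagonal j) :=
        ENNReal.tsum_le_tsum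
          (hs.setLIntegral_Ioc_goodSet_squareDensity_le hα hD hμ hL hη hb hB hacc hc hf hf2)
    _ = K * (∑' j : ℕ, ∑' k, (levelRate α : ℝ≥0∞) ^ j.dist k * N k) + 2 * ∑' j, diagonal j := by
        rw [ENNReal.tsum_add, ENNReal.tsum_mul_left, ENNReal.tsum_mul_left]
    _ ≤ K * ((2 * (1 - levelRate α)⁻¹ : ℝ≥0) * (adaptedConst B c * ∫⁻ x, ‖f x‖ₑ ^ 2 ∂μ))
        + 2 * ((4 * c⁻¹ ^ 2 * carlesonConst n α A B C l : ℝ≥0) * ∫⁻ x, ‖f x‖ₑ ^ 2 ∂μ) := by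
        gcongr
        · exact (tsum_tsum_pow_dist_mul_le (levelRate_lt_one hα) N).trans (mul_le_mul_right
            ((isRefiningPartition_gridIdx τ hL).tsum_lintegral_adaptedDiff_sq_le
              hb hB0 hB hacc hc hf2) _)
        · exact hs.tsum_lintegral_adaptedCoeff_sq_mul_goodDensity_le hα hn hL hη hb hB hacc hc
            hcar hl hf
    _ = _ := by
        rw [goodConst, ← hK]
        push_cast
        ring

end HasTailBound

end SquareFunction

section Main

lemma setLIntegral_Ioc_le_tsum_Ioc_div_two_pow (F : ℝ → ℝ≥0∞) (L : ℝ) :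
    ∫⁻ t in Ioc 0 L, F t ≤ ∑' j : ℕ, ∫⁻ t in Ioc (L / 2 ^ (j + 1)) (L / 2 ^ j), F t :=
  (lintegral_mono_set fun _ ht => mem_iUnion.2 (exists_mem_Ioc_div_two_pow ht)).trans
    (lintegral_iUnion_le _ _)

lemma setLIntegral_Ioi_le_of_forall_Ioc {F : ℝ → ℝ≥0∞} {M : ℝ≥0∞}
    (h : ∀ L : ℝ, 0 < L → ∫⁻ t in Ioc 0 L, F t ≤ M) : ∫⁻ t in Ioi 0, F t ≤ M := by
  have Ioi_eq : Ioi (0 : ℝ) = ⋃ N : ℕ, Ioc 0 (N + 1 : ℝ) := by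
    refine (iUnion_Ioc_eq_Ioi_self_iff.2 fun t _ => ?_).symm
    obtain ⟨N, hN⟩ := exists_nat_ge t
    exact ⟨N, hN.trans (le_add_of_nonneg_right zero_le_one)⟩
  have monotone : Monotone fun N : ℕ => Ioc 0 (N + 1 : ℝ) := fun i j hij =>
    Ioc_subset_Ioc_right (by gcongr)
  rw [Ioi_eq, setLIntegral_iUnion_of_directed _ monotone.directed_le]
  exact iSup_le fun N => h _ (by positivity)

lemma exists_measurable_ae_eq_enorm_le {X E : Type*} [MeasurableSpace X] {μ : Measure X}
    [NormedAddCommGroup E] [MeasurableSpace E] [BorelSpace E] {b : X → E}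
    (hb : AEStronglyMeasurable b μ) {B : ℝ≥0} (hB : eLpNorm b ∞ μ ≤ B) :
    ∃ g : X → E, Measurable g ∧ g =ᵐ[μ] b ∧ ∀ x, ‖g x‖ₑ ≤ B := by
  set S := {x | ‖hb.mk b x‖ₑ ≤ B} with hS
  have measurable_mk : Measurable (hb.mk b) := hb.stronglyMeasurable_mk.measurable
  refine ⟨S.indicator (hb.mk b),
    measurable_mk.indicator (measurableSet_le measurable_mk.enorm measurable_const), ?_,
    fun x => ?_⟩
  · filter_upwards [hb.ae_eq_mk, enorm_ae_le_eLpNormEssSup b μ] with x mk_eq enorm_le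
    rw [indicator_of_mem, mk_eq]
    rw [hS, mem_ofPred_eq, ← mk_eq]
    exact enorm_le.trans (by rwa [← eLpNorm_exponent_top])
  · by_cases hx : x ∈ S
    · rwa [indicator_of_mem hx]
    · rw [indicator_of_notMem hx, enorm_zero]
      exact zero_le

variable {n : ℕ} {μ : Measure (Fin n → ℝ)} {D A B c C : ℝ≥0} {α η : ℝ} {l : ℕ}
  {s : ℝ → (Fin n → ℝ) → (Fin n → ℝ) → ℂ} {b f g : (Fin n → ℝ) → ℂ}

theorem HasTailBound.lintegral_squareDensity_le (hs : HasTailBound μ D (kernelRate α) A α s)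
    (hα : 0 < α) (hD : D ≠ 0) [IsLocallyFiniteMeasure μ] (hμ : μ ≠ 0) (hn : 1 ≤ n) (hη : 0 < η)
    (hη' : 48 * n * η ≤ 1) (hb : Measurable b) (hB0 : 0 < B) (hB : ∀ x, ‖b x‖ₑ ≤ B)
    (hacc : ∀ (a : Fin n → ℝ) (l : ℝ), 0 < l → c * μ (cube a l) ≤ ‖∫ x in cube a l, b x ∂μ‖ₑ)
    (hc : 0 < c) (hcar : IsCarlesonDensity μ C (squareDensity μ s b))
    (hl : (2 / 3 : ℝ) ^ l ≤ η / 16) (hf : Measurable f) (hf2 : MemLp f 2 μ) :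
    ∫⁻ t in Ioi 0, ∫⁻ x, squareDensity μ s f (t, x) ∂μ
      ≤ (2 * goodConst n α η D A B c C l : ℝ≥0) * ∫⁻ x, ‖f x‖ₑ ^ 2 ∂μ := by
  refine setLIntegral_Ioi_le_of_forall_Ioc fun L hL =>
    (setLIntegral_Ioc_le_tsum_Ioc_div_two_pow _ L).trans ?_
  rw [ENNReal.coe_mul, mul_assoc]
  refine tsum_lintegral_le_of_goodSet hL hη.le hη' (hs.measurable_squareDensity hf) _ fun τ => ?_
  have accretive (k : ℕ) : IsAccretiveOn μ (gridIdx τ L k) b c := fun i => by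
    rw [gridIdx_preimage hL]
    exact hacc _ _ (by positivity)
  exact hs.tsum_setLIntegral_goodSet_squareDensity_le hα hD hμ hn hL hη hb hB0 hB accretive hc
    hcar hl hf hf2

lemma theta_congr_ae (hfg : f =ᵐ[μ] g) : theta μ s f = theta μ s g := by
  ext t x
  refine integral_congr_ae ?_
  filter_upwards [hfg] with y hy
  rw [hy]

lemma setLIntegral_theta_div_eq_squareDensity (hfg : f =ᵐ[μ] g) {I : Set ℝ}
    (hI : MeasurableSet I) (hI0 : I ⊆ Ioi 0) (ν : Measure (Fin n → ℝ)) :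
    ∫⁻ t in I, (∫⁻ x, ‖theta μ s f t x‖ₑ ^ 2 ∂ν) / ENNReal.ofReal t
      = ∫⁻ t in I, ∫⁻ x, squareDensity μ (positiveTimeKernel s) g (t, x) ∂ν := by
  refine setLIntegral_congr_fun hI fun t ht => ?_
  have inv_ne_top : (ENNReal.ofReal t)⁻¹ ≠ ∞ := by simpa using hI0 ht
  simp only [squareDensity, theta_congr_ae hfg, theta_positiveTimeKernel g (hI0 ht)]
  rw [lintegral_mul_const' _ _ inv_ne_top, div_eq_mul_inv]

lemma isCarlesonDensity_squareDensity_positiveTimeKernel (hbg : b =ᵐ[μ] g)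
    (h : ∀ (a : Fin n → ℝ) (l : ℝ), 0 < l →
      ∫⁻ t in Ioo 0 l, (∫⁻ x in cube a l, ‖theta μ s b t x‖ₑ ^ 2 ∂μ) / ENNReal.ofReal t
        ≤ C * μ (cube (fun i => a i - l) (3 * l))) :
    IsCarlesonDensity μ C (squareDensity μ (positiveTimeKernel s) g) := fun a l hl => by
  rw [← setLIntegral_theta_div_eq_squareDensity hbg measurableSet_Ioo Ioo_subset_Ioi_self]
  exact h a l hl

namespace IsSquareKernel

variable {lam : (Fin n → ℝ) → ℝ → ℝ} {Clam Cs : ℝ}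

lemma integrable_of_memLp (hs : IsSquareKernel lam α Cs s) (hlam : IsUpperDoubling μ lam Clam)
    (hα : 0 < α) {t : ℝ} (ht : 0 < t) (x : Fin n → ℝ) (hf : MemLp f 2 μ) :
    Integrable (fun y => s t x y * f y) μ := by
  rcases eq_or_ne μ 0 with rfl | hμ
  · exact integrable_zero_measure
  obtain ⟨g, hg, hfg⟩ := hf.1.aemeasurable
  refine ((hs.hasTailBound hlam hα).integrable_of_memLp (kernelRate_lt_one hα) hμ ht x hg
    (hf.ae_eq hfg)).congr ?_
  filter_upwards [hfg] with y hy
  simp only [positiveTimeKernel, if_pos ht, hy]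

theorem lintegral_theta_div_le (hs : IsSquareKernel lam α Cs s) (hlam : IsUpperDoubling μ lam Clam)
    (hα : 0 < α) (hn : 1 ≤ n) (hη : 0 < η) (hη' : 48 * n * η ≤ 1)
    (hl : (2 / 3 : ℝ) ^ l ≤ η / 16) (hb : AEStronglyMeasurable b μ) (hB0 : 0 < B)
    (hB : eLpNorm b ∞ μ ≤ B) (hc : 0 < c)
    (hacc : ∀ (a : Fin n → ℝ) (l : ℝ), 0 < l → c * μ (cube a l) ≤ ‖∫ x in cube a l, b x ∂μ‖ₑ)
    (hcar : ∀ (a : Fin n → ℝ) (l : ℝ), 0 < l →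
      ∫⁻ t in Ioo 0 l, (∫⁻ x in cube a l, ‖theta μ s b t x‖ₑ ^ 2 ∂μ) / ENNReal.ofReal t
        ≤ C * μ (cube (fun i => a i - l) (3 * l)))
    (hf : MemLp f 2 μ) :
    ∫⁻ t in Ioi 0, (∫⁻ x, ‖theta μ s f t x‖ₑ ^ 2 ∂μ) / ENNReal.ofReal t
      ≤ (2 * goodConst n α η Clam.toNNReal (Cs.toNNReal * (Clam.toNNReal * 2 ^ α)) B c C l : ℝ≥0)
        * eLpNorm f 2 μ ^ 2 := by
  rcases eq_or_ne μ 0 with rfl | hμ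
  · simp only [lintegral_zero_measure, ENNReal.zero_div, lintegral_zero, zero_le]
  have := hlam.isLocallyFiniteMeasure
  have Clam_ne_zero := (Real.toNNReal_pos.2 (one_pos.trans_le hlam.one_le)).ne'
  obtain ⟨f', measurable_f', f_ae_eq⟩ := hf.1.aemeasurable
  obtain ⟨b', measurable_b', b_ae_eq, enorm_b'_le⟩ := exists_measurable_ae_eq_enorm_le hb hB
  have accretive (a : Fin n → ℝ) (l : ℝ) (hl : 0 < l) :
      c * μ (cube a l) ≤ ‖∫ x in cube a l, b' x ∂μ‖ₑ := by
    rw [integral_congr_ae (ae_restrict_of_ae b_ae_eq)]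
    exact hacc a l hl
  rw [setLIntegral_theta_div_eq_squareDensity f_ae_eq measurableSet_Ioi subset_rfl,
    eLpNorm_congr_ae f_ae_eq, eLpNorm_two_sq]
  exact (hs.hasTailBound hlam hα).lintegral_squareDensity_le hα Clam_ne_zero hμ hn hη hη'
    measurable_b' hB0 enorm_b'_le accretive hc
    (isCarlesonDensity_squareDensity_positiveTimeKernel b_ae_eq.symm hcar) hl measurable_f'
    (hf.ae_eq f_ae_eq)

end IsSquareKernel

end Main

theorem theorem1p1 (n : ℕ) (hn : 1 ≤ n) (α Clam Cs B c Ccar : ℝ) (hα : 0 < α) (hc : 0 < c) :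
    ∃ C : ℝ, ∀ (μ : Measure (Fin n → ℝ)) (lam : (Fin n → ℝ) → ℝ → ℝ)
      (s : ℝ → (Fin n → ℝ) → (Fin n → ℝ) → ℂ) (b : (Fin n → ℝ) → ℂ),
      IsUpperDoubling μ lam Clam →
      IsSquareKernel lam α Cs s →
      MemLp b ∞ μ → eLpNorm b ∞ μ ≤ ENNReal.ofReal B →
      (∀ (a : Fin n → ℝ) (l : ℝ), 0 < l →
        ENNReal.ofReal c * μ (cube a l) ≤ ‖∫ x in cube a l, b x ∂μ‖ₑ) →
      (∀ (a : Fin n → ℝ) (l : ℝ), 0 < l →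
        ∫⁻ t in Ioo 0 l, (∫⁻ x in cube a l, ‖theta μ s b t x‖ₑ ^ 2 ∂μ) / ENNReal.ofReal t
          ≤ ENNReal.ofReal Ccar * μ (cube (fun i => a i - l) (3 * l))) →
      ∀ f : (Fin n → ℝ) → ℂ, MemLp f 2 μ →
        (∀ t : ℝ, 0 < t → ∀ x, Integrable (fun y => s t x y * f y) μ) ∧
        ∫⁻ t in Ioi (0 : ℝ), (∫⁻ x, ‖theta μ s f t x‖ₑ ^ 2 ∂μ) / ENNReal.ofReal t
          ≤ ENNReal.ofReal C * eLpNorm f 2 μ ^ 2 := by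
  have : (0 : ℝ) < n := by exact_mod_cast hn
  obtain ⟨l, hl⟩ := exists_pow_lt_of_lt_one (show 0 < 1 / (48 * n : ℝ) / 16 by positivity)
    (show (2 / 3 : ℝ) < 1 by norm_num)
  refine ⟨(2 * goodConst n α (1 / (48 * n)) Clam.toNNReal (Cs.toNNReal * (Clam.toNNReal * 2 ^ α))
    (max B.toNNReal 1) c.toNNReal Ccar.toNNReal l : ℝ≥0),
    fun μ lam s b hlam hs hb hbB hacc hcar f hf =>
      ⟨fun t ht x => hs.integrable_of_memLp hlam hα ht x hf, ?_⟩⟩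
  have b_le : eLpNorm b ∞ μ ≤ (max B.toNNReal 1 : ℝ≥0) :=
    hbB.trans (ENNReal.coe_le_coe.2 (le_max_left B.toNNReal 1))
  rw [ENNReal.ofReal_coe_nnreal]
  exact hs.lintegral_theta_div_le hlam hα hn (by positivity)
    (mul_one_div_cancel (by positivity)).le hl.le hb.1 (lt_max_of_lt_right one_pos) b_le
    (Real.toNNReal_pos.2 hc) hacc hcar hf
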